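/- Fix the angular velocity $\Omega=1$. For $b\in\mathbb R$ and $2\pi$-periodic functions $g,r:\mathbb R\to\mathbb R$ with $1+r>0$, consider the vortex sheet on the curve $z(\theta)=(1+r(\theta))(\cos\theta,\sin\theta)$ with strength $\gamma(\theta)=b+g(\theta)$. Write $P_0h=\frac1{2\pi}\int_{-\pi}^{\pi}h$ and $$D(\theta,\eta)=(1+r(\theta))^2+(1+r(\eta))^2-2(1+r(\theta))(1+r(\eta))\cos(\theta-\eta).$$ The sheet rotates uniformly with angular velocity $\Omega$ if $\mathcal F(b,g,r)=(\mathcal F_1,\mathcal F_2)=(0,0)$, where $$\mathcal F_1(\theta)=\mathrm{PV}\,\frac1{2\pi}\int_{-\pi}^{\pi} (b+g(\eta))\frac{\big(r'(\theta)\cos(\theta-\eta)-(1+r(\theta))\sin(\theta-\eta)\big)(1+r(\eta))-(1+r(\theta))r'(\theta)}{D(\theta,\eta)}\,d\eta+\Omega r'(\theta)(1+r(\theta)),$$ $\mathcal F_2=(I-P_0)\tilde{\mathcal F}_2$ and $$\tilde{\mathcal F}_2(\theta)=\frac{b+g(\theta)}{r'(\theta)^2+(1+r(\theta))^2}\left[\frac1{2\pi}\int_{-\pi}^{\pi}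 (b+g(\eta))\frac{(1+r(\theta))^2-\big(r'(\theta)\sin(\theta-\eta)+(1+r(\theta))\cos(\theta-\eta)\big)(1+r(\eta))}{D(\theta,\eta)}\,d\eta-\Omega(1+r(\theta))^2\right].$$ For $k\in\mathbb N$ and $c>0$ let $X^k_c$ be the space of functions $f$, analytic in the closed strip $|\mathrm{Im}\,z|\le c$, with an expansion $f(\theta)=\sum_{n\ge1}a_n\cos(2n\theta)$, $a_n\in\mathbb R$, and $$\|f\|_{X^k_c}^2=\sum_{\pm}\int_{-\pi}^{\pi}|f(\theta\pm ic)|^2+|\partial^kf(\theta\pm ic)|^2\,d\theta<\infty.$$ There is $c_0>0$ such that for every integer $k\ge3$, every $0<c<c_0$, and each of the two slopes $m=\pm\frac12$ (the solutions of $1-4m^2=0$) there are $\delta>0$ and a continuous curve $$(-\delta,\delta)\ni x\mapsto(b,g,r)=(2+x,g_x,r_x)\in\mathbb R\times X^k_c\times X^{k+1}_c$$ with $(g_0,r_0)=(0,0)$, such that for all $x\in(-\delta,\delta)$ one has $1+r_x>0$ and $\mathcal F(2+x,g_x,r_x)=(0,0)$, with $(g_x,r_x)\ne(0,0)$ for $x\neq0$.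 That is, the curve bifurcates from the circle with constant strength at $(b,g,r)=(2,0,0)$. Moreover $\frac1\pi\int_{-\pi}^{\pi}r_x(\theta)\cos(2\theta)\,d\theta=x\,(m+o(1))$ as $x\to0$; i.e. in the coordinates $x=b-2$ and $y=$ the $\cos(2\theta)$-coefficient of $r$, the two curves are tangent at the origin to the two lines of $x^2-4y^2=0$. -/

import Mathlib

open Set Filter Topology

noncomputable section

namespace VortexSheet

/-! ### Principal values of `2π`-periodic integrands -/

/-- The points of the period centred at `θ` at distance more than `ε` from `θ`. -/
def puncturedPeriod (θ ε : ℝ) : Set ℝ := {η | ε < |η - θ| ∧ |η - θ| ≤ Real.pi}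

/-- The mean over one period with the `ε`-neighbourhood of `θ` cut out. The period is centred at
the singularity `θ`; for a `2π`-periodic `h` this is the integral over the circle. -/
def truncMean (h : ℝ → ℝ) (θ ε : ℝ) : ℝ :=
  (2 * Real.pi)⁻¹ * ∫ η in puncturedPeriod θ ε, h η

/-- The principal value `PV ⨍ h(η) dη` with singularity at `η = θ`. -/
def pvMean (h : ℝ → ℝ) (θ : ℝ) : ℝ :=
  limUnder (𝓝[>] (0 : ℝ)) (truncMean h θ)

/-- The principal value of `h` at `θ` exists. -/
def PVExists (h : ℝ → ℝ) (θ : ℝ) : Prop :=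
  (∀ ε : ℝ, 0 < ε → MeasureTheory.IntegrableOn h (puncturedPeriod θ ε)) ∧
    ∃ L : ℝ, Tendsto (truncMean h θ) (𝓝[>] 0) (𝓝 L)

/-- The mean `P₀ h = (1/2π) ∫_{-π}^{π} h`. -/
def mean (h : ℝ → ℝ) : ℝ := (2 * Real.pi)⁻¹ * ∫ η in (-Real.pi)..Real.pi, h η

/-! ### The equations of a uniformly rotating vortex sheet

The sheet is the curve `z(θ) = (1 + r(θ)) (cos θ, sin θ)` with strength `γ(θ) = b + g(θ)`. -/

/-- `|z(θ) - z(η)|²`. -/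
def distSq (r : ℝ → ℝ) (θ η : ℝ) : ℝ :=
  (1 + r θ) ^ 2 + (1 + r η) ^ 2 - 2 * (1 + r θ) * (1 + r η) * Real.cos (θ - η)

/-- The integrand (in `η`) of the first component. -/
def kernel₁ (b : ℝ) (g r : ℝ → ℝ) (θ η : ℝ) : ℝ :=
  (b + g η) *
    (((deriv r θ * Real.cos (θ - η) - (1 + r θ) * Real.sin (θ - η)) * (1 + r η)
      - (1 + r θ) * deriv r θ) / distSq r θ η)

/-- The integrand (in `η`) of the second component; its singularity at `η = θ` is removable. -/
def kernel₂ (b : ℝ) (g r : ℝ → ℝ) (θ η : ℝ) : ℝ :=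
  (b + g η) *
    (((1 + r θ) ^ 2
      - (deriv r θ * Real.sin (θ - η) + (1 + r θ) * Real.cos (θ - η)) * (1 + r η))
        / distSq r θ η)

/-- The first component `𝓕₁`: the normal component of the velocity in the rotating frame. -/
def F₁ (Ω b : ℝ) (g r : ℝ → ℝ) (θ : ℝ) : ℝ :=
  pvMean (kernel₁ b g r θ) θ + Ω * deriv r θ * (1 + r θ)

/-- The tangential expression `𝓕̃₂`. -/
def F₂tilde (Ω b : ℝ) (g r : ℝ → ℝ) (θ : ℝ) : ℝ :=
  mean (kernel₂ b g r θ) * ((b + g θ) / (deriv r θ ^ 2 + (1 + r θ) ^ 2))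
    - Ω * (1 + r θ) ^ 2 * ((b + g θ) / (deriv r θ ^ 2 + (1 + r θ) ^ 2))

/-- The second component `𝓕₂ = (I - P₀) 𝓕̃₂`. -/
def F₂ (Ω b : ℝ) (g r : ℝ → ℝ) (θ : ℝ) : ℝ :=
  F₂tilde Ω b g r θ - mean (F₂tilde Ω b g r)

/-- `𝓕(b, g, r) = (0, 0)`, where the radius `1 + r` is positive (so that the sheet is a simple
closed curve) and all the integrals in `𝓕` exist. -/
structure IsSolution (Ω b : ℝ) (g r : ℝ → ℝ) : Prop where
  radius_pos : ∀ θ, 0 < 1 + r θ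
  pv_exists : ∀ θ, PVExists (kernel₁ b g r θ) θ
  integrable₂ : ∀ θ, IntervalIntegrable (kernel₂ b g r θ) MeasureTheory.volume
    (-Real.pi) Real.pi
  integrable_tilde : IntervalIntegrable (F₂tilde Ω b g r) MeasureTheory.volume
    (-Real.pi) Real.pi
  eq₁ : ∀ θ, F₁ Ω b g r θ = 0
  eq₂ : ∀ θ, F₂ Ω b g r θ = 0

/-! ### The analytic function spaces -/

/-- The closed strip `|Im z| ≤ c`. -/
def strip (c : ℝ) : Set ℂ := {z | |z.im| ≤ c}

/-- `θ ↦ |f(θ + iy)|² + |∂ᵏ f(θ + iy)|²`. -/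
def energyDensity (k : ℕ) (f : ℂ → ℂ) (y θ : ℝ) : ℝ :=
  ‖f (θ + y * Complex.I)‖ ^ 2 + ‖iteratedDeriv k f (θ + y * Complex.I)‖ ^ 2

/-- The square of the norm of the spaces below. -/
def stripNormSq (k : ℕ) (c : ℝ) (f : ℂ → ℂ) : ℝ :=
  (∫ θ in (-Real.pi)..Real.pi, energyDensity k f c θ) +
    ∫ θ in (-Real.pi)..Real.pi, energyDensity k f (-c) θ

/-- The space `X^k_c`: functions that are analytic in the closed strip `|Im z| ≤ c`, have an
expansion `f(θ) = ∑_{n ≥ 1} aₙ cos(2nθ)` with real coefficients, and satisfy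
`∑_± ∫_{-π}^{π} |f(θ ± ic)|² + |∂ᵏ f(θ ± ic)|² dθ < ∞`.
The coefficient with index `n : ℕ` below belongs to the mode `2(n + 1)`. -/
def X (k : ℕ) (c : ℝ) : Set (ℂ → ℂ) :=
  {f | AnalyticOnNhd ℂ f (strip c) ∧
    (∃ a : ℕ → ℝ, ∀ θ : ℝ,
      HasSum (fun n : ℕ => ((a n * Real.cos (2 * (n + 1) * θ) : ℝ) : ℂ)) (f θ)) ∧
    IntervalIntegrable (energyDensity k f c) MeasureTheory.volume (-Real.pi) Real.pi ∧
    IntervalIntegrable (energyDensity k f (-c)) MeasureTheory.volume (-Real.pi) Real.pi}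

/-- The restriction to the real line; elements of `X k c` are real there. -/
def onReal (f : ℂ → ℂ) (θ : ℝ) : ℝ := (f θ).re

/-- The coefficient of `cos(2θ)` in the Fourier expansion. -/
def modeTwo (f : ℝ → ℝ) : ℝ :=
  Real.pi⁻¹ * ∫ θ in (-Real.pi)..Real.pi, f θ * Real.cos (2 * θ)

end VortexSheet

end

/-! Put ζ = e^{iθ}, ξ = ζ², t = e^{i(η-θ)} and z = ζ(1+r). Then z(θ) - z(η) = ζ(1-t)Q, where Q is
the divided difference of ζ(1+r), invertible for small r. The complex velocity is thus obtained from
one linear operator, `pvOp`: the principal value mean of h/(1-t), which multiplies t^j by -1/2 for j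
≥ 1 and by 1/2 for j ≤ 0. Multiplication of γQ⁻¹/(1-t) by r' + i(1+r) gives `-kernel₁ + i kernel₂`
(`kernel_eq`). With γ = b+g, 𝓕 = 0 therefore follows from the single complex equation γ(V - (1+r)) =
λ(1 + r - ζ∂_ζ r), where V = `pvOp`(γQ⁻¹), γ ≠ 0 and λ is the constant value of 𝓕̃₂ (`isSolution`).
All Laurent coefficients in ξ are real: even parts carry cosines, odd parts i times sines.

For b = 2+s the circle is a solution with λ = s + s²/2. At b = 2 the linear part annihilates cos 2θ
and also misses it in its range. The reduced equation is to leading order a multiple of y(x² - 4y²);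
it has no xy term, so the usual transversality condition fails. A blow-up replaces it: r = s(2Y cos
2θ + sR), strength perturbation s²g, λ = s(1+sν). The equation becomes s² times `leading + s •
remainder` (`equation_expansion`). The cos 2θ mode of `leading` vanishes identically, so this mode
is divided by s once more.

At s = 0 the outcome is an explicit polynomial system (`rescaled_zero`). Three components give ν =
1/2 - 4Y², g = 4Y e₀ - 32Y² e₁ and u = 6Y² e₀; the remaining one then reads 2Y(1 - 16Y²) = 0. The
root Y = 0 is the circle. The roots Y = ±1/4 are simple, so the linearisation is invertible
(`isInvertible_fderiv_rescaled`) and the implicit function theorem in s gives the two branches. The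
cos 2θ coefficient of r is 2sY, whence the slope 2Y = ±1/2.

The spaces are ℓ¹ algebras with weight 2^|k|: products and inverses are smooth there, and their
elements extend to |Im z| < (log 2)/2, where Cauchy estimates control every norm of X^k_c. The
unknown u consists of the coefficients of R multiplied by their order, which compensates for the
derivative lost in Q. The other analytic ingredient is that the formal operator `pvOp` really
computes the principal value (`integral_divided_eval₂`). -/

noncomputable section

namespace VortexSheet

/-! ### Linear maps on `ℓ¹` -/

/-- The real space `ℓ¹(ι)`. -/
abbrev L1 (ι : Type*) : Type _ := lp (fun _ : ι => ℝ) 1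

namespace L1

variable {ι : Type*} {F : Type*} [NormedAddCommGroup F] [NormedSpace ℝ F]

theorem add_coord (a b : L1 ι) (i : ι) : (a + b) i = a i + b i := rfl

theorem sub_coord (a b : L1 ι) (i : ι) : (a - b) i = a i - b i := rfl

theorem neg_coord (a : L1 ι) (i : ι) : (-a) i = -a i := rfl

theorem smul_coord (c : ℝ) (a : L1 ι) (i : ι) : (c • a) i = c * a i := rfl

theorem hasSum_norm_coord (a : L1 ι) : HasSum (fun i => |a i|) ‖a‖ := by
  simpa using lp.hasSum_norm (p := 1) (by simp) a

theorem summable_smul [CompleteSpace F] (a : L1 ι) {v : ι → F} {C : ℝ} (hv : ∀ i, ‖v i‖ ≤ C) :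
    Summable fun i => a i • v i := by
  refine Summable.of_norm_bounded ((hasSum_norm_coord a).summable.mul_right C) fun i => ?_
  rw [norm_smul, Real.norm_eq_abs]
  exact mul_le_mul_of_nonneg_left (hv i) (abs_nonneg _)

/-- The continuous linear map on `ℓ¹` with prescribed bounded values on the unit vectors. -/
def lift [CompleteSpace F] (v : ι → F) (C : ℝ) (hv : ∀ i, ‖v i‖ ≤ C) : L1 ι →L[ℝ] F :=
  LinearMap.mkContinuous
    { toFun := fun a => ∑' i, a i • v i
      map_add' := fun a b => by
        rw [← (summable_smul a hv).tsum_add (summable_smul b hv)]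
        exact tsum_congr fun i => by simp [add_smul]
      map_smul' := fun c a => by
        rw [RingHom.id_apply, ← (summable_smul a hv).tsum_const_smul]
        exact tsum_congr fun i => by simp [mul_smul] } C fun a => by
    have h := tsum_of_norm_bounded ((hasSum_norm_coord a).mul_left C) (f := fun i => a i • v i)
      fun i => by
        rw [norm_smul, Real.norm_eq_abs, mul_comm]
        exact mul_le_mul_of_nonneg_right (hv i) (abs_nonneg _)
    simpa using h

theorem hasSum_lift [CompleteSpace F] {v : ι → F} {C : ℝ} (hv : ∀ i, ‖v i‖ ≤ C) (a : L1 ι) :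
    HasSum (fun i => a i • v i) (lift v C hv a) :=
  (summable_smul a hv).hasSum

/-- The coordinates on `ℓ¹`. -/
def coord (i : ι) : L1 ι →L[ℝ] ℝ :=
  LinearMap.mkContinuous
    { toFun := fun a => a i
      map_add' := fun a b => by simp
      map_smul' := fun c a => by simp } 1 fun a => by
    rw [one_mul]
    exact lp.norm_apply_le_norm (by simp) a i

@[simp]
theorem coord_apply (i : ι) (a : L1 ι) : coord i a = a i := rfl

variable [DecidableEq ι]

/-- The unit vectors of `ℓ¹`. -/
abbrev unit (i : ι) : L1 ι := lp.single 1 i (1 : ℝ)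

@[simp]
theorem lift_unit [CompleteSpace F] {v : ι → F} {C : ℝ} (hv : ∀ i, ‖v i‖ ≤ C) (i : ι) :
    lift v C hv (unit i) = v i := by
  have h := hasSum_lift hv (unit i)
  have h' : HasSum (fun j => (unit i : L1 ι) j • v j) ((unit i : L1 ι) i • v i) :=
    hasSum_single i fun j hj => by
      simp [unit, Pi.single_eq_of_ne hj]
  simpa [unit] using h.unique h'

theorem hasSum_unit (a : L1 ι) : HasSum (fun i => a i • (unit i : L1 ι)) a := by
  have h := lp.hasSum_single (p := 1) (by simp) a
  convert h using 2 with i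
  rw [unit, ← lp.single_smul]
  simp

theorem hasSum_apply (T : L1 ι →L[ℝ] F) (a : L1 ι) :
    HasSum (fun i => a i • T (unit i)) (T a) := by
  simpa [Function.comp_def] using (hasSum_unit a).mapL T

/-- The unit vectors span a dense subspace. Operator identities, here and in the weighted algebras,
are reduced in this way to a computation on single modes. -/
theorem clm_ext {S T : L1 ι →L[ℝ] F} (h : ∀ i, S (unit i) = T (unit i)) : S = T := by
  ext a
  refine (hasSum_apply S a).unique ?_
  simpa only [h] using hasSum_apply T a

theorem norm_apply_le (T : L1 ι →L[ℝ] F) {C : ℝ} (h : ∀ i, ‖T (unit i)‖ ≤ C) (a : L1 ι) :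
    ‖T a‖ ≤ C * ‖a‖ := by
  rw [← (hasSum_apply T a).tsum_eq]
  refine tsum_of_norm_bounded ((hasSum_norm_coord a).mul_left C) fun i => ?_
  rw [norm_smul, Real.norm_eq_abs, mul_comm]
  exact mul_le_mul_of_nonneg_right (h i) (abs_nonneg _)

theorem norm_unit (i : ι) : ‖(unit i : L1 ι)‖ = 1 := by
  simp [unit, lp.norm_single]

end L1

/-! ### Weighted convolution algebras -/

/-- A submultiplicative weight on an additive group. -/
structure Weight (G : Type*) [AddCommGroup G] where
  toFun : G → ℝ
  pos : ∀ k, 0 < toFun k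
  add_le : ∀ k l, toFun (k + l) ≤ toFun k * toFun l

instance {G : Type*} [AddCommGroup G] : CoeFun (Weight G) fun _ => G → ℝ := ⟨Weight.toFun⟩

/-- The algebra of formal series `∑ aₖ Xᵏ`, `k ∈ G`, with `∑ |aₖ| w(k) < ∞`. The underlying element
of `ℓ¹` is the sequence `w(k) aₖ`. -/
def Wiener {G : Type*} [AddCommGroup G] (_ : Weight G) : Type _ := L1 G

namespace Wiener

variable {G : Type*} [AddCommGroup G] {w : Weight G}
variable {F : Type*} [NormedAddCommGroup F] [NormedSpace ℝ F]

instance : NormedAddCommGroup (Wiener w) := inferInstanceAs (NormedAddCommGroup (L1 G))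
instance : NormedSpace ℝ (Wiener w) := inferInstanceAs (NormedSpace ℝ (L1 G))
instance : CompleteSpace (Wiener w) := inferInstanceAs (CompleteSpace (L1 G))

/-- The identification with `ℓ¹`. -/
def toL1 (w : Weight G) : Wiener w ≃L[ℝ] L1 G := ContinuousLinearEquiv.refl ℝ (L1 G)

theorem norm_toL1 (a : Wiener w) : ‖toL1 w a‖ = ‖a‖ := rfl

variable [DecidableEq G]

/-- The monomial `Xᵏ`. -/
def mono (w : Weight G) (k : G) : Wiener w := (toL1 w).symm (w k • L1.unit k)

theorem toL1_symm_unit (k : G) : (toL1 w).symm (L1.unit k) = (w k)⁻¹ • mono w k := by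
  rw [mono, map_smul, inv_smul_smul₀ (w.pos k).ne']

theorem norm_mono (k : G) : ‖mono w k‖ = w k := by
  rw [mono, ← norm_toL1, ContinuousLinearEquiv.apply_symm_apply, norm_smul, L1.norm_unit, mul_one,
    Real.norm_of_nonneg (w.pos k).le]

/-- The continuous linear map with prescribed values on the monomials. -/
def lift [CompleteSpace F] (v : G → F) (C : ℝ) (hv : ∀ k, ‖v k‖ ≤ C * w k) :
    Wiener w →L[ℝ] F :=
  L1.lift (fun k => (w k)⁻¹ • v k) C (fun k => by
    rw [norm_smul, norm_inv, Real.norm_of_nonneg (w.pos k).le, inv_mul_le_iff₀ (w.pos k), mul_comm]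
    exact hv k) ∘L (toL1 w : Wiener w →L[ℝ] L1 G)

@[simp]
theorem lift_mono [CompleteSpace F] {v : G → F} {C : ℝ} (hv : ∀ k, ‖v k‖ ≤ C * w k) (k : G) :
    lift v C hv (mono w k) = v k := by
  simp [lift, mono, smul_inv_smul₀ (w.pos k).ne']

theorem clm_ext {S T : Wiener w →L[ℝ] F} (h : ∀ k, S (mono w k) = T (mono w k)) : S = T := by
  have : S ∘L ((toL1 w).symm : L1 G →L[ℝ] Wiener w) = T ∘L ((toL1 w).symm : L1 G →L[ℝ] Wiener w) :=
    L1.clm_ext fun k => by simp [toL1_symm_unit, h]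
  ext a
  simpa using congrArg (fun R => R (toL1 w a)) this

theorem norm_apply_le (T : Wiener w →L[ℝ] F) {C : ℝ} (h : ∀ k, ‖T (mono w k)‖ ≤ C * w k)
    (a : Wiener w) : ‖T a‖ ≤ C * ‖a‖ := by
  have := L1.norm_apply_le (T ∘L ((toL1 w).symm : L1 G →L[ℝ] Wiener w)) (C := C) (fun k => by
    simp only [ContinuousLinearMap.comp_apply, ContinuousLinearEquiv.coe_coe, toL1_symm_unit,
      map_smul]
    rw [norm_smul, norm_inv, Real.norm_of_nonneg (w.pos k).le, inv_mul_le_iff₀ (w.pos k), mul_comm]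
    exact h k) (toL1 w a)
  simpa [norm_toL1] using this

/-- Multiplication as a continuous bilinear map. -/
def mulL (w : Weight G) : Wiener w →L[ℝ] Wiener w →L[ℝ] Wiener w :=
  lift (fun k => lift (fun l => mono w (k + l)) (w k) fun l => by
      rw [norm_mono]; exact w.add_le k l) 1 fun k => by
    rw [one_mul]
    refine ContinuousLinearMap.opNorm_le_bound _ (w.pos k).le fun a => ?_
    refine norm_apply_le _ (fun l => ?_) a
    rw [lift_mono, norm_mono]
    exact w.add_le k l

@[simp]
theorem mulL_mono (k l : G) : mulL w (mono w k) (mono w l) = mono w (k + l) := by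
  simp [mulL]

theorem norm_mulL_le (a b : Wiener w) : ‖mulL w a b‖ ≤ ‖a‖ * ‖b‖ := by
  have h : ‖mulL w a‖ ≤ 1 * ‖a‖ := by
    refine norm_apply_le _ (fun k => ?_) a
    rw [one_mul]
    refine ContinuousLinearMap.opNorm_le_bound _ (w.pos k).le fun b => ?_
    refine norm_apply_le _ (fun l => ?_) b
    rw [mulL_mono, norm_mono]
    exact w.add_le k l
  rw [one_mul] at h
  exact (mulL w a).le_of_opNorm_le h b

theorem mulL_comm (a b : Wiener w) : mulL w a b = mulL w b a := by
  have h : mulL w = (mulL w).flip :=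
    clm_ext fun k => clm_ext fun l => by simp [add_comm]
  exact congrArg (fun T => T a b) h

/-- The three arguments are reduced to monomials one at a time, with the other two frozen; on
monomials this is associativity of addition in G. -/
theorem mulL_assoc (a b c : Wiener w) : mulL w (mulL w a b) c = mulL w a (mulL w b c) := by
  have h₁ (k l : G) : mulL w (mono w (k + l)) = mulL w (mono w k) ∘L mulL w (mono w l) :=
    clm_ext fun m => by simp [add_assoc]
  have h₂ (k : G) (c : Wiener w) :
      (mulL w).flip c ∘L mulL w (mono w k) = mulL w (mono w k) ∘L (mulL w).flip c :=
    clm_ext fun l => by simp [h₁]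
  have h₃ : (mulL w).flip c ∘L (mulL w).flip b = (mulL w).flip (mulL w b c) :=
    clm_ext fun k => by simpa using congrArg (fun T => T b) (h₂ k c)
  simpa using congrArg (fun T => T a) h₃

theorem one_mulL (a : Wiener w) : mulL w (mono w 0) a = a := by
  have h : mulL w (mono w 0) = ContinuousLinearMap.id ℝ (Wiener w) :=
    clm_ext fun k => by simp
  rw [h, ContinuousLinearMap.id_apply]

instance : NormedCommRing (Wiener w) where
  __ := (inferInstance : NormedAddCommGroup (Wiener w))
  mul a b := mulL w a b
  one := mono w 0
  left_distrib a b c := map_add (mulL w a) b c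
  right_distrib a b c := by
    change mulL w (a + b) c = mulL w a c + mulL w b c
    simp
  zero_mul a := by
    change mulL w 0 a = 0
    simp
  mul_zero a := map_zero (mulL w a)
  mul_assoc := mulL_assoc
  one_mul := one_mulL
  mul_one a := (mulL_comm a _).trans (one_mulL a)
  mul_comm := mulL_comm
  norm_mul_le := norm_mulL_le

theorem mul_def (a b : Wiener w) : a * b = mulL w a b := rfl

theorem one_def : (1 : Wiener w) = mono w 0 := rfl

theorem mono_mul_mono (k l : G) : mono w k * mono w l = mono w (k + l) := mulL_mono k l

instance : NormedAlgebra ℝ (Wiener w) where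
  __ := Algebra.ofModule (R := ℝ) (A := Wiener w)
    (fun c a b => by simp [mul_def]) (fun c a b => by simp [mul_def])
  norm_smul_le := norm_smul_le

/-- A linear functional that is multiplicative on monomials is multiplicative. -/
theorem map_mul_of_mono {R : Type*} [NormedCommRing R] [NormedAlgebra ℝ R] (T : Wiener w →L[ℝ] R)
    (h : ∀ k l, T (mono w (k + l)) = T (mono w k) * T (mono w l)) (a b : Wiener w) :
    T (a * b) = T a * T b := by
  have h₁ (k : G) : T ∘L mulL w (mono w k) = ContinuousLinearMap.mul ℝ R (T (mono w k)) ∘L T :=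
    clm_ext fun l => by simp [h]
  have h₂ : T ∘L (mulL w).flip b = (ContinuousLinearMap.mul ℝ R).flip (T b) ∘L T :=
    clm_ext fun k => by simpa [mul_comm] using congrArg (fun S => S b) (h₁ k)
  simpa [mul_def, mul_comm (T a)] using congrArg (fun S => S a) h₂

/-- The coefficient of `Xᵏ`. -/
def coeff (k : G) : Wiener w →L[ℝ] ℝ :=
  (w k)⁻¹ • (L1.coord k ∘L (toL1 w : Wiener w →L[ℝ] L1 G))

theorem coeff_mono (k l : G) : coeff k (mono w l) = if k = l then 1 else 0 := by
  have := (w.pos k).ne'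
  by_cases h : k = l
  · subst h; simp [coeff, mono, L1.unit, this]
  · simp [coeff, mono, L1.unit, h]

theorem eq_zero_of_coeff {a : Wiener w} (h : ∀ k, coeff k a = 0) : a = 0 := by
  have : toL1 w a = 0 := by
    ext k
    have := h k
    simpa [coeff, (w.pos k).ne'] using this
  simpa using this

end Wiener

/-! ### The operators of the vortex sheet equation -/

/-- The weight `2^|k|` on `ℤ`. -/
def expWeight : Weight ℤ where
  toFun k := 2 ^ k.natAbs
  pos k := by positivity
  add_le k l := by
    rw [← pow_add]
    exact pow_le_pow_right₀ (by norm_num) (Int.natAbs_add_le k l)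

/-- The weight `2^|k|` on `ℤ × ℤ`, independent of the second index. -/
def expWeight₂ : Weight (ℤ × ℤ) where
  toFun k := 2 ^ k.1.natAbs
  pos k := by positivity
  add_le k l := by
    rw [← pow_add]
    exact pow_le_pow_right₀ (by norm_num) (Int.natAbs_add_le k.1 l.1)

theorem expWeight_apply (k : ℤ) : expWeight k = 2 ^ k.natAbs := rfl

theorem expWeight₂_apply (k : ℤ × ℤ) : expWeight₂ k = 2 ^ k.1.natAbs := rfl

/-- Laurent series in `ξ = e^{2iθ}`. -/
abbrev Alg : Type := Wiener expWeight

/-- Laurent series in `ξ = e^{2iθ}` and `t = e^{i(η-θ)}`. -/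
abbrev Alg₂ : Type := Wiener expWeight₂

/-- The monomial `ξᵏ`. -/
abbrev ξpow (k : ℤ) : Alg := Wiener.mono expWeight k

/-- The monomial `ξᵏ tʲ`. -/
abbrev ξtpow (k j : ℤ) : Alg₂ := Wiener.mono expWeight₂ (k, j)

theorem norm_ξpow (k : ℤ) : ‖ξpow k‖ = 2 ^ k.natAbs := Wiener.norm_mono k

theorem norm_ξtpow (k j : ℤ) : ‖ξtpow k j‖ = 2 ^ k.natAbs := Wiener.norm_mono (k, j)

theorem ξtpow_mul_ξtpow (k j k' j' : ℤ) : ξtpow k j * ξtpow k' j' = ξtpow (k + k') (j + j') :=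
  Wiener.mono_mul_mono _ _

/-- The even function `ξᵏ + ξ⁻ᵏ = 2 cos(2kθ)`. -/
def evenMode (n : ℕ) : Alg := ξpow n + ξpow (-n)

/-- The odd function `ξᵏ - ξ⁻ᵏ = 2i sin(2kθ)`. -/
def oddMode (n : ℕ) : Alg := ξpow n - ξpow (-n)

theorem norm_evenMode_le (n : ℕ) : ‖evenMode n‖ ≤ 2 * 2 ^ n := by
  refine (norm_add_le _ _).trans ?_
  simp only [norm_ξpow, Int.natAbs_neg, Int.natAbs_natCast]
  linarith

theorem norm_oddMode_le (n : ℕ) : ‖oddMode n‖ ≤ 2 * 2 ^ n := by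
  refine (norm_sub_le _ _).trans ?_
  simp only [norm_ξpow, Int.natAbs_neg, Int.natAbs_natCast]
  linarith

/-- The divided difference `(r(ζ)ζ - r(w)w)/(ζ - w)` of `r = ξⁿ⁺¹ + ξ⁻ⁿ⁻¹`, where `w = tζ`. -/
def quotMode (n : ℕ) : Alg₂ :=
  ∑ j ∈ Finset.range (2 * n + 3), ξtpow (n + 1) j -
    ∑ j ∈ Finset.range (2 * n + 1), ξtpow (-(n + 1)) (-(j + 1))

/-- There are 4n + 4 monomials, each of norm 2^(n+1). The factor growing with n is the derivative
lost in a divided difference; the division by k + 1 in `quotTail` absorbs it. -/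
theorem norm_quotMode_le (n : ℕ) : ‖quotMode n‖ ≤ (4 * n + 4) * 2 ^ (n + 1) := by
  have h₁ : ‖∑ j ∈ Finset.range (2 * n + 3), ξtpow (n + 1) j‖ ≤ (2 * n + 3) * 2 ^ (n + 1) := by
    refine (norm_sum_le_of_le _ fun j _ => (norm_ξtpow _ _).le).trans ?_
    rw [show (n + 1 : ℤ).natAbs = n + 1 by omega]
    simp
  have h₂ : ‖∑ j ∈ Finset.range (2 * n + 1), ξtpow (-(n + 1)) (-(j + 1))‖ ≤
      (2 * n + 1) * 2 ^ (n + 1) := by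
    refine (norm_sum_le_of_le _ fun j _ => (norm_ξtpow _ _).le).trans ?_
    rw [show (-(n + 1) : ℤ).natAbs = n + 1 by omega]
    simp
  refine (norm_sub_le _ _).trans ((add_le_add h₁ h₂).trans (le_of_eq ?_))
  ring

theorem norm_inv_two_pow_smul_le {E : Type*} [NormedAddCommGroup E] [NormedSpace ℝ E] {x : E}
    {C : ℝ} {n : ℕ} (h : ‖x‖ ≤ C * 2 ^ n) : ‖((2 : ℝ) ^ n)⁻¹ • x‖ ≤ C := by
  rw [norm_smul, norm_inv, norm_pow, Real.norm_ofNat, inv_mul_le_iff₀ (by positivity)]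
  linarith

/-- The even series `∑ 2^{-k-1} aₖ (ξᵏ⁺¹ + ξ⁻ᵏ⁻¹)`. -/
def evenSeries : L1 ℕ →L[ℝ] Alg :=
  L1.lift (fun k => ((2 : ℝ) ^ (k + 1))⁻¹ • evenMode (k + 1)) 2 fun _ =>
    norm_inv_two_pow_smul_le (norm_evenMode_le _)

/-- The index shift `k ↦ k + 1`. -/
def shift : L1 ℕ →L[ℝ] L1 ℕ :=
  L1.lift (fun k => L1.unit (k + 1)) 1 fun _ => (L1.norm_unit _).le

/-- The index shift combined with division by `k + 1`. -/
def shiftDiv : L1 ℕ →L[ℝ] L1 ℕ :=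
  L1.lift (fun k => (k + 1 : ℝ)⁻¹ • L1.unit (k + 1)) 1 fun k => by
    rw [norm_smul, L1.norm_unit, mul_one, norm_inv, Real.norm_of_nonneg (by positivity)]
    exact inv_le_one_of_one_le₀ (by linarith [(Nat.cast_nonneg k : (0 : ℝ) ≤ k)])

/-- `ζ∂_ζ` of `evenSeries (shiftDiv u)`. -/
def derivTail : L1 ℕ →L[ℝ] Alg :=
  L1.lift (fun k => ((2 : ℝ) ^ (k + 2))⁻¹ • ((2 * (k + 2) / (k + 1) : ℝ) • oddMode (k + 2))) 8
    fun k => norm_inv_two_pow_smul_le (by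
      rw [norm_smul, Real.norm_of_nonneg (by positivity)]
      have h : (2 * (k + 2) / (k + 1) : ℝ) ≤ 4 := by
        rw [div_le_iff₀ (by positivity)]
        linarith [(Nat.cast_nonneg k : (0 : ℝ) ≤ k)]
      have := norm_oddMode_le (k + 2)
      calc (2 * (k + 2) / (k + 1) : ℝ) * ‖oddMode (k + 2)‖ ≤ 4 * (2 * 2 ^ (k + 2)) := by gcongr
        _ = 8 * 2 ^ (k + 2) := by ring)

/-- The divided difference of `evenSeries (shiftDiv u)`. -/
def quotTail : L1 ℕ →L[ℝ] Alg₂ :=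
  L1.lift (fun k => ((2 : ℝ) ^ (k + 2))⁻¹ • ((k + 1 : ℝ)⁻¹ • quotMode (k + 1))) 8
    fun k => norm_inv_two_pow_smul_le (by
      rw [norm_smul, norm_inv, Real.norm_of_nonneg (by positivity), inv_mul_le_iff₀ (by positivity)]
      refine (norm_quotMode_le (k + 1)).trans ?_
      rw [← mul_assoc]
      gcongr
      push_cast
      linarith [(Nat.cast_nonneg k : (0 : ℝ) ≤ k)])

/-- The substitution `f(ζ) ↦ f(w)`. -/
def subst : Alg →L[ℝ] Alg₂ :=
  Wiener.lift (fun k => ξtpow k (2 * k)) 1 fun k => by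
    rw [norm_ξtpow, expWeight_apply, one_mul]

/-- The principal value of `(1/2π) ∫ h(ζ, w) ζ/(ζ - w) dη`. -/
def pvOp : Alg₂ →L[ℝ] Alg :=
  Wiener.lift (fun k => (if 1 ≤ k.2 then -1 / 2 else 1 / 2 : ℝ) • ξpow k.1) 1 fun k => by
    rw [norm_smul, norm_ξpow, expWeight₂_apply]
    gcongr
    split_ifs <;> norm_num

theorem evenSeries_unit (k : ℕ) :
    evenSeries (L1.unit k) = ((2 : ℝ) ^ (k + 1))⁻¹ • evenMode (k + 1) := L1.lift_unit _ _

theorem shift_unit (k : ℕ) : shift (L1.unit k) = L1.unit (k + 1) := L1.lift_unit _ _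

theorem shiftDiv_unit (k : ℕ) :
    shiftDiv (L1.unit k) = (k + 1 : ℝ)⁻¹ • (L1.unit (k + 1) : L1 ℕ) := L1.lift_unit _ _

theorem derivTail_unit (k : ℕ) : derivTail (L1.unit k) =
    ((2 : ℝ) ^ (k + 2))⁻¹ • ((2 * (k + 2) / (k + 1) : ℝ) • oddMode (k + 2)) := L1.lift_unit _ _

theorem quotTail_unit (k : ℕ) : quotTail (L1.unit k) =
    ((2 : ℝ) ^ (k + 2))⁻¹ • ((k + 1 : ℝ)⁻¹ • quotMode (k + 1)) := L1.lift_unit _ _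

theorem subst_ξpow (k : ℤ) : subst (ξpow k) = ξtpow k (2 * k) := Wiener.lift_mono _ _

theorem pvOp_ξtpow (k j : ℤ) :
    pvOp (ξtpow k j) = (if 1 ≤ j then -1 / 2 else 1 / 2 : ℝ) • ξpow k := Wiener.lift_mono _ (k, j)

theorem pvOp_one : pvOp 1 = (1 / 2 : ℝ) • (1 : Alg) := by
  rw [Wiener.one_def, Wiener.one_def]
  exact pvOp_ξtpow 0 0

/-- Of t⁰, …, t^(2n+2) only t⁰ counts +1/2, which leaves 1/2 - (n+1). The 2n+1 negative powers all
count +1/2, with the minus sign of `quotMode`. Both totals are -(n + 1/2), so even modes stay even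
and the symbol has order one. -/
theorem pvOp_quotMode (n : ℕ) : pvOp (quotMode n) = -(n + 1 / 2 : ℝ) • evenMode (n + 1) := by
  rw [quotMode, map_sub, map_sum, map_sum, evenMode]
  have h₁ : ∑ j ∈ Finset.range (2 * n + 3), pvOp (ξtpow (n + 1) j) =
      (-(n + 1 / 2) : ℝ) • ξpow (n + 1) := by
    rw [Finset.sum_range_succ']
    simp only [pvOp_ξtpow, ← Finset.sum_smul, ← add_smul]
    congr 1
    rw [Finset.sum_congr rfl (g := fun _ => (-1 / 2 : ℝ)) fun j _ => if_pos (by push_cast; omega)]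
    simp
    ring
  have h₂ : ∑ j ∈ Finset.range (2 * n + 1), pvOp (ξtpow (-(n + 1)) (-(j + 1))) =
      (n + 1 / 2 : ℝ) • ξpow (-(n + 1)) := by
    simp only [pvOp_ξtpow, ← Finset.sum_smul]
    congr 1
    rw [Finset.sum_congr rfl (g := fun _ => (1 / 2 : ℝ)) fun j _ => if_neg (by omega)]
    simp
    ring
  rw [h₁, h₂]
  push_cast
  module

/-- The symbol is (k + 3/2)/(k + 1) = 1 + 1/(2(k + 1)). After multiplication by the strength 2 the
second summand cancels against the term R of r, so the bare index shift survives as the principal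
part in u. -/
theorem pvOp_quotTail (u : L1 ℕ) : pvOp (quotTail u) =
    -(evenSeries (shift u) + (1 / 2 : ℝ) • evenSeries (shiftDiv u)) := by
  have h : pvOp ∘L quotTail =
      -(evenSeries ∘L shift + (1 / 2 : ℝ) • (evenSeries ∘L shiftDiv)) := by
    refine L1.clm_ext fun k => ?_
    simp only [ContinuousLinearMap.comp_apply, neg_apply,
      add_apply, smul_apply, quotTail_unit, shift_unit,
      shiftDiv_unit, map_smul, evenSeries_unit, pvOp_quotMode]
    have : (k + 1 : ℝ) ≠ 0 := by positivity
    push_cast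
    match_scalars
    field_simp
  exact congrArg (fun T => T u) h

/-! ### The rescaled equation -/

/-- `2 cos 2θ`. -/
def cosTwo : Alg := evenMode 1

/-- The divided difference of `r/s`, where `r = s (Y e + s R)` with
`R = evenSeries (shiftDiv u)`. -/
def quot (s Y : ℝ) (u : L1 ℕ) : Alg₂ := Y • quotMode 0 + s • quotTail u

/-- The inverse of the divided difference of `ζ(1 + r)`. -/
def quotInv (s Y : ℝ) (u : L1 ℕ) : Alg₂ := Ring.inverse (1 + s • quot s Y u)

/-- `r/s`. -/
def radius (s Y : ℝ) (u : L1 ℕ) : Alg := Y • cosTwo + s • evenSeries (shiftDiv u)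

/-- `ζ∂_ζ r/s`. -/
def radiusDeriv (s Y : ℝ) (u : L1 ℕ) : Alg := (2 * Y) • oddMode 1 + s • derivTail u

/-- First order coefficient of the tangential velocity. -/
def velocityOne (Y : ℝ) (g u : L1 ℕ) : Alg :=
  (2 : ℝ) • evenSeries (shift u) + (Y / 2) • cosTwo + (2 * Y ^ 2) • pvOp (quotMode 0 ^ 2)
    + pvOp (subst (evenSeries g))

/-- Remainder of second order of the tangential velocity. -/
def velocityTwo (s Y : ℝ) (g u : L1 ℕ) : Alg :=
  evenSeries (shift u) + (1 / 2 : ℝ) • evenSeries (shiftDiv u)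
    + (4 * Y) • pvOp (quotMode 0 * quotTail u) + (2 * s) • pvOp (quotTail u ^ 2)
    + pvOp (quot s Y u ^ 2)
    - pvOp (subst (evenSeries g) * quot s Y u * quotInv s Y u)
    - (2 + s) • pvOp (quot s Y u ^ 3 * quotInv s Y u)

/-- Leading order of the rescaled equation. -/
def leading (ν Y : ℝ) (g u : L1 ℕ) : Alg :=
  (4 : ℝ) • evenSeries (shift u) + (4 * Y ^ 2) • pvOp (quotMode 0 ^ 2)
    + (2 : ℝ) • pvOp (subst (evenSeries g)) + (1 / 2 - ν) • (1 : Alg) + (2 * Y) • oddMode 1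

/-- Remainder of the rescaled equation. -/
def remainder (s ν Y : ℝ) (g u : L1 ℕ) : Alg :=
  (2 : ℝ) • velocityTwo s Y g u + velocityOne Y g u + (1 / 2 : ℝ) • evenSeries g
    + s • (velocityTwo s Y g u + evenSeries g * velocityOne Y g u)
    + s ^ 2 • (evenSeries g * velocityTwo s Y g u)
    - (evenSeries (shiftDiv u) - derivTail u) - ν • (radius s Y u - radiusDeriv s Y u)

/-- Geometric expansion of p = (1 + sQ)⁻¹ with exact remainder: to second order against the constant
c, to zeroth order against s²G. -/
theorem mul_quotInv_expansion {R : Type*} [CommRing R] [Algebra ℝ R] {Q G p : R} {s c : ℝ}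
    (hp : (1 + s • Q) * p = 1) : (c • (1 : R) + s ^ 2 • G) * p =
      c • (1 : R) - (s * c) • Q + (s ^ 2 * c) • Q ^ 2 + s ^ 2 • G - (s ^ 3 * c) • (Q ^ 3 * p)
        - s ^ 3 • (G * Q * p) := by
  simp only [Algebra.smul_def, map_mul, map_pow] at hp ⊢
  linear_combination (algebraMap ℝ R c * (1 - algebraMap ℝ R s * Q + (algebraMap ℝ R s * Q) ^ 2) +
    algebraMap ℝ R s ^ 2 * G) * hp

/-- At order s the contribution of `quotMode 0` is exactly Y • `cosTwo`, which equals the same term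
of r. This cancellation places cos 2θ in the kernel at b = 2. -/
theorem velocity_expansion {s Y : ℝ} {g u : L1 ℕ} (hu : IsUnit (1 + s • quot s Y u)) :
    pvOp (((2 + s) • (1 : Alg₂) + s ^ 2 • subst (evenSeries g)) * quotInv s Y u) =
      1 + s • radius s Y u +
        s • ((1 / 2 : ℝ) • (1 : Alg) + s • velocityOne Y g u + s ^ 2 • velocityTwo s Y g u) := by
  have hp : (1 + s • quot s Y u) * quotInv s Y u = 1 := Ring.mul_inverse_cancel _ hu
  rw [mul_quotInv_expansion hp]
  have h₁ : pvOp (quot s Y u) = -((Y / 2) • cosTwo + s • evenSeries (shift u) +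
      (s / 2) • evenSeries (shiftDiv u)) := by
    rw [quot, map_add, map_smul, map_smul, pvOp_quotMode, pvOp_quotTail, cosTwo]
    push_cast
    module
  have h₂ : pvOp (quot s Y u ^ 2) = Y ^ 2 • pvOp (quotMode 0 ^ 2) +
      (2 * s * Y) • pvOp (quotMode 0 * quotTail u) + s ^ 2 • pvOp (quotTail u ^ 2) := by
    simp only [← map_smul, ← map_add]
    congr 1
    simp only [quot, Algebra.smul_def, map_mul, map_pow, map_ofNat]
    ring
  simp only [map_add, map_sub, map_smul, pvOp_one, h₁, velocityTwo, velocityOne, radius]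
  rw [h₂]
  module

/-- Order s cancels because 2 · (s/2) = s is the first order of λ = s(1 + sν). The identity is
exact, so a zero of the bracket on the right solves the unscaled equation. -/
theorem equation_expansion {s ν Y : ℝ} {g u : L1 ℕ} (hu : IsUnit (1 + s • quot s Y u)) :
    ((2 + s) • (1 : Alg) + s ^ 2 • evenSeries g) *
        (pvOp (((2 + s) • (1 : Alg₂) + s ^ 2 • subst (evenSeries g)) * quotInv s Y u)
          - (1 + s • radius s Y u)) -
      (s * (1 + s * ν)) • (1 + s • radius s Y u - s • radiusDeriv s Y u) =
    s ^ 2 • (leading ν Y g u + s • remainder s ν Y g u) := by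
  rw [velocity_expansion hu]
  have h : leading ν Y g u = (2 : ℝ) • velocityOne Y g u + (1 / 2 - ν) • (1 : Alg)
      - Y • cosTwo + (2 * Y) • oddMode 1 := by
    rw [leading, velocityOne]
    module
  rw [h, remainder]
  generalize velocityOne Y g u = M₁
  generalize velocityTwo s Y g u = M₂
  rw [radius, radiusDeriv]
  generalize evenSeries (shiftDiv u) = R
  generalize evenSeries g = G
  generalize derivTail u = D
  simp only [Algebra.smul_def, map_mul, map_pow, map_add, map_sub, map_ofNat, map_one]
  have h2 : algebraMap ℝ Alg (1 / 2) * 2 = 1 := by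
    rw [← map_ofNat (algebraMap ℝ Alg) 2, ← map_mul]; norm_num
  linear_combination algebraMap ℝ Alg s * h2

/-! ### Even and odd parts of a series -/

open Wiener (coeff)

theorem coeff_ξpow (k l : ℤ) : coeff k (ξpow l) = if k = l then (1 : ℝ) else 0 :=
  Wiener.coeff_mono k l

/-- The sum of the coefficients of `ξ` and `ξ⁻¹`. -/
def evenCoeffOne : Alg →L[ℝ] ℝ := coeff 1 + coeff (-1)

/-- The odd part, in normalized coordinates. -/
def oddPart : Alg →L[ℝ] L1 ℕ :=
  Wiener.lift (fun k => (k.sign * 2 ^ k.natAbs : ℝ) • L1.unit (k.natAbs - 1)) 1 fun k => by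
    rw [norm_smul, L1.norm_unit, mul_one, norm_mul, expWeight_apply, norm_pow, Real.norm_ofNat]
    gcongr
    rcases lt_trichotomy k 0 with h | h | h
    · simp [Int.sign_eq_neg_one_of_neg h]
    · simp [h]
    · simp [Int.sign_eq_one_of_pos h]

/-- The even part without the modes `0` and `±1`, in normalized coordinates. -/
def evenTail : Alg →L[ℝ] L1 ℕ :=
  Wiener.lift (fun k => (if 2 ≤ k.natAbs then 2 ^ k.natAbs else 0 : ℝ) • L1.unit (k.natAbs - 2)) 1
    fun k => by
      rw [norm_smul, L1.norm_unit, mul_one, expWeight_apply]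
      split_ifs <;> simp

theorem oddPart_ξpow (k : ℤ) :
    oddPart (ξpow k) = (k.sign * 2 ^ k.natAbs : ℝ) • L1.unit (k.natAbs - 1) := Wiener.lift_mono _ _

theorem evenTail_ξpow (k : ℤ) : evenTail (ξpow k) =
    (if 2 ≤ k.natAbs then 2 ^ k.natAbs else 0 : ℝ) • L1.unit (k.natAbs - 2) := Wiener.lift_mono _ _

theorem unit_coord (m n : ℕ) : (L1.unit m : L1 ℕ) n = if n = m then (1 : ℝ) else 0 := by
  by_cases h : n = m
  · subst h; simp [L1.unit]
  · simp [L1.unit, h]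

theorem oddPart_coord (a : Alg) (n : ℕ) :
    oddPart a n = 2 ^ (n + 1) * (coeff (n + 1 : ℤ) a - coeff (-(n + 1) : ℤ) a) := by
  have h : L1.coord n ∘L oddPart =
      (2 ^ (n + 1) : ℝ) • (coeff (n + 1 : ℤ) - coeff (-(n + 1) : ℤ)) := by
    refine Wiener.clm_ext fun k => ?_
    change L1.coord n (oddPart (ξpow k)) =
      (2 ^ (n + 1) : ℝ) * (coeff (n + 1 : ℤ) (ξpow k) - coeff (-(n + 1) : ℤ) (ξpow k))
    rw [oddPart_ξpow, map_smul, L1.coord_apply, unit_coord, coeff_ξpow, coeff_ξpow, smul_eq_mul]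
    rcases lt_trichotomy k 0 with h | h | h
    · rw [Int.sign_eq_neg_one_of_neg h, if_neg (show ¬ (n + 1 : ℤ) = k by omega)]
      by_cases h' : (-(n + 1) : ℤ) = k
      · rw [if_pos h', if_pos (by omega), show k.natAbs = n + 1 by omega]
        simp
      · rw [if_neg h', if_neg (by omega)]
        simp
    · rw [h, if_neg (show ¬ (n + 1 : ℤ) = 0 by omega), if_neg (show ¬ (-(n + 1) : ℤ) = 0 by omega)]
      simp
    · rw [Int.sign_eq_one_of_pos h, if_neg (show ¬ (-(n + 1) : ℤ) = k by omega)]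
      by_cases h' : (n + 1 : ℤ) = k
      · rw [if_pos h', if_pos (by omega), show k.natAbs = n + 1 by omega]
        simp
      · rw [if_neg h', if_neg (by omega)]
        simp
  exact congrArg (fun T => T a) h

theorem evenTail_coord (a : Alg) (n : ℕ) :
    evenTail a n = 2 ^ (n + 2) * (coeff (n + 2 : ℤ) a + coeff (-(n + 2) : ℤ) a) := by
  have h : L1.coord n ∘L evenTail =
      (2 ^ (n + 2) : ℝ) • (coeff (n + 2 : ℤ) + coeff (-(n + 2) : ℤ)) := by
    refine Wiener.clm_ext fun k => ?_
    change L1.coord n (evenTail (ξpow k)) =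
      (2 ^ (n + 2) : ℝ) * (coeff (n + 2 : ℤ) (ξpow k) + coeff (-(n + 2) : ℤ) (ξpow k))
    rw [evenTail_ξpow, map_smul, L1.coord_apply, unit_coord, coeff_ξpow, coeff_ξpow, smul_eq_mul]
    by_cases h₁ : (n + 2 : ℤ) = k
    · rw [if_pos h₁, if_neg (show ¬ (-(n + 2) : ℤ) = k by omega), if_pos (by omega),
        if_pos (by omega), show k.natAbs = n + 2 by omega]
      simp
    · by_cases h₂ : (-(n + 2) : ℤ) = k
      · rw [if_neg h₁, if_pos h₂, if_pos (by omega), if_pos (by omega),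
          show k.natAbs = n + 2 by omega]
        simp
      · rw [if_neg h₁, if_neg h₂]
        by_cases h₃ : 2 ≤ k.natAbs
        · rw [if_neg (show ¬ n = k.natAbs - 2 by omega)]
          simp
        · simp [h₃]
  exact congrArg (fun T => T a) h

/-- For each k ≥ 1 the parts determine the sum and the difference of the coefficients at k and -k;
the sum for k = 1 is `evenCoeffOne`, kept apart because it is the degenerate mode. -/
theorem eq_zero_of_parts {a : Alg} (h₀ : coeff 0 a = 0) (h₁ : evenCoeffOne a = 0)
    (h₂ : oddPart a = 0) (h₃ : evenTail a = 0) : a = 0 := by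
  have hodd (n : ℕ) : coeff (n + 1 : ℤ) a = coeff (-(n + 1) : ℤ) a := by
    have := oddPart_coord a n
    rw [h₂] at this
    simpa [sub_eq_zero] using this.symm
  have heven (n : ℕ) : coeff (n + 1 : ℤ) a + coeff (-(n + 1) : ℤ) a = 0 := by
    rcases n with _ | n
    · simpa [evenCoeffOne] using h₁
    · have := evenTail_coord a n
      rw [h₃] at this
      have h : coeff (n + 2 : ℤ) a + coeff (-(n + 2) : ℤ) a = 0 := by simpa using this.symm
      push_cast
      rwa [show (n + 1 + 1 : ℤ) = n + 2 by ring]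
  refine Wiener.eq_zero_of_coeff fun k => ?_
  rcases lt_trichotomy k 0 with h | h | h
  · obtain ⟨n, rfl⟩ : ∃ n : ℕ, k = -(n + 1 : ℤ) := ⟨k.natAbs - 1, by omega⟩
    linarith [hodd n, heven n]
  · rw [h, h₀]
  · obtain ⟨n, rfl⟩ : ∃ n : ℕ, k = (n + 1 : ℤ) := ⟨k.natAbs - 1, by omega⟩
    linarith [hodd n, heven n]

/-! ### The rescaled equation at `s = 0` -/

theorem quotMode_zero :
    quotMode 0 = ξtpow 1 0 + ξtpow 1 1 + ξtpow 1 2 - ξtpow (-1) (-1) := by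
  simp [quotMode, Finset.sum_range_succ]

theorem quotMode_one : quotMode 1 =
    ξtpow 2 0 + ξtpow 2 1 + ξtpow 2 2 + ξtpow 2 3 + ξtpow 2 4
      - (ξtpow (-2) (-1) + ξtpow (-2) (-2) + ξtpow (-2) (-3)) := by
  simp [quotMode, Finset.sum_range_succ]

/-- This square is the only quadratic nonlinearity in `leading`. It has no modes ξ and ξ⁻¹; its
modes 0 and ±2 produce the constants 4, 64 and 48 in `rescaled_zero`. -/
theorem pvOp_quotMode_zero_sq :
    pvOp (quotMode 0 ^ 2) =
      (-7 / 2 : ℝ) • ξpow 2 - (1 : Alg) + (1 / 2 : ℝ) • ξpow (-2) := by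
  rw [Wiener.one_def, quotMode_zero, pow_two]
  simp only [mul_add, add_mul, mul_sub, sub_mul, ξtpow_mul_ξtpow, map_add, map_sub, pvOp_ξtpow]
  norm_num
  module

/-- The exponent of t in ξᵏt²ᵏ has the sign of k, so `pvOp ∘ subst` acts as a Hilbert transform and
turns cosines into sines. Hence the strength governs the odd part of the equation. -/
theorem pvOp_subst_evenSeries_unit (k : ℕ) : pvOp (subst (evenSeries (L1.unit k))) =
    -((1 / 2 : ℝ) • ((2 : ℝ) ^ (k + 1))⁻¹ • oddMode (k + 1)) := by
  rw [evenSeries_unit, map_smul, map_smul, evenMode, map_add, map_add, subst_ξpow, subst_ξpow,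
    pvOp_ξtpow, pvOp_ξtpow, if_pos (by push_cast; omega), if_neg (by push_cast; omega), oddMode]
  module

theorem oddPart_oddMode (n : ℕ) :
    oddPart (oddMode (n + 1)) = (2 * 2 ^ (n + 1) : ℝ) • (L1.unit n : L1 ℕ) := by
  rw [oddMode, map_sub, oddPart_ξpow, oddPart_ξpow, Int.sign_neg,
    Int.sign_eq_one_of_pos (by positivity), Int.natAbs_neg, Int.natAbs_natCast]
  simp only [Nat.add_sub_cancel]
  push_cast
  module

theorem oddPart_evenMode (n : ℕ) : oddPart (evenMode n) = 0 := by
  rw [evenMode, map_add, oddPart_ξpow, oddPart_ξpow, Int.sign_neg, Int.natAbs_neg]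
  push_cast
  module

theorem evenTail_oddMode (n : ℕ) : evenTail (oddMode n) = 0 := by
  rw [oddMode, map_sub, evenTail_ξpow, evenTail_ξpow, Int.natAbs_neg, sub_self]

theorem evenTail_evenMode (n : ℕ) :
    evenTail (evenMode (n + 2)) = (2 * 2 ^ (n + 2) : ℝ) • (L1.unit n : L1 ℕ) := by
  rw [evenMode, map_add, evenTail_ξpow, evenTail_ξpow, Int.natAbs_neg, Int.natAbs_natCast,
    if_pos (by omega), Nat.add_sub_cancel]
  module

theorem evenCoeffOne_oddMode (n : ℕ) : evenCoeffOne (oddMode n) = 0 := by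
  simp only [evenCoeffOne, oddMode, add_apply, map_sub, coeff_ξpow]
  rcases n with _ | n
  · simp
  · rw [if_neg (show ¬ (1 : ℤ) = -((n + 1 : ℕ) : ℤ) by omega),
      if_neg (show ¬ (-1 : ℤ) = ((n + 1 : ℕ) : ℤ) by omega)]
    rcases n with _ | n
    · simp
    · rw [if_neg (by omega), if_neg (by omega)]
      simp

theorem coeff_zero_oddMode (n : ℕ) : coeff 0 (oddMode n) = 0 := by
  simp only [oddMode, map_sub, coeff_ξpow]
  rcases n with _ | n
  · simp
  · rw [if_neg (by omega), if_neg (by omega)]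
    simp

theorem coeff_zero_evenMode (n : ℕ) : coeff 0 (evenMode (n + 1)) = 0 := by
  simp only [evenMode, map_add, coeff_ξpow]
  rw [if_neg (by omega), if_neg (by omega)]
  simp

theorem evenCoeffOne_evenSeries (a : L1 ℕ) : evenCoeffOne (evenSeries a) = a 0 := by
  have h : evenCoeffOne ∘L evenSeries = L1.coord 0 := by
    refine L1.clm_ext fun k => ?_
    simp only [ContinuousLinearMap.comp_apply, evenSeries_unit, map_smul, evenCoeffOne, evenMode,
      add_apply, map_add, coeff_ξpow, L1.coord_apply, unit_coord]
    rcases k with _ | k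
    · norm_num
    · rw [if_neg (by omega), if_neg (by omega), if_neg (by omega), if_neg (by omega),
        if_neg (by omega)]
      simp
  exact congrArg (fun T => T a) h

theorem shift_coord_zero (u : L1 ℕ) : shift u 0 = 0 := by
  have h : L1.coord 0 ∘L shift = 0 := L1.clm_ext fun k => by
    rw [ContinuousLinearMap.comp_apply, shift_unit, L1.coord_apply, unit_coord]
    simp
  exact congrArg (fun T => T u) h

theorem shiftDiv_coord_zero (u : L1 ℕ) : shiftDiv u 0 = 0 := by
  have h : L1.coord 0 ∘L shiftDiv = 0 := L1.clm_ext fun k => by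
    rw [ContinuousLinearMap.comp_apply, shiftDiv_unit, map_smul, L1.coord_apply, unit_coord]
    simp
  exact congrArg (fun T => T u) h

theorem evenCoeffOne_derivTail (u : L1 ℕ) : evenCoeffOne (derivTail u) = 0 := by
  have h : evenCoeffOne ∘L derivTail = 0 := L1.clm_ext fun k => by
    simp [derivTail_unit, evenCoeffOne_oddMode]
  exact congrArg (fun T => T u) h

theorem evenCoeffOne_pvOp_subst (g : L1 ℕ) :
    evenCoeffOne (pvOp (subst (evenSeries g))) = 0 := by
  have h : evenCoeffOne ∘L pvOp ∘L subst ∘L evenSeries = 0 := L1.clm_ext fun k => by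
    simp [pvOp_subst_evenSeries_unit, evenCoeffOne_oddMode]
  exact congrArg (fun T => T g) h

theorem coeff_zero_leading (ν Y : ℝ) (g u : L1 ℕ) :
    coeff 0 (leading ν Y g u) = 1 / 2 - ν - 4 * Y ^ 2 := by
  have h₁ : coeff 0 (evenSeries (shift u)) = (0 : ℝ) := by
    have h : (coeff 0 : Alg →L[ℝ] ℝ) ∘L evenSeries = 0 := L1.clm_ext fun k => by
      simp [evenSeries_unit, coeff_zero_evenMode]
    exact congrArg (fun T => T (shift u)) h
  have h₂ : coeff 0 (pvOp (subst (evenSeries g))) = (0 : ℝ) := by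
    have h : (coeff 0 : Alg →L[ℝ] ℝ) ∘L pvOp ∘L subst ∘L evenSeries = 0 := L1.clm_ext fun k => by
      simp [pvOp_subst_evenSeries_unit, coeff_zero_oddMode]
    exact congrArg (fun T => T g) h
  simp only [leading, map_add, map_smul, h₁, h₂, coeff_zero_oddMode, pvOp_quotMode_zero_sq, map_sub,
    Wiener.one_def, coeff_ξpow]
  norm_num
  ring

/-- The shift skips the first mode, the strength enters through odd modes only, and the quadratic
term has modes 0 and ±2. The cos 2θ equation is therefore empty at this order, which justifies the
extra division by s. -/
theorem evenCoeffOne_leading (ν Y : ℝ) (g u : L1 ℕ) : evenCoeffOne (leading ν Y g u) = 0 := by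
  simp only [leading, map_add, map_smul, evenCoeffOne_evenSeries, shift_coord_zero,
    evenCoeffOne_pvOp_subst, evenCoeffOne_oddMode, pvOp_quotMode_zero_sq, map_sub, Wiener.one_def]
  simp [evenCoeffOne, coeff_ξpow]

theorem oddPart_leading (ν Y : ℝ) (g u : L1 ℕ) : oddPart (leading ν Y g u) =
    -((2 : ℝ) • g) + (8 * Y) • (L1.unit 0 : L1 ℕ) - (64 * Y ^ 2) • (L1.unit 1 : L1 ℕ) := by
  have h₁ : oddPart (evenSeries (shift u)) = 0 := by
    have h : oddPart ∘L evenSeries = 0 := L1.clm_ext fun k => by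
      simp [evenSeries_unit, oddPart_evenMode]
    exact congrArg (fun T => T (shift u)) h
  have h₂ : oddPart (pvOp (subst (evenSeries g))) = -g := by
    have h : oddPart ∘L pvOp ∘L subst ∘L evenSeries = -ContinuousLinearMap.id ℝ (L1 ℕ) :=
      L1.clm_ext fun k => by
        simp only [ContinuousLinearMap.comp_apply, pvOp_subst_evenSeries_unit, map_neg, map_smul,
          oddPart_oddMode, neg_apply, ContinuousLinearMap.id_apply, smul_smul]
        rw [show (1 / 2 * ((2 : ℝ) ^ (k + 1))⁻¹ * (2 * 2 ^ (k + 1)) : ℝ) = 1 by field_simp,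
          one_smul]
    exact congrArg (fun T => T g) h
  simp only [leading, map_add, map_smul, h₁, h₂, oddPart_oddMode, pvOp_quotMode_zero_sq, map_sub,
    Wiener.one_def, oddPart_ξpow, Int.sign_neg, show Int.sign 2 = 1 from rfl]
  norm_num
  module

theorem evenTail_leading (ν Y : ℝ) (g u : L1 ℕ) : evenTail (leading ν Y g u) =
    (8 : ℝ) • u - (48 * Y ^ 2) • (L1.unit 0 : L1 ℕ) := by
  have h₁ : evenTail (evenSeries (shift u)) = (2 : ℝ) • u := by
    have h : evenTail ∘L evenSeries ∘L shift = (2 : ℝ) • ContinuousLinearMap.id ℝ (L1 ℕ) :=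
      L1.clm_ext fun k => by
        simp only [ContinuousLinearMap.comp_apply, shift_unit, evenSeries_unit, map_smul,
          evenTail_evenMode, smul_apply, ContinuousLinearMap.id_apply, smul_smul]
        congr 1
        field_simp
    exact congrArg (fun T => T u) h
  have h₂ : evenTail (pvOp (subst (evenSeries g))) = 0 := by
    have h : evenTail ∘L pvOp ∘L subst ∘L evenSeries = 0 := L1.clm_ext fun k => by
      simp [pvOp_subst_evenSeries_unit, evenTail_oddMode]
    exact congrArg (fun T => T g) h
  simp only [leading, map_add, map_smul, h₁, h₂, evenTail_oddMode, pvOp_quotMode_zero_sq, map_sub,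
    Wiener.one_def, evenTail_ξpow]
  norm_num
  module

/-! ### The cos 2θ mode of the remainder at s = 0 -/

theorem evenCoeffOne_pvOp_ξtpow (k j : ℤ) : evenCoeffOne (pvOp (ξtpow k j)) =
    (if 1 ≤ j then -1 / 2 else 1 / 2) * (if k = 1 ∨ k = -1 then 1 else 0) := by
  rw [pvOp_ξtpow, map_smul, evenCoeffOne, add_apply, coeff_ξpow, coeff_ξpow, smul_eq_mul]
  congr 1
  split_ifs <;> first | omega | norm_num

/-- The exponents ±1 ± (n+1) of ξ have modulus at least 2 when n ≥ 2, so only the first mode of u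
can interact with `quotMode 0` to give cos 2θ. -/
theorem evenCoeffOne_pvOp_ξtpow_mul_quotMode {k j : ℤ} (hk : k = 1 ∨ k = -1) {n : ℕ} (hn : 2 ≤ n) :
    evenCoeffOne (pvOp (ξtpow k j * quotMode n)) = 0 := by
  rw [quotMode, mul_sub, Finset.mul_sum, Finset.mul_sum, map_sub, map_sub, map_sum, map_sum,
    map_sum, map_sum, Finset.sum_eq_zero, Finset.sum_eq_zero, sub_zero]
  all_goals
    intro i _
    rw [ξtpow_mul_ξtpow, evenCoeffOne_pvOp_ξtpow, if_neg (show ¬ (_ ∨ _) by omega), mul_zero]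

theorem evenCoeffOne_pvOp_quot_mul (u : L1 ℕ) :
    evenCoeffOne (pvOp (quotMode 0 * quotTail u)) = -(3 / 4) * u 0 := by
  have h : evenCoeffOne ∘L pvOp ∘L ContinuousLinearMap.mul ℝ Alg₂ (quotMode 0) ∘L quotTail =
      (-(3 / 4) : ℝ) • L1.coord 0 := by
    refine L1.clm_ext fun k => ?_
    simp only [ContinuousLinearMap.comp_apply, quotTail_unit, map_smul, smul_apply, L1.coord_apply,
      unit_coord, ContinuousLinearMap.mul_apply']
    rcases k with _ | k
    · rw [quotMode_zero, zero_add, quotMode_one]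
      simp only [mul_add, add_mul, mul_sub, sub_mul, ξtpow_mul_ξtpow, map_add, map_sub,
        evenCoeffOne_pvOp_ξtpow]
      norm_num
    · rw [quotMode_zero, sub_mul, add_mul, add_mul, map_sub, map_add, map_add, map_sub, map_add,
        map_add]
      rw [evenCoeffOne_pvOp_ξtpow_mul_quotMode (by simp) (by omega),
        evenCoeffOne_pvOp_ξtpow_mul_quotMode (by simp) (by omega),
        evenCoeffOne_pvOp_ξtpow_mul_quotMode (by simp) (by omega),
        evenCoeffOne_pvOp_ξtpow_mul_quotMode (by simp) (by omega)]
      simp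
  exact congrArg (fun T => T u) h

theorem evenCoeffOne_pvOp_subst_mul (g : L1 ℕ) :
    evenCoeffOne (pvOp (subst (evenSeries g) * quotMode 0)) = 1 / 2 * g 1 := by
  have h : evenCoeffOne ∘L pvOp ∘L (ContinuousLinearMap.mul ℝ Alg₂).flip (quotMode 0) ∘L
      subst ∘L evenSeries = (1 / 2 : ℝ) • L1.coord 1 := by
    refine L1.clm_ext fun k => ?_
    simp only [ContinuousLinearMap.comp_apply, evenSeries_unit, map_smul, smul_apply,
      L1.coord_apply, unit_coord, ContinuousLinearMap.mul_apply', ContinuousLinearMap.flip_apply,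
      evenMode, map_add, subst_ξpow, quotMode_zero]
    simp only [mul_add, mul_sub, ξtpow_mul_ξtpow, map_add, map_sub, evenCoeffOne_pvOp_ξtpow]
    rcases k with _ | _ | k
    · norm_num
    · norm_num
    · have e (a : ℤ) (ha : a = 1 ∨ a = -1) :
        (if ((k + 1 + 1 + 1 : ℕ) : ℤ) + a = 1 ∨ ((k + 1 + 1 + 1 : ℕ) : ℤ) + a = -1
          then (1 : ℝ) else 0) = 0 := if_neg (by omega)
      have e' (a : ℤ) (ha : a = 1 ∨ a = -1) :
        (if -((k + 1 + 1 + 1 : ℕ) : ℤ) + a = 1 ∨ -((k + 1 + 1 + 1 : ℕ) : ℤ) + a = -1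
          then (1 : ℝ) else 0) = 0 := if_neg (by omega)
      rw [e 1 (by simp), e (-1) (by simp), e' 1 (by simp), e' (-1) (by simp)]
      simp
  exact congrArg (fun T => T g) h

theorem evenCoeffOne_pvOp_quotMode_cube : evenCoeffOne (pvOp (quotMode 0 ^ 3)) = 9 := by
  rw [quotMode_zero, pow_three]
  simp only [mul_add, add_mul, mul_sub, sub_mul, ξtpow_mul_ξtpow, map_add, map_sub,
    evenCoeffOne_pvOp_ξtpow]
  norm_num

/-- This is the solvability condition at third order. With the values of ν, g and u forced by the
other components it becomes 2Y(1 - 16Y²). -/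
theorem evenCoeffOne_remainder_zero (ν Y : ℝ) (g u : L1 ℕ) :
    evenCoeffOne (remainder 0 ν Y g u) =
      -6 * Y * u 0 - Y * g 1 - 36 * Y ^ 3 + Y + 1 / 2 * g 0 - 2 * ν * Y := by
  have hc : evenCoeffOne cosTwo = 2 := by
    simp [evenCoeffOne, cosTwo, evenMode, coeff_ξpow]
    norm_num
  have hq : evenCoeffOne (pvOp (quotMode 0 ^ 2)) = 0 := by
    rw [pvOp_quotMode_zero_sq, Wiener.one_def]
    simp [evenCoeffOne, coeff_ξpow]
  have hi : quotInv 0 Y u = 1 := by simp [quotInv]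
  have hQ : quot 0 Y u = Y • quotMode 0 := by simp [quot]
  simp only [remainder, velocityTwo, velocityOne, radius, radiusDeriv, hi, hQ, mul_one, zero_smul,
    smul_pow, mul_smul_comm, map_add, map_sub, map_smul, evenCoeffOne_evenSeries, shift_coord_zero,
    shiftDiv_coord_zero, evenCoeffOne_pvOp_quot_mul, evenCoeffOne_pvOp_subst_mul,
    evenCoeffOne_pvOp_quotMode_cube, evenCoeffOne_pvOp_subst, evenCoeffOne_derivTail,
    evenCoeffOne_oddMode, hc, hq, smul_eq_mul, mul_zero, map_zero, zero_pow, ne_eq,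
    OfNat.ofNat_ne_zero, not_false_eq_true]
  ring

/-! ### The implicit function theorem -/

/-- The unknowns `(ν, Y, g, u)` of the rescaled equation. -/
abbrev Unknown : Type := ℝ × ℝ × L1 ℕ × L1 ℕ

/-- The rescaled equation in coordinates. Since the `cos 2θ` mode of the leading part vanishes, this
mode is divided by `s` once more. -/
def rescaled (x : ℝ × Unknown) : Unknown :=
  let L := leading x.2.1 x.2.2.1 x.2.2.2.1 x.2.2.2.2
  let R := remainder x.1 x.2.1 x.2.2.1 x.2.2.2.1 x.2.2.2.2
  (coeff 0 (L + x.1 • R), evenCoeffOne R, oddPart (L + x.1 • R), evenTail (L + x.1 • R))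

theorem leading_add_remainder_eq_zero {s ν Y : ℝ} {g u : L1 ℕ}
    (h : rescaled (s, ν, Y, g, u) = 0) : leading ν Y g u + s • remainder s ν Y g u = 0 := by
  simp only [rescaled, Prod.mk_eq_zero] at h
  obtain ⟨h₀, h₁, h₂, h₃⟩ := h
  refine eq_zero_of_parts h₀ ?_ h₂ h₃
  rw [map_add, map_smul, h₁, evenCoeffOne_leading, smul_zero, add_zero]

theorem rescaled_zero (ν Y : ℝ) (g u : L1 ℕ) : rescaled (0, ν, Y, g, u) =
    (1 / 2 - ν - 4 * Y ^ 2,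
      -6 * Y * u 0 - Y * g 1 - 36 * Y ^ 3 + Y + 1 / 2 * g 0 - 2 * ν * Y,
      -((2 : ℝ) • g) + (8 * Y) • (L1.unit 0 : L1 ℕ) - (64 * Y ^ 2) • (L1.unit 1 : L1 ℕ),
      (8 : ℝ) • u - (48 * Y ^ 2) • (L1.unit 0 : L1 ℕ)) := by
  simp only [rescaled, zero_smul, add_zero, coeff_zero_leading, evenCoeffOne_remainder_zero,
    oddPart_leading, evenTail_leading]

/-- Everything is polynomial in continuous linear expressions except `quotInv`, the inverse of 1 + s
• `quot`. At s = 0 this element is the unit 1, near which inversion in a Banach algebra is smooth.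
-/
theorem contDiffAt_rescaled (U : Unknown) : ContDiffAt ℝ 1 rescaled (0, U) := by
  have hq : ContDiffAt ℝ 1 (fun x : ℝ × Unknown => quotInv x.1 x.2.2.1 x.2.2.2.2) (0, U) := by
    refine ContDiffAt.comp (g := Ring.inverse) (0, U) ?_ ?_
    · simpa using contDiffAt_ringInverse ℝ (1 : Alg₂ˣ)
    · unfold quot
      fun_prop
  have hq2 : ContDiffAt ℝ 1 (fun x : ℝ × Unknown => quot x.1 x.2.2.1 x.2.2.2.2) (0, U) := by
    unfold quot
    fun_prop
  have hL : ContDiffAt ℝ 1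
      (fun x : ℝ × Unknown => leading x.2.1 x.2.2.1 x.2.2.2.1 x.2.2.2.2) (0, U) := by
    unfold leading
    fun_prop
  have hV₁ : ContDiffAt ℝ 1
      (fun x : ℝ × Unknown => velocityOne x.2.2.1 x.2.2.2.1 x.2.2.2.2) (0, U) := by
    unfold velocityOne
    fun_prop
  have hV₂ : ContDiffAt ℝ 1
      (fun x : ℝ × Unknown => velocityTwo x.1 x.2.2.1 x.2.2.2.1 x.2.2.2.2) (0, U) := by
    unfold velocityTwo
    fun_prop
  have hR : ContDiffAt ℝ 1
      (fun x : ℝ × Unknown => remainder x.1 x.2.1 x.2.2.1 x.2.2.2.1 x.2.2.2.2) (0, U) := by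
    unfold remainder radius radiusDeriv
    fun_prop
  have hS := hL.add (contDiffAt_fst.smul hR)
  exact ((coeff 0).contDiff.contDiffAt.comp _ hS).prodMk ((evenCoeffOne.contDiff.contDiffAt.comp _
    hR).prodMk ((oddPart.contDiff.contDiffAt.comp _ hS).prodMk
      (evenTail.contDiff.contDiffAt.comp _ hS)))

/-- The point from which the branch with slope `2Y` emanates. -/
def basePoint (Y : ℝ) : Unknown :=
  (1 / 4, Y, (4 * Y) • (L1.unit 0 : L1 ℕ) - (2 : ℝ) • (L1.unit 1 : L1 ℕ),
    (3 / 8 : ℝ) • (L1.unit 0 : L1 ℕ))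

theorem rescaled_basePoint {Y : ℝ} (hY : 16 * Y ^ 2 = 1) : rescaled (0, basePoint Y) = 0 := by
  have h2 : Y ^ 2 = 1 / 16 := by linarith
  have h3 : Y ^ 3 = Y / 16 := by rw [pow_succ, h2]; ring
  rw [basePoint, rescaled_zero]
  simp only [Prod.mk_eq_zero, h2, h3]
  refine ⟨by norm_num, ?_, by module, by module⟩
  simp only [L1.sub_coord, L1.smul_coord, unit_coord]
  norm_num
  ring

/-- Only directions inside s = 0 are needed, and there `rescaled` is the explicit map of
`rescaled_zero`. The derivative is computed along a line and identified by uniqueness. -/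
theorem fderiv_rescaled_apply {Y : ℝ} (hY : 16 * Y ^ 2 = 1) (n y : ℝ) (g u : L1 ℕ) :
    fderiv ℝ rescaled (0, basePoint Y) (0, n, y, g, u) =
      (-n - 8 * Y * y,
        -(13 / 2) * y - 6 * Y * u 0 - Y * g 1 + 1 / 2 * g 0 - 2 * Y * n,
        -((2 : ℝ) • g) + (8 * y) • (L1.unit 0 : L1 ℕ) - (128 * Y * y) • (L1.unit 1 : L1 ℕ),
        (8 : ℝ) • u - (96 * Y * y) • (L1.unit 0 : L1 ℕ)) := by
  have h2 : Y ^ 2 = 1 / 16 := by linarith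
  have hline : HasDerivAt (fun t : ℝ => ((0 : ℝ), basePoint Y) + t • ((0 : ℝ), n, y, g, u))
      (0, n, y, g, u) 0 := by
    simpa using ((hasDerivAt_id (0 : ℝ)).smul_const ((0 : ℝ), n, y, g, u)).const_add
      ((0 : ℝ), basePoint Y)
  have hF := ((contDiffAt_rescaled (basePoint Y)).differentiableAt (by simp)).hasFDerivAt
  have h₁ := HasFDerivAt.comp_hasDerivAt (0 : ℝ) (l := rescaled)
    (f := fun t : ℝ => ((0 : ℝ), basePoint Y) + t • ((0 : ℝ), n, y, g, u))
    (by simpa using hF) hline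
  refine h₁.unique ?_
  have hfun : (rescaled ∘ fun t : ℝ => ((0 : ℝ), basePoint Y) + t • ((0 : ℝ), n, y, g, u)) =
      fun t => (1 / 2 - (1 / 4 + t * n) - 4 * (Y + t * y) ^ 2,
        -6 * (Y + t * y) * (3 / 8 + t * u 0) - (Y + t * y) * (-2 + t * g 1)
          - 36 * (Y + t * y) ^ 3 + (Y + t * y) + 1 / 2 * (4 * Y + t * g 0)
          - 2 * (1 / 4 + t * n) * (Y + t * y),
        -((2 : ℝ) • ((4 * Y) • (L1.unit 0 : L1 ℕ) - (2 : ℝ) • (L1.unit 1 : L1 ℕ) + t • g))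
          + (8 * (Y + t * y)) • (L1.unit 0 : L1 ℕ) - (64 * (Y + t * y) ^ 2) • (L1.unit 1 : L1 ℕ),
        (8 : ℝ) • ((3 / 8 : ℝ) • (L1.unit 0 : L1 ℕ) + t • u)
          - (48 * (Y + t * y) ^ 2) • (L1.unit 0 : L1 ℕ)) := by
    funext t
    have hp : ((0 : ℝ), basePoint Y) + t • ((0 : ℝ), n, y, g, u) = (0, 1 / 4 + t * n, Y + t * y,
        (4 * Y) • (L1.unit 0 : L1 ℕ) - (2 : ℝ) • (L1.unit 1 : L1 ℕ) + t • g,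
        (3 / 8 : ℝ) • (L1.unit 0 : L1 ℕ) + t • u) := by
      simp [basePoint]
    rw [Function.comp_apply, hp, rescaled_zero]
    simp only [L1.add_coord, L1.sub_coord, L1.smul_coord, unit_coord]
    norm_num
  rw [hfun]
  have hy : HasDerivAt (fun t : ℝ => Y + t * y) y 0 := by
    simpa using ((hasDerivAt_id (0 : ℝ)).mul_const y).const_add Y
  have hlin (c d : ℝ) : HasDerivAt (fun t : ℝ => c + t * d) d 0 := by
    simpa using ((hasDerivAt_id (0 : ℝ)).mul_const d).const_add c
  have hvec (a b : L1 ℕ) : HasDerivAt (fun t : ℝ => a + t • b) b 0 := by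
    simpa using ((hasDerivAt_id (0 : ℝ)).smul_const b).const_add a
  refine HasDerivAt.prodMk ?_ (HasDerivAt.prodMk ?_ (HasDerivAt.prodMk ?_ ?_))
  · refine HasDerivAt.congr_deriv
      (((hlin (1 / 4) n).const_sub (1 / 2)).sub ((hy.pow 2).const_mul 4)) ?_
    simp
    ring
  · refine HasDerivAt.congr_deriv (((((((hy.const_mul (-6)).mul (hlin (3 / 8) (u 0))).sub
      (hy.mul (hlin (-2) (g 1)))).sub ((hy.pow 3).const_mul 36)).add hy).add
      ((hlin (4 * Y) (g 0)).const_mul (1 / 2))).sub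
      (((hlin (1 / 4) n).const_mul 2).mul hy)) ?_
    simp
    linear_combination (-27 / 4 * y) * hY
  · refine HasDerivAt.congr_deriv ((((hvec _ g).const_smul (2 : ℝ)).neg.add
      ((hy.const_mul 8).smul_const (L1.unit 0 : L1 ℕ))).sub
      (((hy.pow 2).const_mul 64).smul_const (L1.unit 1 : L1 ℕ))) ?_
    simp only [Nat.cast_ofNat, zero_mul, add_zero, Nat.add_one_sub_one, pow_one]
    module
  · refine HasDerivAt.congr_deriv (((hvec _ u).const_smul (8 : ℝ)).sub
      (((hy.pow 2).const_mul 48).smul_const (L1.unit 0 : L1 ℕ))) ?_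
    simp only [Nat.cast_ofNat, zero_mul, add_zero, Nat.add_one_sub_one, pow_one]
    module

/-- The system is triangular: the first, third and fourth components express n, g and u through y.
Substituted into the second they leave -4y, where -4 is the derivative of 2Y - 32Y³ at Y² = 1/16. -/
theorem isInvertible_fderiv_rescaled {Y : ℝ} (hY : 16 * Y ^ 2 = 1) :
    (fderiv ℝ rescaled (0, basePoint Y) ∘L .inr ℝ ℝ Unknown).IsInvertible := by
  set T := fderiv ℝ rescaled (0, basePoint Y) ∘L .inr ℝ ℝ Unknown with hT
  have hTa (n y : ℝ) (g u : L1 ℕ) : T (n, y, g, u) = _ := fderiv_rescaled_apply hY n y g u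
  have hker : T.ker = ⊥ := by
    rw [LinearMap.ker_eq_bot']
    rintro ⟨n, y, g, u⟩ h
    have h := (hTa n y g u).symm.trans h
    simp only [Prod.mk_eq_zero] at h
    obtain ⟨h₀, h₁, h₂, h₃⟩ := h
    have hu : u = (12 * Y * y) • (L1.unit 0 : L1 ℕ) := by
      rw [← sub_eq_zero, ← smul_zero (A := L1 ℕ) (1 / 8 : ℝ), ← h₃]
      module
    have hg : g = (4 * y) • (L1.unit 0 : L1 ℕ) - (64 * Y * y) • (L1.unit 1 : L1 ℕ) := by
      rw [← sub_eq_zero, ← smul_zero (A := L1 ℕ) (-1 / 2 : ℝ), ← h₂]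
      module
    have hn : n = -8 * Y * y := by linarith
    have hy : y = 0 := by
      rw [hu, hg, hn] at h₁
      simp only [L1.sub_coord, L1.smul_coord, unit_coord] at h₁
      norm_num at h₁
      linear_combination (-1 / 4) * h₁ + (1 / 8 * y) * hY
    subst hy
    simp only [mul_zero, zero_smul, sub_zero] at hu hg hn
    rw [hu, hg, hn]
    rfl
  have hrange : T.range = ⊤ := by
    rw [LinearMap.range_eq_top]
    rintro ⟨a, b, c, d⟩
    -- The second component after elimination of n, g and u is -4y plus terms in the data, here
    -- solved for y.
    set y : ℝ := -(b + 3 / 4 * Y * d 0 - 1 / 2 * Y * c 1 + 1 / 4 * c 0 - 2 * Y * a) / 4 with hy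
    refine ⟨(-a - 8 * Y * y, y,
      -((1 / 2 : ℝ) • c) + (4 * y) • (L1.unit 0 : L1 ℕ) - (64 * Y * y) • (L1.unit 1 : L1 ℕ),
      (1 / 8 : ℝ) • d + (12 * Y * y) • (L1.unit 0 : L1 ℕ)), ?_⟩
    refine (hTa _ _ _ _).trans ?_
    refine Prod.ext ?_ (Prod.ext ?_ (Prod.ext ?_ ?_))
    · simp
    · simp only [L1.add_coord, L1.sub_coord, L1.neg_coord, L1.smul_coord, unit_coord]
      norm_num
      linear_combination (-4) * hy + (y / 2) * hY
    · simp only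
      module
    · simp only
      module
  exact ⟨ContinuousLinearEquiv.ofBijective T hker hrange,
    ContinuousLinearEquiv.coe_ofBijective T hker hrange⟩

theorem exists_branch {Y : ℝ} (hY : 16 * Y ^ 2 = 1) : ∃ ψ : ℝ → Unknown, ψ 0 = basePoint Y ∧
    (∀ᶠ s in 𝓝 0, ContinuousAt ψ s) ∧
    ∀ᶠ s in 𝓝 0, leading (ψ s).1 (ψ s).2.1 (ψ s).2.2.1 (ψ s).2.2.2 +
      s • remainder s (ψ s).1 (ψ s).2.1 (ψ s).2.2.1 (ψ s).2.2.2 = 0 := by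
  have hc := contDiffAt_rescaled (basePoint Y)
  have hi := isInvertible_fderiv_rescaled hY
  refine ⟨hc.implicitFunction one_ne_zero hi, hc.implicitFunction_apply_self one_ne_zero hi, ?_, ?_⟩
  -- Differentiability of class C¹ at 0 holds on a neighbourhood, which yields continuity of the
  -- branch at all small s and not merely at 0.
  · filter_upwards [(hc.contDiffAt_implicitFunction one_ne_zero hi).eventually (by simp)] with s hs
    exact hs.continuousAt
  · filter_upwards [hc.eventually_apply_implicitFunction one_ne_zero hi] with s hs
    rw [rescaled_basePoint hY] at hs
    exact leading_add_remainder_eq_zero hs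

/-! ### Cosine series in a strip -/

/-- The function `2^{-k} cos(2(k+1)z)`. -/
def cosTerm (k : ℕ) (z : ℂ) : ℂ := ((2 : ℂ) ^ (k + 1))⁻¹ * (2 * Complex.cos (2 * (k + 1) * z))

/-- The series `∑ 2^{-k} aₖ cos(2(k+1)z)`. -/
def cosSeries (a : L1 ℕ) (z : ℂ) : ℂ := ∑' k, (a k : ℂ) * cosTerm k z

/-- The open strip `|Im z| < (log 2)/2`. -/
def openStrip : Set ℂ := {z | |z.im| < Real.log 2 / 2}

theorem isOpen_openStrip : IsOpen openStrip :=
  isOpen_lt (continuous_abs.comp Complex.continuous_im) continuous_const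

theorem ofReal_mem_openStrip (θ : ℝ) : (θ : ℂ) ∈ openStrip := by
  have : 0 < Real.log 2 := Real.log_pos (by norm_num)
  simpa [openStrip] using this

/-- In this strip |exp(±2i(k+1)z)| ≤ exp((k+1) log 2) = 2^(k+1), which the normalising factor
cancels. The weight 2^|k| thus fixes the width of the strip. -/
theorem norm_cosTerm_le (k : ℕ) {z : ℂ} (hz : z ∈ openStrip) : ‖cosTerm k z‖ ≤ 2 := by
  have hexp (σ : ℝ) (hσ : |σ| = 1) :
      ‖Complex.exp (σ * ((2 * (k + 1) * z) * Complex.I))‖ ≤ 2 ^ (k + 1) := by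
    rw [Complex.norm_exp, ← Real.exp_log (show (0 : ℝ) < 2 ^ (k + 1) by positivity), Real.log_pow]
    refine Real.exp_le_exp.2 ?_
    have h : (σ * ((2 * (k + 1) * z) * Complex.I)).re = -(2 * (k + 1) * (σ * z.im)) := by
      simp
      ring
    rw [h]
    have h1 : |σ * z.im| < Real.log 2 / 2 := by rw [abs_mul, hσ, one_mul]; exact hz
    have h2 := (abs_lt.1 h1).1
    push_cast
    nlinarith [(Nat.cast_nonneg k : (0 : ℝ) ≤ k)]
  have h₁ := hexp 1 (by simp)
  have h₂ := hexp (-1) (by simp)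
  simp only [Complex.ofReal_one, Complex.ofReal_neg, one_mul, neg_mul] at h₁ h₂
  rw [cosTerm, Complex.two_cos, norm_mul, norm_inv, norm_pow, Complex.norm_ofNat,
    inv_mul_le_iff₀ (by positivity)]
  refine (norm_add_le _ _).trans ?_
  rw [neg_mul]
  linarith

theorem summable_cosTerm_bound (a : L1 ℕ) : Summable fun k => |a k| * 2 :=
  (L1.hasSum_norm_coord a).summable.mul_right 2

theorem norm_coord_mul_cosTerm_le (a : L1 ℕ) (k : ℕ) {z : ℂ} (hz : z ∈ openStrip) :
    ‖(a k : ℂ) * cosTerm k z‖ ≤ |a k| * 2 := by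
  rw [norm_mul, Complex.norm_real, Real.norm_eq_abs]
  exact mul_le_mul_of_nonneg_left (norm_cosTerm_le k hz) (abs_nonneg _)

theorem hasSum_cosSeries (a : L1 ℕ) {z : ℂ} (hz : z ∈ openStrip) :
    HasSum (fun k => (a k : ℂ) * cosTerm k z) (cosSeries a z) :=
  (Summable.of_norm_bounded (summable_cosTerm_bound a) fun k =>
    norm_coord_mul_cosTerm_le a k hz).hasSum

theorem norm_cosSeries_le (a : L1 ℕ) {z : ℂ} (hz : z ∈ openStrip) :
    ‖cosSeries a z‖ ≤ 2 * ‖a‖ := by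
  rw [mul_comm]
  exact tsum_of_norm_bounded ((L1.hasSum_norm_coord a).mul_right 2) fun k =>
    norm_coord_mul_cosTerm_le a k hz

theorem cosSeries_sub (a b : L1 ℕ) {z : ℂ} (hz : z ∈ openStrip) :
    cosSeries (a - b) z = cosSeries a z - cosSeries b z := by
  refine (hasSum_cosSeries (a - b) hz).unique ?_
  have h (k : ℕ) : ((a - b) k : ℂ) * cosTerm k z =
      (a k : ℂ) * cosTerm k z - (b k : ℂ) * cosTerm k z := by
    rw [L1.sub_coord]
    push_cast
    ring
  simp only [h]
  exact (hasSum_cosSeries a hz).sub (hasSum_cosSeries b hz)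

theorem cosSeries_zero : cosSeries 0 = 0 := by
  funext z
  simp [cosSeries]

theorem differentiable_cosTerm (k : ℕ) : Differentiable ℂ (cosTerm k) := by
  unfold cosTerm
  fun_prop

theorem deriv_cosTerm (k : ℕ) (z : ℂ) : deriv (cosTerm k) z =
    -(((2 : ℂ) ^ (k + 1))⁻¹ * (4 * (k + 1) * Complex.sin (2 * (k + 1) * z))) := by
  have h : HasDerivAt (fun z : ℂ => 2 * (k + 1) * z) (2 * (k + 1) : ℂ) z := by
    simpa using (hasDerivAt_id z).const_mul (2 * (k + 1) : ℂ)
  have := ((h.ccos.const_mul 2).const_mul ((2 : ℂ) ^ (k + 1))⁻¹).deriv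
  refine this.trans ?_
  ring

theorem differentiableOn_cosSeries (a : L1 ℕ) : DifferentiableOn ℂ (cosSeries a) openStrip :=
  Complex.differentiableOn_tsum_of_summable_norm (summable_cosTerm_bound a)
    (fun k => ((differentiable_cosTerm k).const_mul _).differentiableOn) isOpen_openStrip
    fun k _ hz => norm_coord_mul_cosTerm_le a k hz

theorem hasSum_deriv_cosSeries (a : L1 ℕ) {z : ℂ} (hz : z ∈ openStrip) :
    HasSum (fun k => (a k : ℂ) * deriv (cosTerm k) z) (deriv (cosSeries a) z) := by
  have h := Complex.hasSum_deriv_of_summable_norm (summable_cosTerm_bound a)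
    (fun k => ((differentiable_cosTerm k).const_mul (a k : ℂ)).differentiableOn) isOpen_openStrip
    (fun k _ hz => norm_coord_mul_cosTerm_le a k hz) hz
  simp only [deriv_const_mul_field] at h
  exact h

theorem cosTerm_ofReal (k : ℕ) (θ : ℝ) :
    cosTerm k θ = ((((2 : ℝ) ^ (k + 1))⁻¹ * (2 * Real.cos (2 * (k + 1) * θ)) : ℝ) : ℂ) := by
  rw [cosTerm]
  push_cast
  rfl

theorem hasSum_cosSeries_ofReal (a : L1 ℕ) (θ : ℝ) :
    HasSum (fun k : ℕ => ((a k * ((2 : ℝ) ^ (k + 1))⁻¹ * 2 * Real.cos (2 * (k + 1) * θ) : ℝ) : ℂ))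
      (cosSeries a θ) := by
  convert hasSum_cosSeries a (ofReal_mem_openStrip θ) using 2 with k
  rw [cosTerm_ofReal]
  push_cast
  ring

theorem hasSum_onReal_cosSeries (a : L1 ℕ) (θ : ℝ) :
    HasSum (fun k : ℕ => a k * ((2 : ℝ) ^ (k + 1))⁻¹ * 2 * Real.cos (2 * (k + 1) * θ))
      (onReal (cosSeries a) θ) :=
  Complex.hasSum_re (hasSum_cosSeries_ofReal a θ)

theorem cosSeries_ofReal (a : L1 ℕ) (θ : ℝ) : cosSeries a θ = (onReal (cosSeries a) θ : ℂ) :=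
  (hasSum_cosSeries_ofReal a θ).unique (Complex.hasSum_ofReal.2 (hasSum_onReal_cosSeries a θ))

theorem abs_onReal_cosSeries_le (a : L1 ℕ) (θ : ℝ) : |onReal (cosSeries a) θ| ≤ 2 * ‖a‖ :=
  (Complex.abs_re_le_norm _).trans (norm_cosSeries_le a (ofReal_mem_openStrip θ))

theorem hasDerivAt_onReal_cosSeries (a : L1 ℕ) (θ : ℝ) :
    HasDerivAt (onReal (cosSeries a)) (deriv (cosSeries a) θ).re θ :=
  ((differentiableOn_cosSeries a).differentiableAt
    (isOpen_openStrip.mem_nhds (ofReal_mem_openStrip θ))).hasDerivAt.real_of_complex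

theorem deriv_cosSeries_ofReal (a : L1 ℕ) (θ : ℝ) :
    deriv (cosSeries a) θ = ((deriv (onReal (cosSeries a)) θ : ℝ) : ℂ) := by
  have hs := hasSum_deriv_cosSeries a (ofReal_mem_openStrip θ)
  have h (k : ℕ) : (a k : ℂ) * deriv (cosTerm k) θ = ((a k * -(((2 : ℝ) ^ (k + 1))⁻¹ *
      (4 * (k + 1) * Real.sin (2 * (k + 1) * θ))) : ℝ) : ℂ) := by
    rw [deriv_cosTerm]
    push_cast
    rfl
  simp only [h] at hs
  have h' := Complex.hasSum_ofReal.2 (Complex.hasSum_re hs)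
  rw [(hasDerivAt_onReal_cosSeries a θ).deriv]
  exact hs.unique h'

/-! ### The cos 2θ Fourier coefficient of a series -/

theorem integral_cos_mul_cos_two (k : ℕ) :
    ∫ θ in (-Real.pi)..Real.pi, Real.cos (2 * (k + 1) * θ) * Real.cos (2 * θ) =
      if k = 0 then Real.pi else 0 := by
  have hcos (n : ℤ) (hn : n ≠ 0) : ∫ θ in (-Real.pi)..Real.pi, Real.cos (n * θ) = 0 := by
    have : (n : ℝ) ≠ 0 := by exact_mod_cast hn
    rw [intervalIntegral.integral_comp_mul_left (fun x => Real.cos x) this, integral_cos]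
    simp [Real.sin_int_mul_pi]
  have h (θ : ℝ) : Real.cos (2 * (k + 1) * θ) * Real.cos (2 * θ) =
      (1 / 2) * (Real.cos (((2 * k + 4 : ℤ) : ℝ) * θ) + Real.cos (((2 * k : ℤ) : ℝ) * θ)) := by
    have h₁ := Real.cos_add (2 * (k + 1) * θ) (2 * θ)
    have h₂ := Real.cos_sub (2 * (k + 1) * θ) (2 * θ)
    push_cast
    rw [show 2 * (k + 1) * θ + 2 * θ = (2 * k + 4) * θ by ring] at h₁
    rw [show 2 * (k + 1) * θ - 2 * θ = (2 * k) * θ by ring] at h₂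
    linarith
  simp only [h]
  rw [intervalIntegral.integral_const_mul, intervalIntegral.integral_add
    (Continuous.intervalIntegrable (by fun_prop) _ _)
    (Continuous.intervalIntegrable (by fun_prop) _ _), hcos (2 * k + 4) (by omega)]
  split_ifs with hk
  · subst hk
    simp
    ring
  · rw [hcos (2 * k) (by omega)]
    simp

theorem hasSum_intervalIntegral_of_norm_le {ι E : Type*} [Countable ι] [NormedAddCommGroup E]
    [NormedSpace ℝ E] {F : ι → ℝ → E} {f : ℝ → E} {u : ι → ℝ} (hF : ∀ i, Continuous (F i))
    (hu : Summable u) (hle : ∀ i t, ‖F i t‖ ≤ u i) (hf : ∀ t, HasSum (fun i => F i t) (f t))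
    (a b : ℝ) : HasSum (fun i => ∫ t in a..b, F i t) (∫ t in a..b, f t) :=
  intervalIntegral.hasSum_integral_of_dominated_convergence (fun i _ => u i)
    (fun i => (hF i).aestronglyMeasurable) (fun i => .of_forall fun t _ => hle i t)
    (.of_forall fun _ _ => hu) intervalIntegrable_const (.of_forall fun t _ => hf t)

theorem modeTwo_cosSeries (a : L1 ℕ) : modeTwo (onReal (cosSeries a)) = a 0 := by
  have h := hasSum_intervalIntegral_of_norm_le
    (F := fun (k : ℕ) θ => a k * ((2 : ℝ) ^ (k + 1))⁻¹ * 2 * (Real.cos (2 * (k + 1) * θ)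
      * Real.cos (2 * θ))) (f := fun θ => onReal (cosSeries a) θ * Real.cos (2 * θ))
    (fun k => by fun_prop) (summable_cosTerm_bound a) (fun k θ => ?_) (fun θ => ?_)
    (-Real.pi) Real.pi
  · simp only [intervalIntegral.integral_const_mul, integral_cos_mul_cos_two] at h
    have h' := h.unique (hasSum_single 0 fun k hk => by simp [hk])
    rw [modeTwo, h']
    have := Real.pi_ne_zero
    simp
    field_simp
  · rw [norm_mul, norm_mul, norm_mul, norm_mul, Real.norm_ofNat, norm_inv, norm_pow,
      Real.norm_ofNat]
    have h₁ : ((2 : ℝ) ^ (k + 1))⁻¹ ≤ 1 := inv_le_one_of_one_le₀ (one_le_pow₀ (by norm_num))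
    have h₂ := Real.abs_cos_le_one (2 * (k + 1) * θ)
    have h₃ := Real.abs_cos_le_one (2 * θ)
    simp only [Real.norm_eq_abs]
    calc |a k| * ((2 : ℝ) ^ (k + 1))⁻¹ * 2 * (|Real.cos (2 * (k + 1) * θ)| * |Real.cos (2 * θ)|)
        ≤ |a k| * 1 * 2 * (1 * 1) := by gcongr
      _ = |a k| * 2 := by ring
  · simpa only [mul_assoc] using (hasSum_onReal_cosSeries a θ).mul_right (Real.cos (2 * θ))

/-! ### Membership in `X k c` and norm estimates -/

theorem strip_subset_openStrip {c : ℝ} (hc : c < Real.log 2 / 4) : strip c ⊆ openStrip := by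
  intro z hz
  have : 0 < Real.log 2 := Real.log_pos (by norm_num)
  have hz : |z.im| ≤ c := hz
  change |z.im| < Real.log 2 / 2
  linarith

theorem ofReal_add_mem_strip {c y : ℝ} (hy : |y| ≤ c) (θ : ℝ) :
    (θ + y * Complex.I : ℂ) ∈ strip c := by
  simpa [strip] using hy

theorem continuous_energyDensity {f : ℂ → ℂ} (hf : DifferentiableOn ℂ f openStrip) {c y : ℝ}
    (hc : c < Real.log 2 / 4) (hy : |y| ≤ c) (k : ℕ) : Continuous (energyDensity k f y) := by
  have ha : AnalyticOnNhd ℂ f openStrip := hf.analyticOnNhd isOpen_openStrip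
  have hline : Continuous fun θ : ℝ => (θ + y * Complex.I : ℂ) := by fun_prop
  have hmem (θ : ℝ) : (θ + y * Complex.I : ℂ) ∈ openStrip :=
    strip_subset_openStrip hc (ofReal_add_mem_strip hy θ)
  have h₁ : Continuous fun θ : ℝ => f (θ + y * Complex.I) :=
    ha.continuousOn.comp_continuous hline hmem
  have h₂ : Continuous fun θ : ℝ => iteratedDeriv k f (θ + y * Complex.I) := by
    rw [iteratedDeriv_eq_iterate]
    exact (ha.iterated_deriv k).continuousOn.comp_continuous hline hmem
  exact (h₁.norm.pow 2).add (h₂.norm.pow 2)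

theorem cosSeries_mem_X (a : L1 ℕ) (k : ℕ) {c : ℝ} (hc₀ : 0 < c) (hc : c < Real.log 2 / 4) :
    cosSeries a ∈ X k c := by
  have hd := differentiableOn_cosSeries a
  refine ⟨(hd.analyticOnNhd isOpen_openStrip).mono (strip_subset_openStrip hc),
    ⟨fun n => a n * ((2 : ℝ) ^ (n + 1))⁻¹ * 2, hasSum_cosSeries_ofReal a⟩, ?_, ?_⟩
  · exact (continuous_energyDensity hd hc (abs_of_pos hc₀).le k).intervalIntegrable _ _
  · exact (continuous_energyDensity hd hc (by rw [abs_neg, abs_of_pos hc₀]) k).intervalIntegrable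
      _ _

/-- Cauchy's estimate on a circle of radius (log 2)/4. The bound c < (log 2)/4 keeps that circle
inside the open strip. -/
theorem energyDensity_le {f : ℂ → ℂ} (hf : DifferentiableOn ℂ f openStrip) {M : ℝ}
    (hM : ∀ z ∈ openStrip, ‖f z‖ ≤ M) {c y : ℝ} (hc : c < Real.log 2 / 4) (hy : |y| ≤ c)
    (k : ℕ) (θ : ℝ) :
    energyDensity k f y θ ≤ (1 + (k.factorial / (Real.log 2 / 4) ^ k) ^ 2) * M ^ 2 := by
  have hlog : 0 < Real.log 2 / 4 := by
    have : 0 < Real.log 2 := Real.log_pos (by norm_num)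
    positivity
  set z : ℂ := θ + y * Complex.I with hz
  have hzim : |z.im| ≤ c := ofReal_add_mem_strip hy θ
  have hball : Metric.closedBall z (Real.log 2 / 4) ⊆ openStrip := by
    intro w hw
    have h₁ : |w.im - z.im| ≤ Real.log 2 / 4 := by
      rw [← Complex.sub_im]
      exact (Complex.abs_im_le_norm _).trans (by simpa [dist_eq_norm] using hw)
    change |w.im| < Real.log 2 / 2
    have h₂ : |w.im| ≤ |w.im - z.im| + |z.im| := by
      simpa using abs_add_le (w.im - z.im) z.im
    linarith
  have h₀ : ‖f z‖ ≤ M := hM z (hball (Metric.mem_closedBall_self hlog.le))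
  have hk : ‖iteratedDeriv k f z‖ ≤ k.factorial * M / (Real.log 2 / 4) ^ k := by
    refine Complex.norm_iteratedDeriv_le_of_forall_mem_sphere_norm_le k hlog ?_ fun w hw =>
      hM w (hball (Metric.sphere_subset_closedBall hw))
    refine DifferentiableOn.diffContOnCl ?_
    rw [closure_ball z hlog.ne']
    exact hf.mono hball
  rw [energyDensity, ← hz]
  calc ‖f z‖ ^ 2 + ‖iteratedDeriv k f z‖ ^ 2
      ≤ M ^ 2 + (k.factorial * M / (Real.log 2 / 4) ^ k) ^ 2 := by gcongr
    _ = _ := by ring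

theorem stripNormSq_le {f : ℂ → ℂ} (hf : DifferentiableOn ℂ f openStrip) {M : ℝ}
    (hM : ∀ z ∈ openStrip, ‖f z‖ ≤ M) {c : ℝ} (hc₀ : 0 < c) (hc : c < Real.log 2 / 4) (k : ℕ) :
    stripNormSq k c f ≤
      4 * Real.pi * ((1 + (k.factorial / (Real.log 2 / 4) ^ k) ^ 2) * M ^ 2) := by
  have hInt (y : ℝ) (hy : |y| ≤ c) : ∫ θ in (-Real.pi)..Real.pi, energyDensity k f y θ ≤
      2 * Real.pi * ((1 + (k.factorial / (Real.log 2 / 4) ^ k) ^ 2) * M ^ 2) := by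
    have := intervalIntegral.integral_mono_on (a := -Real.pi) (b := Real.pi)
      (μ := MeasureTheory.volume) (by linarith [Real.pi_pos])
      ((continuous_energyDensity hf hc hy k).intervalIntegrable _ _)
      intervalIntegrable_const fun θ _ => energyDensity_le hf hM hc hy k θ
    refine this.trans (le_of_eq ?_)
    rw [intervalIntegral.integral_const, smul_eq_mul]
    ring
  have h₁ := hInt c (abs_of_pos hc₀).le
  have h₂ := hInt (-c) (by rw [abs_neg, abs_of_pos hc₀])
  rw [stripNormSq]
  linarith

theorem stripNormSq_nonneg (k : ℕ) (c : ℝ) (f : ℂ → ℂ) : 0 ≤ stripNormSq k c f := by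
  have h (y : ℝ) : 0 ≤ ∫ θ in (-Real.pi)..Real.pi, energyDensity k f y θ :=
    intervalIntegral.integral_nonneg (by linarith [Real.pi_pos]) fun θ _ => by
      unfold energyDensity
      positivity
  exact add_nonneg (h c) (h (-c))

theorem tendsto_stripNormSq_cosSeries {a : ℝ → L1 ℕ} {x : ℝ} (ha : ContinuousAt a x) (k : ℕ)
    {c : ℝ} (hc₀ : 0 < c) (hc : c < Real.log 2 / 4) :
    Tendsto (fun y => stripNormSq k c (cosSeries (a y) - cosSeries (a x))) (𝓝 x) (𝓝 0) := by
  have h (y : ℝ) : stripNormSq k c (cosSeries (a y) - cosSeries (a x)) ≤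
      4 * Real.pi * ((1 + (k.factorial / (Real.log 2 / 4) ^ k) ^ 2) * (2 * ‖a y - a x‖) ^ 2) := by
    refine stripNormSq_le
      ((differentiableOn_cosSeries _).sub (differentiableOn_cosSeries _)) (fun z hz => ?_) hc₀ hc k
    rw [Pi.sub_apply, ← cosSeries_sub _ _ hz]
    exact norm_cosSeries_le _ hz
  refine squeeze_zero (fun y => stripNormSq_nonneg k c _) h ?_
  have hn : Tendsto (fun y => ‖a y - a x‖) (𝓝 x) (𝓝 0) := by
    simpa using (ha.sub (continuousAt_const (y := a x))).norm.tendsto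
  have hbound := (((hn.const_mul 2).pow 2).const_mul
    (1 + (k.factorial / (Real.log 2 / 4) ^ k) ^ 2)).const_mul (4 * Real.pi)
  simpa using hbound

/-! ### Evaluation of series on the circle -/

theorem Wiener.hasSum_apply {G F : Type*} [AddCommGroup G] [DecidableEq G] {w : Weight G}
    [NormedAddCommGroup F] [NormedSpace ℝ F] (T : Wiener w →L[ℝ] F) (a : Wiener w) :
    HasSum (fun k => coeff k a • T (Wiener.mono w k)) (T a) := by
  have h := L1.hasSum_apply (T ∘L ((Wiener.toL1 w).symm : L1 G →L[ℝ] Wiener w)) (Wiener.toL1 w a)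
  simp only [ContinuousLinearMap.comp_apply, ContinuousLinearEquiv.coe_coe,
    Wiener.toL1_symm_unit, map_smul, ContinuousLinearEquiv.symm_apply_apply, smul_smul] at h
  convert h using 3 with k
  rw [coeff, smul_apply, smul_eq_mul, mul_comm]
  rfl

theorem Wiener.summable_coeff {G : Type*} [AddCommGroup G] [DecidableEq G] {w : Weight G}
    (hw : ∀ k, 1 ≤ w k) (a : Wiener w) : Summable fun k => |coeff k a| := by
  refine Summable.of_nonneg_of_le (fun _ => abs_nonneg _) (fun k => ?_)
    (L1.hasSum_norm_coord (Wiener.toL1 w a)).summable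
  have h : coeff k a = (w k)⁻¹ * Wiener.toL1 w a k := rfl
  rw [h, abs_mul, abs_of_pos (inv_pos.2 (w.pos k))]
  exact mul_le_of_le_one_left (abs_nonneg _) (inv_le_one_of_one_le₀ (hw k))

/-! ### Evaluation on the circle -/

/-- Evaluation of a Laurent series in `ξ = ζ²` at a point of the unit circle. -/
def eval (ζ : Circle) : Alg →L[ℝ] ℂ :=
  Wiener.lift (fun k => (ζ : ℂ) ^ (2 * k)) 1 fun k => by
    rw [norm_zpow, Circle.norm_coe, one_zpow, one_mul, expWeight_apply]
    exact one_le_pow₀ (by norm_num)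

/-- Evaluation of a Laurent series in `ξ = ζ²` and `t` at points of the unit circle. -/
def eval₂ (ζ t : Circle) : Alg₂ →L[ℝ] ℂ :=
  Wiener.lift (fun k => (ζ : ℂ) ^ (2 * k.1) * (t : ℂ) ^ k.2) 1 fun k => by
    rw [norm_mul, norm_zpow, norm_zpow, Circle.norm_coe, Circle.norm_coe, one_zpow,
      one_zpow, one_mul, one_mul, expWeight₂_apply]
    exact one_le_pow₀ (by norm_num)

theorem eval_ξpow (ζ : Circle) (k : ℤ) : eval ζ (ξpow k) = (ζ : ℂ) ^ (2 * k) := Wiener.lift_mono _ _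

theorem eval₂_mono (ζ t : Circle) (k : ℤ × ℤ) :
    eval₂ ζ t (Wiener.mono expWeight₂ k) = (ζ : ℂ) ^ (2 * k.1) * (t : ℂ) ^ k.2 :=
  Wiener.lift_mono _ _

theorem eval₂_ξtpow (ζ t : Circle) (k j : ℤ) :
    eval₂ ζ t (ξtpow k j) = (ζ : ℂ) ^ (2 * k) * (t : ℂ) ^ j := eval₂_mono ζ t (k, j)

theorem eval_mul (ζ : Circle) (a b : Alg) : eval ζ (a * b) = eval ζ a * eval ζ b := by
  refine Wiener.map_mul_of_mono _ (fun k l => ?_) a b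
  rw [eval_ξpow, eval_ξpow, eval_ξpow, mul_add, zpow_add₀ (Circle.coe_ne_zero ζ)]

theorem eval_one (ζ : Circle) : eval ζ 1 = 1 := by
  rw [Wiener.one_def, eval_ξpow, mul_zero, zpow_zero]

theorem eval₂_mul (ζ t : Circle) (a b : Alg₂) : eval₂ ζ t (a * b) = eval₂ ζ t a * eval₂ ζ t b := by
  refine Wiener.map_mul_of_mono _ (fun k l => ?_) a b
  rw [eval₂_mono, eval₂_mono, eval₂_mono, Prod.fst_add, Prod.snd_add, mul_add,
    zpow_add₀ (Circle.coe_ne_zero ζ), zpow_add₀ (Circle.coe_ne_zero t)]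
  ring

theorem eval₂_one (ζ t : Circle) : eval₂ ζ t 1 = 1 := by
  have := eval₂_ξtpow ζ t 0 0
  rw [mul_zero, zpow_zero, zpow_zero, one_mul] at this
  exact this

theorem norm_eval₂_le (ζ t : Circle) (a : Alg₂) : ‖eval₂ ζ t a‖ ≤ ‖a‖ := by
  have := Wiener.norm_apply_le (eval₂ ζ t) (C := 1) (fun k => by
    rw [eval₂_mono, norm_mul, norm_zpow, norm_zpow, Circle.norm_coe, Circle.norm_coe, one_zpow,
      one_zpow, one_mul, one_mul, expWeight₂_apply]
    exact one_le_pow₀ (by norm_num)) a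
  simpa using this

theorem eval₂_subst (ζ t : Circle) (a : Alg) : eval₂ ζ t (subst a) = eval (ζ * t) a := by
  have h : eval₂ ζ t ∘L subst = eval (ζ * t) := by
    refine Wiener.clm_ext fun k => ?_
    rw [ContinuousLinearMap.comp_apply, subst_ξpow, eval₂_ξtpow, eval_ξpow, Circle.coe_mul,
      mul_zpow]
  exact congrArg (fun T => T a) h

theorem eval_evenMode (ζ : Circle) (n : ℕ) :
    eval ζ (evenMode n) = (ζ : ℂ) ^ (2 * n) + ((ζ : ℂ) ^ (2 * n))⁻¹ := by
  rw [evenMode, map_add, eval_ξpow, eval_ξpow, mul_neg, zpow_neg]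
  norm_cast

theorem eval_oddMode (ζ : Circle) (n : ℕ) :
    eval ζ (oddMode n) = (ζ : ℂ) ^ (2 * n) - ((ζ : ℂ) ^ (2 * n))⁻¹ := by
  rw [oddMode, map_sub, eval_ξpow, eval_ξpow, mul_neg, zpow_neg]
  norm_cast

theorem eval₂_quotMode (ζ t : Circle) (n : ℕ) : eval₂ ζ t (quotMode n) =
    (ζ : ℂ) ^ (2 * (n + 1)) * ∑ j ∈ Finset.range (2 * n + 3), (t : ℂ) ^ j -
      ((ζ : ℂ) ^ (2 * (n + 1)))⁻¹ * ∑ j ∈ Finset.range (2 * n + 1), ((t : ℂ)⁻¹) ^ (j + 1) := by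
  rw [quotMode, map_sub, map_sum, map_sum, Finset.mul_sum, Finset.mul_sum]
  congr 1
  · refine Finset.sum_congr rfl fun j _ => ?_
    rw [eval₂_ξtpow]
    norm_cast
  · refine Finset.sum_congr rfl fun j _ => ?_
    rw [eval₂_ξtpow, mul_neg, zpow_neg, zpow_neg, inv_pow]
    norm_cast

theorem one_sub_mul_sum_inv (t : Circle) (N : ℕ) :
    (1 - t : ℂ) * ∑ j ∈ Finset.range N, ((t : ℂ)⁻¹) ^ (j + 1) = ((t : ℂ)⁻¹) ^ N - 1 := by
  have ht := Circle.coe_ne_zero t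
  have := mul_neg_geom_sum ((t : ℂ)⁻¹) N
  simp only [pow_succ, ← Finset.sum_mul]
  rw [mul_comm _ ((t : ℂ)⁻¹), ← mul_assoc, show (1 - t : ℂ) * (t : ℂ)⁻¹ = -(1 - (t : ℂ)⁻¹) by
    field_simp; ring, neg_mul, this]
  ring

/-- Two geometric sums: the factor 1 - t turns the first into 1 - t^(2n+3) and the second into
t^(-(2n+1)) - 1. This identifies the formal `quotMode` with a genuine divided difference. -/
theorem one_sub_mul_eval₂_quotMode (ζ t : Circle) (n : ℕ) :
    (1 - t : ℂ) * eval₂ ζ t (quotMode n) =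
      eval ζ (evenMode (n + 1)) - t * eval (ζ * t) (evenMode (n + 1)) := by
  have ht := Circle.coe_ne_zero t
  have hz := Circle.coe_ne_zero ζ
  have h₁ : (1 - t : ℂ) * ∑ j ∈ Finset.range (2 * n + 3), (t : ℂ) ^ j = 1 - (t : ℂ) ^ (2 * n + 3) :=
    mul_neg_geom_sum _ _
  rw [eval₂_quotMode, mul_sub, mul_left_comm, h₁, mul_left_comm, one_sub_mul_sum_inv, eval_evenMode,
    eval_evenMode, Circle.coe_mul, inv_pow]
  field_simp
  ring

/-- On the diagonal the divided difference of ζr(ζ) is its derivative r + ζ∂_ζ r. -/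
theorem eval₂_one_quotMode (ζ : Circle) (n : ℕ) : eval₂ ζ 1 (quotMode n) =
    eval ζ (evenMode (n + 1)) + (2 * (n + 1) : ℝ) • eval ζ (oddMode (n + 1)) := by
  rw [eval₂_quotMode, eval_evenMode, eval_oddMode]
  simp
  ring

/-! ### Lipschitz estimates at t = 1 -/

theorem norm_pow_sub_one_le (t : Circle) (n : ℕ) : ‖(t : ℂ) ^ n - 1‖ ≤ n * ‖(t : ℂ) - 1‖ := by
  rw [← mul_geom_sum, norm_mul, mul_comm]
  gcongr
  refine (norm_sum_le_of_le _ (f := fun i => (t : ℂ) ^ i) (n := fun _ => (1 : ℝ))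
    fun i _ => ?_).trans (by simp)
  rw [norm_pow, Circle.norm_coe, one_pow]

theorem norm_inv_sub_one (t : Circle) : ‖(t : ℂ)⁻¹ - 1‖ = ‖(t : ℂ) - 1‖ := by
  have ht := Circle.coe_ne_zero t
  rw [show (t : ℂ)⁻¹ - 1 = -((t : ℂ)⁻¹ * (t - 1)) by field_simp; ring, norm_neg, norm_mul, norm_inv,
    Circle.norm_coe, inv_one, one_mul]

theorem norm_eval_mul_sub_le (ζ t : Circle) (a : L1 ℕ) :
    ‖eval (ζ * t) (evenSeries a) - eval ζ (evenSeries a)‖ ≤ 4 * ‖(t : ℂ) - 1‖ * ‖a‖ := by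
  have h := L1.norm_apply_le ((eval (ζ * t) - eval ζ) ∘L evenSeries)
    (C := 4 * ‖(t : ℂ) - 1‖) (fun k => ?_) a
  · exact h
  have hpow (z s : Circle) : ‖(z * s : ℂ) ^ (2 * (k + 1)) - (z : ℂ) ^ (2 * (k + 1))‖ ≤
      2 * (k + 1) * ‖(s : ℂ) - 1‖ := by
    rw [mul_pow, show ∀ x y : ℂ, x * y - x = x * (y - 1) by intros; ring, norm_mul, norm_pow,
      Circle.norm_coe, one_pow, one_mul]
    exact_mod_cast norm_pow_sub_one_le s (2 * (k + 1))
  rw [ContinuousLinearMap.comp_apply, evenSeries_unit, map_smul]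
  refine norm_inv_two_pow_smul_le ?_
  rw [sub_apply, eval_evenMode, eval_evenMode, Circle.coe_mul]
  have h₁ := hpow ζ t
  have h₂ := hpow ζ⁻¹ t⁻¹
  rw [Circle.coe_inv, Circle.coe_inv, norm_inv_sub_one, ← mul_inv, inv_pow, inv_pow] at h₂
  have hk : (k + 1 : ℝ) ≤ 2 ^ (k + 1) := by exact_mod_cast (Nat.lt_two_pow_self (n := k + 1)).le
  calc _ = ‖((ζ * t : ℂ) ^ (2 * (k + 1)) - (ζ : ℂ) ^ (2 * (k + 1))) +
        (((ζ * t : ℂ) ^ (2 * (k + 1)))⁻¹ - ((ζ : ℂ) ^ (2 * (k + 1)))⁻¹)‖ := by congr 1; ring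
    _ ≤ 2 * (k + 1) * ‖(t : ℂ) - 1‖ + 2 * (k + 1) * ‖(t : ℂ) - 1‖ :=
        (norm_add_le _ _).trans (add_le_add h₁ h₂)
    _ = 4 * ‖(t : ℂ) - 1‖ * (k + 1) := by ring
    _ ≤ _ := by gcongr

theorem norm_eval₂_quotMode_sub_le (ζ t : Circle) (n : ℕ) :
    ‖eval₂ ζ t (quotMode n) - eval₂ ζ 1 (quotMode n)‖ ≤ 2 * (2 * n + 3) ^ 2 * ‖(t : ℂ) - 1‖ := by
  have hsum (s : Circle) (N m : ℕ) (hN : N ≤ 2 * n + 3) (hNm : N + m ≤ 2 * n + 3) :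
      ‖∑ j ∈ Finset.range N, ((s : ℂ) ^ (j + m) - 1)‖ ≤ (2 * n + 3) ^ 2 * ‖(s : ℂ) - 1‖ := by
    refine (norm_sum_le_of_le _ (n := fun _ => (2 * n + 3) * ‖(s : ℂ) - 1‖) fun j hj => ?_).trans ?_
    · refine (norm_pow_sub_one_le s _).trans ?_
      gcongr
      have := Finset.mem_range.1 hj
      exact_mod_cast (show j + m ≤ 2 * n + 3 by omega)
    · rw [Finset.sum_const, Finset.card_range, nsmul_eq_mul, pow_two, mul_assoc]
      gcongr
      exact_mod_cast hN
  have h₁ := hsum t (2 * n + 3) 0 le_rfl le_rfl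
  have h₂ := hsum t⁻¹ (2 * n + 1) 1 (by omega) (by omega)
  rw [Circle.coe_inv, norm_inv_sub_one] at h₂
  simp only [add_zero] at h₁
  rw [eval₂_quotMode, eval₂_quotMode]
  have e : (ζ : ℂ) ^ (2 * (n + 1)) * ∑ j ∈ Finset.range (2 * n + 3), (t : ℂ) ^ j -
      ((ζ : ℂ) ^ (2 * (n + 1)))⁻¹ * ∑ j ∈ Finset.range (2 * n + 1), ((t : ℂ)⁻¹) ^ (j + 1) -
      ((ζ : ℂ) ^ (2 * (n + 1)) * ∑ j ∈ Finset.range (2 * n + 3), ((1 : Circle) : ℂ) ^ j -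
      ((ζ : ℂ) ^ (2 * (n + 1)))⁻¹ *
        ∑ j ∈ Finset.range (2 * n + 1), (((1 : Circle) : ℂ)⁻¹) ^ (j + 1)) =
      (ζ : ℂ) ^ (2 * (n + 1)) * ∑ j ∈ Finset.range (2 * n + 3), ((t : ℂ) ^ j - 1) -
      ((ζ : ℂ) ^ (2 * (n + 1)))⁻¹ *
        ∑ j ∈ Finset.range (2 * n + 1), (((t : ℂ)⁻¹) ^ (j + 1) - 1) := by
    simp only [Finset.sum_sub_distrib, Circle.coe_one, one_pow, inv_one]
    ring
  rw [e]
  refine (norm_sub_le _ _).trans ?_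
  rw [norm_mul, norm_mul, norm_inv, norm_pow, Circle.norm_coe, one_pow, inv_one, one_mul, one_mul]
  linarith

/-- The bound for one mode grows like (k+1)². One factor is removed by the division by k + 1, the
other by 2^(-k-2); 50 comes from 2k + 5 ≤ 5(k + 1). -/
theorem norm_eval₂_quotTail_sub_le (ζ t : Circle) (u : L1 ℕ) :
    ‖eval₂ ζ t (quotTail u) - eval₂ ζ 1 (quotTail u)‖ ≤ 50 * ‖(t : ℂ) - 1‖ * ‖u‖ := by
  have h := L1.norm_apply_le ((eval₂ ζ t - eval₂ ζ 1) ∘L quotTail)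
    (C := 50 * ‖(t : ℂ) - 1‖) (fun k => ?_) u
  · exact h
  rw [ContinuousLinearMap.comp_apply, quotTail_unit, map_smul]
  refine norm_inv_two_pow_smul_le ?_
  rw [map_smul, norm_smul, norm_inv, Real.norm_of_nonneg (by positivity),
    inv_mul_le_iff₀ (by positivity), sub_apply]
  refine (norm_eval₂_quotMode_sub_le ζ t (k + 1)).trans ?_
  have hk : (k + 1 : ℝ) ≤ 2 ^ (k + 2) := by
    exact_mod_cast ((Nat.lt_two_pow_self (n := k + 1)).le.trans
      (Nat.pow_le_pow_right (by norm_num) (by omega)))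
  push_cast
  calc 2 * (2 * (k + 1 : ℝ) + 3) ^ 2 * ‖(t : ℂ) - 1‖
      ≤ 2 * (5 * (k + 1 : ℝ)) ^ 2 * ‖(t : ℂ) - 1‖ := by
        gcongr
        linarith [(Nat.cast_nonneg k : (0 : ℝ) ≤ k)]
    _ = (k + 1) * (50 * ‖(t : ℂ) - 1‖ * (k + 1)) := by ring
    _ ≤ _ := by gcongr

open MeasureTheory

/-! ### The principal value of a series divided by `1 - t` -/

theorem hasSum_of_forall_eq {ι : Type*} {f g : ι → ℂ} {a : ℂ} (h : HasSum f a)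
    (e : ∀ k, f k = g k) : HasSum g a := by
  rwa [← funext e]

theorem integral_circleExp_zpow (j : ℤ) :
    ∫ τ in (-Real.pi)..Real.pi, (Circle.exp τ : ℂ) ^ j =
      if j = 0 then 2 * (Real.pi : ℂ) else 0 := by
  have h (τ : ℝ) : (Circle.exp τ : ℂ) ^ j = Complex.exp ((j * Complex.I) * τ) := by
    rw [Circle.coe_exp, ← Complex.exp_int_mul]
    ring_nf
  simp only [h]
  split_ifs with hj
  · subst hj
    simp
    ring
  · have hc : (j * Complex.I : ℂ) ≠ 0 := mul_ne_zero (by exact_mod_cast hj) Complex.I_ne_zero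
    rw [integral_exp_mul_complex hc, div_eq_zero_iff, sub_eq_zero]
    left
    rw [Complex.exp_eq_exp_iff_exists_int]
    exact ⟨j, by push_cast; ring⟩

theorem continuous_circleExp_coe : Continuous fun τ : ℝ => (Circle.exp τ : ℂ) :=
  continuous_subtype_val.comp Circle.exp.continuous

theorem continuous_sum_inv (N : ℕ) :
    Continuous fun τ : ℝ => ∑ j ∈ Finset.range N, ((Circle.exp τ : ℂ)⁻¹) ^ (j + 1) :=
  continuous_finsetSum _ fun _ _ => (continuous_circleExp_coe.inv₀ fun _ =>
    Circle.coe_ne_zero _).pow _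

theorem norm_sum_inv_le (t : Circle) (N : ℕ) :
    ‖∑ j ∈ Finset.range N, ((t : ℂ)⁻¹) ^ (j + 1)‖ ≤ N := by
  refine (norm_sum_le_of_le _ (n := fun _ => (1 : ℝ)) fun i _ => ?_).trans (by simp)
  rw [norm_pow, norm_inv, Circle.norm_coe, inv_one, one_pow]

theorem integral_zpow_mul_sum_inv (j : ℤ) (N : ℕ) :
    ∫ τ in (-Real.pi)..Real.pi, (Circle.exp τ : ℂ) ^ j *
        ∑ n ∈ Finset.range N, ((Circle.exp τ : ℂ)⁻¹) ^ (n + 1) =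
      if 1 ≤ j ∧ j ≤ N then 2 * (Real.pi : ℂ) else 0 := by
  have h (τ : ℝ) : (Circle.exp τ : ℂ) ^ j *
      ∑ n ∈ Finset.range N, ((Circle.exp τ : ℂ)⁻¹) ^ (n + 1) =
      ∑ n ∈ Finset.range N, (Circle.exp τ : ℂ) ^ (j - (n + 1)) := by
    rw [Finset.mul_sum]
    refine Finset.sum_congr rfl fun n _ => ?_
    rw [zpow_sub₀ (Circle.coe_ne_zero _), inv_pow, div_eq_mul_inv]
    norm_cast
  simp only [h]
  rw [intervalIntegral.integral_finsetSum fun n _ => ?_]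
  · simp only [integral_circleExp_zpow]
    split_ifs with hj
    · rw [Finset.sum_eq_single (j - 1).toNat]
      · rw [if_pos (by omega)]
      · intro n _ hn
        rw [if_neg (by omega)]
      · intro hn
        rw [Finset.mem_range] at hn
        omega
    · refine Finset.sum_eq_zero fun n hn => if_neg ?_
      rw [Finset.mem_range] at hn
      omega
  · exact (continuous_circleExp_coe.zpow₀ _ fun τ =>
      Or.inl (Circle.coe_ne_zero _)).intervalIntegrable _ _

theorem summable_coeff₂ (h : Alg₂) : Summable fun k => |coeff k h| :=
  Wiener.summable_coeff (fun k => by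
    rw [expWeight₂_apply]
    exact one_le_pow₀ (by norm_num)) h

theorem hasSum_eval₂ (ζ t : Circle) (h : Alg₂) :
    HasSum (fun k : ℤ × ℤ => coeff k h * (ζ : ℂ) ^ (2 * k.1) * (t : ℂ) ^ k.2) (eval₂ ζ t h) := by
  have := Wiener.hasSum_apply (eval₂ ζ t) h
  simpa only [eval₂_mono, Complex.real_smul, mul_assoc] using this

theorem norm_coeff_mul_zpow (ζ : Circle) (h : Alg₂) (k : ℤ × ℤ) :
    ‖(coeff k h : ℂ) * (ζ : ℂ) ^ (2 * k.1)‖ = |coeff k h| := by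
  rw [norm_mul, norm_zpow, Circle.norm_coe, one_zpow, mul_one, Complex.norm_real, Real.norm_eq_abs]

theorem continuous_eval₂_circleExp (ζ : Circle) (h : Alg₂) :
    Continuous fun τ : ℝ => eval₂ ζ (Circle.exp τ) h := by
  have e : (fun τ : ℝ => eval₂ ζ (Circle.exp τ) h) = fun τ : ℝ =>
      ∑' k : ℤ × ℤ, coeff k h * (ζ : ℂ) ^ (2 * k.1) * (Circle.exp τ : ℂ) ^ k.2 :=
    funext fun τ => (hasSum_eval₂ ζ _ h).tsum_eq.symm
  rw [e]
  refine continuous_tsum (fun k => ?_) (summable_coeff₂ h) fun k τ => ?_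
  · exact continuous_const.mul (continuous_circleExp_coe.zpow₀ _ fun τ =>
      Or.inl (Circle.coe_ne_zero _))
  · rw [norm_mul, norm_coeff_mul_zpow, norm_zpow, Circle.norm_coe, one_zpow, mul_one]

theorem hasSum_integral_eval₂_mul_sum_inv (ζ : Circle) (h : Alg₂) (N : ℕ) :
    HasSum (fun k : ℤ × ℤ => coeff k h * (ζ : ℂ) ^ (2 * k.1) *
        if 1 ≤ k.2 ∧ k.2 ≤ N then 2 * (Real.pi : ℂ) else 0)
      (∫ τ in (-Real.pi)..Real.pi, eval₂ ζ (Circle.exp τ) h *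
        ∑ n ∈ Finset.range N, ((Circle.exp τ : ℂ)⁻¹) ^ (n + 1)) := by
  have H := hasSum_intervalIntegral_of_norm_le (a := -Real.pi) (b := Real.pi)
    (F := fun (k : ℤ × ℤ) τ => (coeff k h * (ζ : ℂ) ^ (2 * k.1)) * ((Circle.exp τ : ℂ) ^ k.2 *
      ∑ n ∈ Finset.range N, ((Circle.exp τ : ℂ)⁻¹) ^ (n + 1)))
    (f := fun τ => eval₂ ζ (Circle.exp τ) h *
        ∑ n ∈ Finset.range N, ((Circle.exp τ : ℂ)⁻¹) ^ (n + 1))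
    (fun k => continuous_const.mul ((continuous_circleExp_coe.zpow₀ _ fun τ =>
      Or.inl (Circle.coe_ne_zero _)).mul (continuous_sum_inv N)))
    ((summable_coeff₂ h).mul_right (N : ℝ)) (fun k τ => ?_) (fun τ => ?_)
  · simpa only [intervalIntegral.integral_const_mul, integral_zpow_mul_sum_inv] using H
  · rw [norm_mul, norm_coeff_mul_zpow, norm_mul, norm_zpow, Circle.norm_coe, one_zpow, one_mul]
    gcongr
    exact norm_sum_inv_le _ N
  · simpa only [mul_assoc] using (hasSum_eval₂ ζ (Circle.exp τ) h).mul_right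
      (∑ n ∈ Finset.range N, ((Circle.exp τ : ℂ)⁻¹) ^ (n + 1))

theorem hasSum_eval_pvOp (ζ : Circle) (h : Alg₂) :
    HasSum (fun k : ℤ × ℤ => coeff k h * (ζ : ℂ) ^ (2 * k.1) *
      (if 1 ≤ k.2 then -1 / 2 else 1 / 2)) (eval ζ (pvOp h)) := by
  have := Wiener.hasSum_apply (eval ζ ∘L pvOp) h
  refine hasSum_of_forall_eq this fun k => ?_
  have hk : pvOp (Wiener.mono expWeight₂ k) = (if 1 ≤ k.2 then -1 / 2 else 1 / 2 : ℝ) • ξpow k.1 :=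
    pvOp_ξtpow k.1 k.2
  rw [ContinuousLinearMap.comp_apply, hk, map_smul, eval_ξpow, Complex.real_smul, Complex.real_smul]
  split_ifs <;> · push_cast; ring

/-- Riemann–Lebesgue lemma on a period. -/
theorem tendsto_integral_mul_circleExp_inv_pow (φ : ℝ → ℂ) :
    Tendsto (fun N : ℕ => ∫ τ in (-Real.pi)..Real.pi, φ τ * ((Circle.exp τ : ℂ)⁻¹) ^ N)
      atTop (𝓝 0) := by
  have h := Real.tendsto_integral_exp_smul_cocompact ((Ioc (-Real.pi) Real.pi).indicator φ)
  have hN : Tendsto (fun N : ℕ => (N : ℝ) / (2 * Real.pi)) atTop (cocompact ℝ) :=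
    (tendsto_natCast_atTop_atTop.atTop_div_const (by positivity)).mono_right atTop_le_cocompact
  refine (h.comp hN).congr fun N => ?_
  rw [Function.comp_apply, intervalIntegral.integral_of_le (by linarith [Real.pi_pos]),
    ← integral_indicator measurableSet_Ioc]
  refine integral_congr_ae (.of_forall fun τ => ?_)
  by_cases hτ : τ ∈ Ioc (-Real.pi) Real.pi
  · simp only [indicator_of_mem hτ]
    rw [Circle.smul_def, smul_eq_mul, mul_comm, Real.fourierChar_apply, Circle.coe_exp,
      ← Complex.exp_neg, ← Complex.exp_nat_mul]
    congr 2
    have := Complex.ofReal_ne_zero.2 Real.pi_ne_zero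
    push_cast
    field_simp
  · simp [indicator_of_notMem hτ]

/-- The weight gives no decay in the t-exponent j, while (t^j - 1)/(1 - t) may be as large as |j|,
so termwise integration is not available. Multiplying by 1 - t⁻ᴺ replaces the quotient by a finite
sum of inverse powers, whose integral picks out the exponents 1 ≤ j ≤ N. As N → ∞ the t⁻ᴺ term
disappears by Riemann–Lebesgue, and the integral is -2π times the sum over j ≥ 1. Adding half the
value at t = 1 produces the factors ∓1/2 of `pvOp`. -/
theorem integral_divided_eval₂ (ζ : Circle) (h : Alg₂)
    (hInt : IntervalIntegrable (fun τ : ℝ => (eval₂ ζ (Circle.exp τ) h - eval₂ ζ 1 h) /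
      (1 - Circle.exp τ)) volume (-Real.pi) Real.pi) :
    (2 * Real.pi : ℂ)⁻¹ * (∫ τ in (-Real.pi)..Real.pi,
      (eval₂ ζ (Circle.exp τ) h - eval₂ ζ 1 h) / (1 - Circle.exp τ)) + eval₂ ζ 1 h / 2 =
    eval ζ (pvOp h) := by
  set φ : ℝ → ℂ := fun τ => (eval₂ ζ (Circle.exp τ) h - eval₂ ζ 1 h) / (1 - Circle.exp τ) with hφ
  set D : ℕ → ℝ → ℂ := fun N τ => ∑ n ∈ Finset.range N, ((Circle.exp τ : ℂ)⁻¹) ^ (n + 1) with hD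
  set c : ℤ × ℤ → ℂ := fun k => coeff k h * (ζ : ℂ) ^ (2 * k.1) with hc
  have hcs : Summable fun k => ‖c k‖ := by
    simpa only [hc, norm_coeff_mul_zpow] using summable_coeff₂ h
  have hid (N : ℕ) (τ : ℝ) : φ τ - φ τ * ((Circle.exp τ : ℂ)⁻¹) ^ N =
      eval₂ ζ 1 h * D N τ - eval₂ ζ (Circle.exp τ) h * D N τ := by
    have h₁ : (1 - Circle.exp τ : ℂ) * D N τ = ((Circle.exp τ : ℂ)⁻¹) ^ N - 1 :=
      one_sub_mul_sum_inv (Circle.exp τ) N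
    -- At t = 1 the quotient is 0 by the convention for division by zero, and the right side
    -- vanishes as well.
    by_cases ht : (Circle.exp τ : ℂ) = 1
    · have ht' : Circle.exp τ = 1 := Circle.ext ht
      simp [hφ, ht']
    · have h₂ : φ τ * (1 - Circle.exp τ) = eval₂ ζ (Circle.exp τ) h - eval₂ ζ 1 h :=
        div_mul_cancel₀ _ (sub_ne_zero.2 (Ne.symm ht))
      linear_combination φ τ * h₁ - D N τ * h₂
  have hDc (N : ℕ) : Continuous (D N) := continuous_sum_inv N
  have hHD (N : ℕ) : Continuous fun τ => eval₂ ζ (Circle.exp τ) h * D N τ :=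
    (continuous_eval₂_circleExp ζ h).mul (hDc N)
  have hinv (N : ℕ) : Continuous fun τ : ℝ => ((Circle.exp τ : ℂ)⁻¹) ^ N :=
    (continuous_circleExp_coe.inv₀ fun τ => Circle.coe_ne_zero _).pow _
  have hD0 (N : ℕ) : ∫ τ in (-Real.pi)..Real.pi, D N τ = 0 := by
    simpa only [zpow_zero, one_mul, show ¬(1 ≤ (0 : ℤ)) by norm_num, false_and, if_false] using
      integral_zpow_mul_sum_inv 0 N
  have hdiff (N : ℕ) : (∫ τ in (-Real.pi)..Real.pi, φ τ) -
      (∫ τ in (-Real.pi)..Real.pi, φ τ * ((Circle.exp τ : ℂ)⁻¹) ^ N) =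
      -∑' k : ℤ × ℤ, c k * if 1 ≤ k.2 ∧ k.2 ≤ N then 2 * (Real.pi : ℂ) else 0 := by
    rw [(hasSum_integral_eval₂_mul_sum_inv ζ h N).tsum_eq, ← intervalIntegral.integral_sub hInt
      (hInt.mul_continuousOn (hinv N).continuousOn)]
    simp only [hid]
    have hc1 : Continuous fun τ => eval₂ ζ 1 h * D N τ := continuous_const.mul (hDc N)
    rw [intervalIntegral.integral_sub (hc1.intervalIntegrable _ _)
      ((hHD N).intervalIntegrable _ _), intervalIntegral.integral_const_mul, hD0, mul_zero,
      zero_sub]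
  have hlim : Tendsto (fun N : ℕ => ∑' k : ℤ × ℤ, c k *
      if 1 ≤ k.2 ∧ k.2 ≤ N then 2 * (Real.pi : ℂ) else 0) atTop
      (𝓝 (∑' k : ℤ × ℤ, c k * if 1 ≤ k.2 then 2 * (Real.pi : ℂ) else 0)) := by
    refine tendsto_tsum_of_dominated_convergence (bound := fun k => ‖c k‖ * (2 * Real.pi))
      (hcs.mul_right _) (fun k => ?_) (.of_forall fun N k => ?_)
    · refine tendsto_const_nhds.congr' ?_
      filter_upwards [eventually_ge_atTop k.2.toNat] with N hN
      congr 1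
      by_cases hk : 1 ≤ k.2
      · rw [if_pos hk, if_pos ⟨hk, by omega⟩]
      · rw [if_neg hk, if_neg (by tauto)]
    · rw [norm_mul]
      gcongr
      split_ifs
      · simp [abs_of_pos Real.pi_pos]
      · simp [Real.pi_pos.le]
  have hmain : ∫ τ in (-Real.pi)..Real.pi, φ τ =
      -∑' k : ℤ × ℤ, c k * if 1 ≤ k.2 then 2 * (Real.pi : ℂ) else 0 := by
    have h₁ := (tendsto_const_nhds (x := ∫ τ in (-Real.pi)..Real.pi, φ τ)).sub
      (tendsto_integral_mul_circleExp_inv_pow φ)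
    simp only [hdiff, sub_zero] at h₁
    exact tendsto_nhds_unique h₁ hlim.neg
  have hpi := Complex.ofReal_ne_zero.2 Real.pi_ne_zero
  have hs : Summable fun k : ℤ × ℤ => c k * if 1 ≤ k.2 then 2 * (Real.pi : ℂ) else 0 := by
    refine Summable.of_norm_bounded (hcs.mul_right (2 * Real.pi)) fun k => ?_
    rw [norm_mul]
    gcongr
    split_ifs
    · simp [abs_of_pos Real.pi_pos]
    · simp [Real.pi_pos.le]
  have h₁ := hasSum_eval₂ ζ 1 h
  simp only [Circle.coe_one, one_zpow, mul_one] at h₁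
  rw [hmain]
  refine ((hs.hasSum.neg.mul_left (2 * Real.pi : ℂ)⁻¹).add (h₁.div_const 2)).unique ?_
  refine hasSum_of_forall_eq (hasSum_eval_pvOp ζ h) fun k => ?_
  split_ifs <;> · simp only [hc]; field_simp; ring

/-! ### Principal values -/

theorem circleExp_ne_one {τ : ℝ} (h₀ : τ ≠ 0) (hτ : |τ| ≤ Real.pi) : (Circle.exp τ : ℂ) ≠ 1 := by
  intro h
  rw [Circle.coe_exp, Complex.exp_eq_one_iff] at h
  obtain ⟨n, hn⟩ := h
  have hn' : τ = n * (2 * Real.pi) := by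
    have : (τ : ℂ) = n * (2 * Real.pi) := by
      apply mul_right_cancel₀ Complex.I_ne_zero
      rw [hn]
      ring
    exact_mod_cast this
  have hn0 : n ≠ 0 := by
    rintro rfl
    simp at hn'
    exact h₀ hn'
  have h1 : (1 : ℝ) ≤ |(n : ℝ)| := by exact_mod_cast Int.one_le_abs hn0
  rw [hn', abs_mul, abs_of_pos (show 0 < 2 * Real.pi by positivity)] at hτ
  nlinarith [Real.pi_pos]

theorem inv_one_sub_re {t : Circle} (ht : (t : ℂ) ≠ 1) : ((1 - t : ℂ)⁻¹).re = 1 / 2 := by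
  have h := Circle.normSq_coe t
  rw [Complex.normSq_apply] at h
  have h0 : Complex.normSq (1 - t : ℂ) ≠ 0 := by
    rw [Ne, Complex.normSq_eq_zero, sub_eq_zero]
    exact Ne.symm ht
  have h1 : Complex.normSq (1 - t : ℂ) = 2 * (1 - (t : ℂ).re) := by
    rw [Complex.normSq_apply]
    simp
    linarith
  rw [Complex.inv_re, div_eq_iff h0, h1]
  simp

theorem inv_one_sub_im_neg (τ : ℝ) : ((1 - (Circle.exp (-τ) : ℂ))⁻¹).im =
    -((1 - (Circle.exp τ : ℂ))⁻¹).im := by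
  have : (1 - (Circle.exp (-τ) : ℂ)) = (starRingEnd ℂ) (1 - (Circle.exp τ : ℂ)) := by
    rw [map_sub, map_one, Circle.exp_neg, Circle.coe_inv_eq_conj]
  rw [this, ← map_inv₀, Complex.conj_im]

/-- The symmetric punctured period around `0`. -/
def punctured (ε : ℝ) : Set ℝ := {τ | ε < |τ| ∧ |τ| ≤ Real.pi}

theorem measurableSet_punctured (ε : ℝ) : MeasurableSet (punctured ε) :=
  (measurableSet_lt measurable_const measurable_norm).inter
    (measurableSet_le measurable_norm measurable_const)

theorem punctured_subset (ε : ℝ) : punctured ε ⊆ Icc (-Real.pi) Real.pi := fun _ hτ =>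
  abs_le.1 hτ.2

theorem setIntegral_punctured_inv_one_sub_im (ε : ℝ) :
    ∫ τ in punctured ε, ((1 - (Circle.exp τ : ℂ))⁻¹).im = 0 := by
  rw [← integral_indicator (measurableSet_punctured ε)]
  set f := (punctured ε).indicator fun τ => ((1 - (Circle.exp τ : ℂ))⁻¹).im with hf
  have hodd (τ : ℝ) : f (-τ) = -f τ := by
    have hmem : -τ ∈ punctured ε ↔ τ ∈ punctured ε := by simp [punctured]
    by_cases h : τ ∈ punctured ε
    · rw [hf, indicator_of_mem h, indicator_of_mem (hmem.2 h), inv_one_sub_im_neg]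
    · rw [hf, indicator_of_notMem h, indicator_of_notMem (fun h' => h (hmem.1 h')), neg_zero]
  have h := integral_neg_eq_self f volume
  simp only [hodd, integral_neg] at h
  linarith

theorem integrableOn_punctured_inv_one_sub_im {ε : ℝ} (hε : 0 < ε) :
    IntegrableOn (fun τ => ((1 - (Circle.exp τ : ℂ))⁻¹).im) (punctured ε) := by
  have hK : IsCompact (Icc (-Real.pi) Real.pi ∩ {τ : ℝ | ε ≤ |τ|}) :=
    isCompact_Icc.inter_right (isClosed_le continuous_const continuous_abs)
  refine IntegrableOn.mono_set (ContinuousOn.integrableOn_compact hK ?_) fun τ hτ =>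
    ⟨punctured_subset ε hτ, hτ.1.le⟩
  refine Complex.continuous_im.comp_continuousOn (ContinuousOn.inv₀
    (continuous_const.sub continuous_circleExp_coe).continuousOn fun τ hτ => ?_)
  have hτ0 : τ ≠ 0 := by
    rintro rfl
    have : ε ≤ |(0 : ℝ)| := hτ.2
    simp at this
    linarith
  exact sub_ne_zero.2 (Ne.symm (circleExp_ne_one hτ0 (abs_le.2 hτ.1)))

theorem tendsto_setIntegral_punctured {f : ℝ → ℝ}
    (hf : IntegrableOn f (Icc (-Real.pi) Real.pi)) :
    Tendsto (fun ε => ∫ τ in punctured ε, f τ) (𝓝[>] 0)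
      (𝓝 (∫ τ in (-Real.pi)..Real.pi, f τ)) := by
  rw [intervalIntegral.integral_of_le (by linarith [Real.pi_pos]), ← integral_Icc_eq_integral_Ioc,
    ← integral_indicator measurableSet_Icc]
  simp only [← integral_indicator (measurableSet_punctured _)]
  refine tendsto_integral_filter_of_dominated_convergence
    (fun τ => ‖(Icc (-Real.pi) Real.pi).indicator f τ‖) (.of_forall fun ε => ?_)
    (.of_forall fun ε => .of_forall fun τ => ?_) ((integrable_indicator_iff measurableSet_Icc).2
    hf).norm ?_
  · exact ((integrable_indicator_iff (measurableSet_punctured ε)).2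
      (hf.mono_set (punctured_subset ε))).aestronglyMeasurable
  · by_cases h : τ ∈ punctured ε
    · rw [indicator_of_mem h, indicator_of_mem (punctured_subset ε h)]
    · rw [indicator_of_notMem h]
      simp
  · have h0 : ∀ᵐ τ : ℝ, τ ≠ 0 := Measure.ae_ne volume 0
    filter_upwards [h0] with τ hτ
    refine tendsto_const_nhds.congr' ?_
    filter_upwards [Ioo_mem_nhdsGT (abs_pos.2 hτ)] with ε hε
    by_cases h : τ ∈ Icc (-Real.pi) Real.pi
    · rw [indicator_of_mem h, indicator_of_mem (show τ ∈ punctured ε from ⟨hε.2, abs_le.2 h⟩)]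
    · rw [indicator_of_notMem h, indicator_of_notMem fun h' => h (punctured_subset ε h')]

/-! ### Kernels with a simple pole at t = 1 -/

section

variable {ζ : Circle} {h : Alg₂} {κ : ℂ} {γ C : ℝ}

theorem integrableOn_divided_eval₂ (hC : 0 ≤ C)
    (hLip : ∀ t : Circle, ‖eval₂ ζ t h - eval₂ ζ 1 h‖ ≤ C * ‖(t : ℂ) - 1‖) :
    IntegrableOn (fun τ : ℝ => (eval₂ ζ (Circle.exp τ) h - eval₂ ζ 1 h) / (1 - Circle.exp τ))
      (Icc (-Real.pi) Real.pi) := by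
  refine Measure.integrableOn_of_bounded (M := C) (by simp) ?_ (.of_forall fun τ => ?_)
  · exact (((continuous_eval₂_circleExp ζ h).sub continuous_const).measurable.div
      (continuous_const.sub continuous_circleExp_coe).measurable).aestronglyMeasurable
  · rw [norm_div]
    refine div_le_of_le_mul₀ (norm_nonneg _) hC ?_
    rw [norm_sub_rev (1 : ℂ)]
    exact hLip _

theorem mul_eval_pvOp (hκ : κ * eval₂ ζ 1 h = Complex.I * γ)
    (hφ : IntervalIntegrable (fun τ : ℝ => (eval₂ ζ (Circle.exp τ) h - eval₂ ζ 1 h) /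
      (1 - Circle.exp τ)) volume (-Real.pi) Real.pi) :
    κ * eval ζ (pvOp h) = ((2 * Real.pi)⁻¹ : ℝ) * (κ * ∫ τ in (-Real.pi)..Real.pi,
      (eval₂ ζ (Circle.exp τ) h - eval₂ ζ 1 h) / (1 - Circle.exp τ)) +
        Complex.I * ((γ / 2 : ℝ) : ℂ) := by
  rw [← integral_divided_eval₂ ζ h hφ]
  push_cast
  linear_combination (1 / 2) * hκ

/-- The pole is split off with coefficient iγ. Since 1/(1 - t) has constant real part 1/2 and odd
imaginary part, the real part of the kernel needs a principal value and the imaginary part is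
bounded off t = 1. -/
theorem kernel_decomposition (hκ : κ * eval₂ ζ 1 h = Complex.I * γ) (τ : ℝ) :
    κ * eval₂ ζ (Circle.exp τ) h / (1 - Circle.exp τ) =
      κ * ((eval₂ ζ (Circle.exp τ) h - eval₂ ζ 1 h) / (1 - Circle.exp τ)) +
        Complex.I * γ * (1 - Circle.exp τ : ℂ)⁻¹ := by
  rw [← hκ]
  ring

theorem kernel_re (hκ : κ * eval₂ ζ 1 h = Complex.I * γ) (τ : ℝ) :
    (κ * eval₂ ζ (Circle.exp τ) h / (1 - Circle.exp τ)).re =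
      (κ * ((eval₂ ζ (Circle.exp τ) h - eval₂ ζ 1 h) / (1 - Circle.exp τ))).re -
        γ * ((1 - Circle.exp τ : ℂ)⁻¹).im := by
  rw [kernel_decomposition hκ, Complex.add_re]
  congr 1
  simp [Complex.mul_re]

theorem kernel_im (hκ : κ * eval₂ ζ 1 h = Complex.I * γ) {τ : ℝ}
    (hτ : (Circle.exp τ : ℂ) ≠ 1) :
    (κ * eval₂ ζ (Circle.exp τ) h / (1 - Circle.exp τ)).im =
      (κ * ((eval₂ ζ (Circle.exp τ) h - eval₂ ζ 1 h) / (1 - Circle.exp τ))).im + γ / 2 := by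
  rw [kernel_decomposition hκ, Complex.add_im]
  congr 1
  have := inv_one_sub_re hτ
  rw [mul_assoc, Complex.I_mul_im, Complex.re_ofReal_mul, this]
  ring

theorem integrableOn_kernel_re (hC : 0 ≤ C) (hκ : κ * eval₂ ζ 1 h = Complex.I * γ)
    (hLip : ∀ t : Circle, ‖eval₂ ζ t h - eval₂ ζ 1 h‖ ≤ C * ‖(t : ℂ) - 1‖) {ε : ℝ} (hε : 0 < ε) :
    IntegrableOn (fun τ : ℝ => (κ * eval₂ ζ (Circle.exp τ) h / (1 - Circle.exp τ)).re)
      (punctured ε) := by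
  simp only [kernel_re hκ]
  refine Integrable.sub ?_ ((integrableOn_punctured_inv_one_sub_im hε).const_mul γ)
  exact (((integrableOn_divided_eval₂ hC hLip).mono_set (punctured_subset ε)).const_mul κ).re

/-- The singular part is odd and integrates to zero over each symmetric punctured period; the rest
is integrable. The half-residue in `pvOp` is purely imaginary after multiplication by κ and does not
contribute. -/
theorem tendsto_kernel_re (hC : 0 ≤ C) (hκ : κ * eval₂ ζ 1 h = Complex.I * γ)
    (hLip : ∀ t : Circle, ‖eval₂ ζ t h - eval₂ ζ 1 h‖ ≤ C * ‖(t : ℂ) - 1‖) :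
    Tendsto (fun ε => (2 * Real.pi)⁻¹ * ∫ τ in punctured ε,
      (κ * eval₂ ζ (Circle.exp τ) h / (1 - Circle.exp τ)).re) (𝓝[>] 0)
      (𝓝 (κ * eval ζ (pvOp h)).re) := by
  have hφ := integrableOn_divided_eval₂ hC hLip
  have hφi : IntervalIntegrable (fun τ : ℝ => (eval₂ ζ (Circle.exp τ) h - eval₂ ζ 1 h) /
      (1 - Circle.exp τ)) volume (-Real.pi) Real.pi :=
    (intervalIntegrable_iff_integrableOn_Icc_of_le (by linarith [Real.pi_pos])).2 hφ
  have hval : (κ * eval ζ (pvOp h)).re = (2 * Real.pi)⁻¹ * ∫ τ in (-Real.pi)..Real.pi,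
      (κ * ((eval₂ ζ (Circle.exp τ) h - eval₂ ζ 1 h) / (1 - Circle.exp τ))).re := by
    have hre := Complex.reCLM.intervalIntegral_comp_comm (hφi.const_mul κ)
    simp only [Complex.reCLM_apply] at hre
    rw [hre, intervalIntegral.integral_const_mul, mul_eval_pvOp hκ hφi, Complex.add_re,
      Complex.re_ofReal_mul]
    simp
  rw [hval]
  have hre : IntegrableOn (fun τ : ℝ =>
      (κ * ((eval₂ ζ (Circle.exp τ) h - eval₂ ζ 1 h) / (1 - Circle.exp τ))).re)
      (Icc (-Real.pi) Real.pi) := (hφ.const_mul κ).re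
  refine ((tendsto_setIntegral_punctured hre).const_mul (2 * Real.pi)⁻¹).congr' ?_
  filter_upwards [self_mem_nhdsWithin] with ε hε
  simp only [kernel_re hκ]
  rw [integral_sub (hre.mono_set (punctured_subset ε))
    ((integrableOn_punctured_inv_one_sub_im hε).const_mul γ), integral_const_mul,
    setIntegral_punctured_inv_one_sub_im, mul_zero, sub_zero]

theorem ae_circleExp_ne_one :
    ∀ᵐ τ : ℝ, τ ∈ uIoc (-Real.pi) Real.pi → (Circle.exp τ : ℂ) ≠ 1 := by
  filter_upwards [Measure.ae_ne volume (0 : ℝ)] with τ hτ hmem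
  rw [uIoc_of_le (by linarith [Real.pi_pos])] at hmem
  exact circleExp_ne_one hτ (abs_le.2 ⟨hmem.1.le, hmem.2⟩)

theorem intervalIntegrable_kernel_im (hC : 0 ≤ C) (hκ : κ * eval₂ ζ 1 h = Complex.I * γ)
    (hLip : ∀ t : Circle, ‖eval₂ ζ t h - eval₂ ζ 1 h‖ ≤ C * ‖(t : ℂ) - 1‖) :
    IntervalIntegrable (fun τ : ℝ => (κ * eval₂ ζ (Circle.exp τ) h / (1 - Circle.exp τ)).im)
      volume (-Real.pi) Real.pi := by
  have hφ := (integrableOn_divided_eval₂ hC hLip).const_mul κ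
  have h₁ : IntervalIntegrable (fun τ : ℝ =>
      (κ * ((eval₂ ζ (Circle.exp τ) h - eval₂ ζ 1 h) / (1 - Circle.exp τ))).im + γ / 2)
      volume (-Real.pi) Real.pi :=
    ((intervalIntegrable_iff_integrableOn_Icc_of_le (by linarith [Real.pi_pos])).2 hφ.im).add
      intervalIntegrable_const
  refine h₁.congr_ae ?_
  rw [EventuallyEq, ae_restrict_iff' measurableSet_uIoc]
  filter_upwards [ae_circleExp_ne_one] with τ hτ hmem
  exact (kernel_im hκ (hτ hmem)).symm

/-- The constant γ/2 coming from Re 1/(1 - t) = 1/2 is precisely the half-residue in `pvOp`. -/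
theorem integral_kernel_im (hC : 0 ≤ C) (hκ : κ * eval₂ ζ 1 h = Complex.I * γ)
    (hLip : ∀ t : Circle, ‖eval₂ ζ t h - eval₂ ζ 1 h‖ ≤ C * ‖(t : ℂ) - 1‖) :
    (2 * Real.pi)⁻¹ * ∫ τ in (-Real.pi)..Real.pi,
      (κ * eval₂ ζ (Circle.exp τ) h / (1 - Circle.exp τ)).im = (κ * eval ζ (pvOp h)).im := by
  have hφ := integrableOn_divided_eval₂ hC hLip
  have hφi : IntervalIntegrable (fun τ : ℝ => (eval₂ ζ (Circle.exp τ) h - eval₂ ζ 1 h) /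
      (1 - Circle.exp τ)) volume (-Real.pi) Real.pi :=
    (intervalIntegrable_iff_integrableOn_Icc_of_le (by linarith [Real.pi_pos])).2 hφ
  have him := Complex.imCLM.intervalIntegral_comp_comm (hφi.const_mul κ)
  simp only [Complex.imCLM_apply] at him
  have hcongr : ∫ τ in (-Real.pi)..Real.pi,
      (κ * eval₂ ζ (Circle.exp τ) h / (1 - Circle.exp τ)).im = ∫ τ in (-Real.pi)..Real.pi,
      ((κ * ((eval₂ ζ (Circle.exp τ) h - eval₂ ζ 1 h) / (1 - Circle.exp τ))).im + γ / 2) := by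
    refine intervalIntegral.integral_congr_ae ?_
    filter_upwards [ae_circleExp_ne_one] with τ hτ hmem
    exact kernel_im hκ (hτ hmem)
  have hii : IntervalIntegrable (fun τ : ℝ =>
      (κ * ((eval₂ ζ (Circle.exp τ) h - eval₂ ζ 1 h) / (1 - Circle.exp τ))).im)
      volume (-Real.pi) Real.pi :=
    (intervalIntegrable_iff_integrableOn_Icc_of_le (by linarith [Real.pi_pos])).2
      (hφ.const_mul κ).im
  rw [hcongr, intervalIntegral.integral_add hii intervalIntegrable_const, him,
    intervalIntegral.integral_const_mul, mul_eval_pvOp hκ hφi, Complex.add_im,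
    Complex.im_ofReal_mul, Complex.I_mul_im, Complex.ofReal_re, intervalIntegral.integral_const]
  have := Real.pi_ne_zero
  simp only [smul_eq_mul]
  field_simp
  ring

end

/-! ### The functions defined by a solution of the rescaled equation -/

theorem circleExp_pow_add_inv (n : ℕ) (θ : ℝ) :
    (Circle.exp θ : ℂ) ^ (2 * n) + ((Circle.exp θ : ℂ) ^ (2 * n))⁻¹ =
      2 * Complex.cos (2 * n * θ) := by
  rw [Circle.coe_exp, ← Complex.exp_nat_mul, ← Complex.exp_neg, Complex.two_cos]
  push_cast
  congr 2 <;> ring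

theorem circleExp_pow_sub_inv (n : ℕ) (θ : ℝ) :
    (Circle.exp θ : ℂ) ^ (2 * n) - ((Circle.exp θ : ℂ) ^ (2 * n))⁻¹ =
      2 * Complex.I * Complex.sin (2 * n * θ) := by
  rw [Circle.coe_exp, ← Complex.exp_nat_mul, ← Complex.exp_neg, mul_right_comm, Complex.two_sin,
    mul_assoc, Complex.I_mul_I, show (((2 * n : ℕ) : ℂ) * (θ * Complex.I)) =
      2 * n * θ * Complex.I by push_cast; ring, neg_mul]
  ring

theorem eval_evenSeries (a : L1 ℕ) (θ : ℝ) :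
    eval (Circle.exp θ) (evenSeries a) = (onReal (cosSeries a) θ : ℂ) := by
  rw [← cosSeries_ofReal]
  have h := L1.hasSum_apply (eval (Circle.exp θ) ∘L evenSeries) a
  refine HasSum.unique (hasSum_of_forall_eq h fun k => ?_)
    (hasSum_cosSeries a (ofReal_mem_openStrip θ))
  rw [ContinuousLinearMap.comp_apply, evenSeries_unit, map_smul, eval_evenMode,
    circleExp_pow_add_inv, Complex.real_smul, Complex.real_smul, cosTerm]
  push_cast
  ring

/-- The derivative of a cosine series at a real point. -/
def derivAt (θ : ℝ) : L1 ℕ →L[ℝ] ℂ :=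
  L1.lift (fun k => deriv (cosTerm k) θ) 4 fun k => by
    rw [deriv_cosTerm, norm_neg, norm_mul, norm_inv, norm_pow, Complex.norm_ofNat,
      inv_mul_le_iff₀ (by positivity)]
    have hk : (k + 1 : ℝ) ≤ 2 ^ (k + 1) := by exact_mod_cast (Nat.lt_two_pow_self (n := k + 1)).le
    have hs : ‖Complex.sin (2 * (k + 1) * θ)‖ ≤ 1 := by
      rw [show (2 * (k + 1) * θ : ℂ) = ((2 * (k + 1) * θ : ℝ) : ℂ) by push_cast; rfl,
        ← Complex.ofReal_sin, Complex.norm_real]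
      exact Real.abs_sin_le_one _
    have hn : ‖(4 * (k + 1) : ℂ)‖ = 4 * (k + 1) := by
      rw [show (4 * (k + 1) : ℂ) = ((4 * (k + 1) : ℝ) : ℂ) by push_cast; rfl, Complex.norm_real,
        Real.norm_of_nonneg (by positivity)]
    rw [norm_mul, hn]
    calc (4 * (k + 1) : ℝ) * ‖Complex.sin (2 * (k + 1) * θ)‖ ≤ 4 * 2 ^ (k + 1) * 1 := by gcongr
      _ = 2 ^ (k + 1) * 4 := by ring

theorem derivAt_unit (θ : ℝ) (k : ℕ) : derivAt θ (L1.unit k) = deriv (cosTerm k) θ :=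
  L1.lift_unit _ _

theorem derivAt_eq (θ : ℝ) (a : L1 ℕ) :
    derivAt θ a = ((deriv (onReal (cosSeries a)) θ : ℝ) : ℂ) := by
  rw [← deriv_cosSeries_ofReal]
  have h : HasSum (fun k => a k • deriv (cosTerm k) θ) (derivAt θ a) := L1.hasSum_lift _ a
  refine HasSum.unique (hasSum_of_forall_eq h fun k => ?_)
    (hasSum_deriv_cosSeries a (ofReal_mem_openStrip θ))
  rw [Complex.real_smul]

theorem eval_derivTail (u : L1 ℕ) (θ : ℝ) :
    eval (Circle.exp θ) (derivTail u) = -Complex.I * derivAt θ (shiftDiv u) := by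
  have h : eval (Circle.exp θ) ∘L derivTail =
      ContinuousLinearMap.mul ℝ ℂ (-Complex.I) ∘L derivAt θ ∘L shiftDiv := by
    refine L1.clm_ext fun k => ?_
    rw [ContinuousLinearMap.comp_apply, ContinuousLinearMap.comp_apply,
      ContinuousLinearMap.comp_apply, derivTail_unit, shiftDiv_unit, map_smul, map_smul, map_smul,
      eval_oddMode, circleExp_pow_sub_inv, derivAt_unit, deriv_cosTerm,
      ContinuousLinearMap.mul_apply']
    simp only [Complex.real_smul]
    have : (k + 1 : ℂ) ≠ 0 := by exact_mod_cast Nat.succ_ne_zero k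
    push_cast
    rw [show (k + 1 + 1 : ℂ) = k + 2 by ring]
    field_simp
    ring
  exact congrArg (fun T => T u) h

/-- The coefficients of the radius perturbation `r`. -/
def radiusCoeff (s Y : ℝ) (u : L1 ℕ) : L1 ℕ := s • ((2 * Y) • (L1.unit 0 : L1 ℕ) + s • shiftDiv u)

theorem smul_radius (s Y : ℝ) (u : L1 ℕ) :
    s • radius s Y u = evenSeries (radiusCoeff s Y u) := by
  rw [radiusCoeff, radius, map_smul, map_add, map_smul, map_smul, evenSeries_unit, cosTwo,
    smul_smul]
  congr 3
  norm_num
  ring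

theorem eval_radius (s Y : ℝ) (u : L1 ℕ) (θ : ℝ) : eval (Circle.exp θ) (s • radius s Y u) =
    (onReal (cosSeries (radiusCoeff s Y u)) θ : ℂ) := by
  rw [smul_radius, eval_evenSeries]

theorem eval_radiusDeriv (s Y : ℝ) (u : L1 ℕ) (θ : ℝ) :
    eval (Circle.exp θ) (s • radiusDeriv s Y u) =
      -Complex.I * ((deriv (onReal (cosSeries (radiusCoeff s Y u))) θ : ℝ) : ℂ) := by
  rw [← derivAt_eq, radiusCoeff, radiusDeriv]
  simp only [map_smul, map_add, eval_derivTail, derivAt_unit, deriv_cosTerm, eval_oddMode,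
    circleExp_pow_sub_inv, Complex.real_smul]
  push_cast
  ring_nf

/-! ### The divided difference of the curve and the regularity of the density -/

theorem one_sub_mul_eval₂_quotTail (ζ t : Circle) (u : L1 ℕ) :
    (1 - t : ℂ) * eval₂ ζ t (quotTail u) = eval ζ (evenSeries (shiftDiv u)) -
      t * eval (ζ * t) (evenSeries (shiftDiv u)) := by
  have h : ContinuousLinearMap.mul ℝ ℂ (1 - t : ℂ) ∘L eval₂ ζ t ∘L quotTail =
      (eval ζ - ContinuousLinearMap.mul ℝ ℂ (t : ℂ) ∘L eval (ζ * t)) ∘L evenSeries ∘L shiftDiv := by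
    refine L1.clm_ext fun k => ?_
    simp only [ContinuousLinearMap.comp_apply, quotTail_unit, shiftDiv_unit, map_smul,
      evenSeries_unit, ContinuousLinearMap.mul_apply', one_sub_mul_eval₂_quotMode, sub_apply]
    rw [smul_comm]
  exact congrArg (fun T => T u) h

theorem eval₂_one_quotTail (θ : ℝ) (u : L1 ℕ) : eval₂ (Circle.exp θ) 1 (quotTail u) =
    eval (Circle.exp θ) (evenSeries (shiftDiv u)) + eval (Circle.exp θ) (derivTail u) := by
  have h : eval₂ (Circle.exp θ) 1 ∘L quotTail =
      eval (Circle.exp θ) ∘L (evenSeries ∘L shiftDiv + derivTail) := by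
    refine L1.clm_ext fun k => ?_
    have : (k + 1 : ℝ) ≠ 0 := by positivity
    simp only [ContinuousLinearMap.comp_apply, quotTail_unit, shiftDiv_unit, map_smul, map_add,
      evenSeries_unit, derivTail_unit, add_apply, eval₂_one_quotMode]
    push_cast
    match_scalars
    · field_simp
    · field_simp
      ring
  have := congrArg (fun T => T u) h
  simpa using this

/-- The strength `2 + s + g` at the second point. -/
def strength₂ (s : ℝ) (g : L1 ℕ) : Alg₂ := (2 + s) • (1 : Alg₂) + s ^ 2 • subst (evenSeries g)

theorem eval₂_strength₂ (s : ℝ) (g : L1 ℕ) (θ τ : ℝ) :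
    eval₂ (Circle.exp θ) (Circle.exp τ) (strength₂ s g) =
      ((2 + s + onReal (cosSeries (s ^ 2 • g)) (θ + τ) : ℝ) : ℂ) := by
  rw [strength₂, map_add, map_smul, ← map_smul subst, ← map_smul evenSeries, eval₂_one, eval₂_subst,
    ← Circle.exp_add, eval_evenSeries, Complex.real_smul]
  push_cast
  ring

theorem one_sub_mul_eval₂_quot (s Y : ℝ) (u : L1 ℕ) (θ τ : ℝ) :
    (1 - Circle.exp τ : ℂ) * eval₂ (Circle.exp θ) (Circle.exp τ) (1 + s • quot s Y u) =
      (1 + onReal (cosSeries (radiusCoeff s Y u)) θ) -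
        Circle.exp τ * (1 + onReal (cosSeries (radiusCoeff s Y u)) (θ + τ)) := by
  rw [← eval_radius, ← eval_radius, Circle.exp_add, quot, radius, cosTwo, map_add, eval₂_one]
  simp only [map_smul, map_add, Complex.real_smul]
  linear_combination (s * Y : ℂ) * one_sub_mul_eval₂_quotMode (Circle.exp θ) (Circle.exp τ) 0 +
    (s * s : ℂ) * one_sub_mul_eval₂_quotTail (Circle.exp θ) (Circle.exp τ) u

theorem eval₂_one_quot (s Y : ℝ) (u : L1 ℕ) (θ : ℝ) :
    eval₂ (Circle.exp θ) 1 (1 + s • quot s Y u) =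
      1 + onReal (cosSeries (radiusCoeff s Y u)) θ -
        Complex.I * ((deriv (onReal (cosSeries (radiusCoeff s Y u))) θ : ℝ) : ℂ) := by
  have h := eval_radiusDeriv s Y u θ
  rw [neg_mul] at h
  rw [sub_eq_add_neg, ← h, ← eval_radius, quot, radius, radiusDeriv, cosTwo, map_add, eval₂_one]
  simp only [map_smul, map_add, Complex.real_smul, eval₂_one_quotTail, eval₂_one_quotMode]
  push_cast
  ring

/-- Both the strength and the divided difference are Lipschitz at t = 1. The identity p(t) - p(1) =
p(t)p(1)(Q(1) - Q(t)) transfers this to the inverse, with evaluations bounded by norms in the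
algebra. -/
theorem exists_lipschitz (s Y : ℝ) (g u : L1 ℕ) (hu : IsUnit (1 + s • quot s Y u)) (θ : ℝ) :
    ∃ C : ℝ, 0 ≤ C ∧ ∀ t : Circle,
      ‖eval₂ (Circle.exp θ) t (strength₂ s g * quotInv s Y u) -
        eval₂ (Circle.exp θ) 1 (strength₂ s g * quotInv s Y u)‖ ≤ C * ‖(t : ℂ) - 1‖ := by
  set ζ := Circle.exp θ
  set p := quotInv s Y u with hp
  have hqp (t : Circle) : eval₂ ζ t (1 + s • quot s Y u) * eval₂ ζ t p = 1 := by
    rw [← eval₂_mul, hp, quotInv, Ring.mul_inverse_cancel _ hu, eval₂_one]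
  have hγ (t : Circle) : ‖eval₂ ζ t (strength₂ s g) - eval₂ ζ 1 (strength₂ s g)‖ ≤
      s ^ 2 * (4 * ‖(t : ℂ) - 1‖ * ‖g‖) := by
    have := norm_eval_mul_sub_le ζ t g
    rw [strength₂, map_add, map_add, map_smul, map_smul, map_smul, map_smul, eval₂_one, eval₂_one,
      eval₂_subst, eval₂_subst, mul_one, add_sub_add_left_eq_sub, ← smul_sub, norm_smul,
      Real.norm_of_nonneg (sq_nonneg s)]
    gcongr
  have hq (t : Circle) : ‖eval₂ ζ 1 (1 + s • quot s Y u) - eval₂ ζ t (1 + s • quot s Y u)‖ ≤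
      (|s| * |Y| * 18 + |s| * |s| * 50 * ‖u‖) * ‖(t : ℂ) - 1‖ := by
    have h₁ := norm_eval₂_quotMode_sub_le ζ t 0
    have h₂ := norm_eval₂_quotTail_sub_le ζ t u
    rw [norm_sub_rev]
    have e : eval₂ ζ t (1 + s • quot s Y u) - eval₂ ζ 1 (1 + s • quot s Y u) =
        (s * Y) • (eval₂ ζ t (quotMode 0) - eval₂ ζ 1 (quotMode 0)) +
          (s * s) • (eval₂ ζ t (quotTail u) - eval₂ ζ 1 (quotTail u)) := by
      simp only [quot, map_add, map_smul, eval₂_one]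
      module
    rw [e]
    refine (norm_add_le _ _).trans ?_
    rw [norm_smul, norm_smul, norm_mul, norm_mul, Real.norm_eq_abs, Real.norm_eq_abs]
    calc |s| * |Y| * ‖eval₂ ζ t (quotMode 0) - eval₂ ζ 1 (quotMode 0)‖ +
          |s| * |s| * ‖eval₂ ζ t (quotTail u) - eval₂ ζ 1 (quotTail u)‖
        ≤ |s| * |Y| * (2 * (2 * (0 : ℕ) + 3) ^ 2 * ‖(t : ℂ) - 1‖) +
          |s| * |s| * (50 * ‖(t : ℂ) - 1‖ * ‖u‖) := by gcongr
      _ = _ := by push_cast; ring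
  refine ⟨s ^ 2 * 4 * ‖g‖ * ‖p‖ + ‖strength₂ s g‖ * (‖p‖ * ‖p‖ *
    (|s| * |Y| * 18 + |s| * |s| * 50 * ‖u‖)), by positivity, fun t => ?_⟩
  have e : eval₂ ζ t (strength₂ s g * p) - eval₂ ζ 1 (strength₂ s g * p) =
      (eval₂ ζ t (strength₂ s g) - eval₂ ζ 1 (strength₂ s g)) * eval₂ ζ t p +
        eval₂ ζ 1 (strength₂ s g) * (eval₂ ζ t p * eval₂ ζ 1 p *
          (eval₂ ζ 1 (1 + s • quot s Y u) - eval₂ ζ t (1 + s • quot s Y u))) := by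
    rw [eval₂_mul, eval₂_mul]
    linear_combination eval₂ ζ 1 (strength₂ s g) * eval₂ ζ 1 p * hqp t -
      eval₂ ζ 1 (strength₂ s g) * eval₂ ζ t p * hqp 1
  rw [e]
  refine (norm_add_le _ _).trans ?_
  rw [norm_mul, norm_mul, norm_mul, norm_mul]
  calc _ ≤ s ^ 2 * (4 * ‖(t : ℂ) - 1‖ * ‖g‖) * ‖p‖ + ‖strength₂ s g‖ * (‖p‖ * ‖p‖ *
        ((|s| * |Y| * 18 + |s| * |s| * 50 * ‖u‖) * ‖(t : ℂ) - 1‖)) := by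
        gcongr
        · exact hγ t
        · exact norm_eval₂_le _ _ _
        · exact norm_eval₂_le _ _ _
        · exact norm_eval₂_le _ _ _
        · exact norm_eval₂_le _ _ _
        · exact hq t
    _ = _ := by ring

/-- The modulus squared of R - e^{iτ}S is the squared distance of the two points of the curve, so
multiplication by the conjugate gives both kernels at once. If it vanishes, both sides are 0 by
convention. -/
theorem div_re_im_formula (a R S γ τ : ℝ) :
    ((a + Complex.I * R) * γ / (R - Circle.exp τ * S) : ℂ) =
      ((γ * ((a * (R - S * Real.cos τ) - R * S * Real.sin τ) /
        (R ^ 2 + S ^ 2 - 2 * R * S * Real.cos τ)) : ℝ) : ℂ) +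
      ((γ * ((R * (R - S * Real.cos τ) + a * S * Real.sin τ) /
        (R ^ 2 + S ^ 2 - 2 * R * S * Real.cos τ)) : ℝ) : ℂ) * Complex.I := by
  have hN : (R - Circle.exp τ * S : ℂ) =
      ((R - S * Real.cos τ : ℝ) : ℂ) + ((-(S * Real.sin τ) : ℝ) : ℂ) * Complex.I := by
    rw [Circle.coe_exp, Complex.exp_mul_I]
    push_cast
    ring
  have hD : Complex.normSq (R - Circle.exp τ * S : ℂ) =
      R ^ 2 + S ^ 2 - 2 * R * S * Real.cos τ := by
    rw [hN, Complex.normSq_add_mul_I]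
    linear_combination S ^ 2 * Real.sin_sq_add_cos_sq τ
  rw [div_eq_mul_inv, Complex.inv_def, hD, hN, map_add, map_mul, Complex.conj_ofReal,
    Complex.conj_ofReal, Complex.conj_I]
  push_cast
  rw [div_eq_mul_inv, div_eq_mul_inv]
  linear_combination (-R * S * Complex.sin τ * γ *
    (R ^ 2 + S ^ 2 - 2 * R * S * Complex.cos τ : ℂ)⁻¹) * -Complex.I_sq

/-! ### Solutions of the rescaled equation solve the vortex sheet equations -/

/-- The perturbation `r` of the radius. -/
def radiusFun (s Y : ℝ) (u : L1 ℕ) : ℝ → ℝ := onReal (cosSeries (radiusCoeff s Y u))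

/-- The perturbation `g` of the strength. -/
def strengthFun (s : ℝ) (g : L1 ℕ) : ℝ → ℝ := onReal (cosSeries (s ^ 2 • g))

/-- The factor `r'(θ) + i (1 + r(θ))` in front of the complex velocity. -/
def tangent (s Y : ℝ) (u : L1 ℕ) (θ : ℝ) : ℂ :=
  (deriv (radiusFun s Y u) θ : ℝ) + Complex.I * (1 + radiusFun s Y u θ : ℝ)

/-- The product of the strength and the inverse of the divided difference of the curve. -/
def density (s Y : ℝ) (g u : L1 ℕ) : Alg₂ := strength₂ s g * quotInv s Y u

section

variable {s ν Y : ℝ} {g u : L1 ℕ}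

theorem eval₂_quotInv (hu : IsUnit (1 + s • quot s Y u)) (ζ t : Circle) :
    eval₂ ζ t (quotInv s Y u) = (eval₂ ζ t (1 + s • quot s Y u))⁻¹ := by
  refine eq_inv_of_mul_eq_one_right ?_
  rw [← eval₂_mul, quotInv, Ring.mul_inverse_cancel _ hu, eval₂_one]

/-- The diagonal value of the divided difference is 1 + r - ir', and i times it is the tangent
factor. The residue at t = 1 is therefore purely imaginary, as the kernel lemmas require. -/
theorem tangent_mul_eval₂_density (hu : IsUnit (1 + s • quot s Y u)) (θ : ℝ) :
    tangent s Y u θ * eval₂ (Circle.exp θ) 1 (density s Y g u) =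
      Complex.I * ((2 + s + strengthFun s g θ : ℝ) : ℂ) := by
  have h₀ := eval₂_strength₂ s g θ 0
  rw [Circle.exp_zero, add_zero] at h₀
  have h₁ : tangent s Y u θ = Complex.I * eval₂ (Circle.exp θ) 1 (1 + s • quot s Y u) := by
    rw [eval₂_one_quot, tangent, radiusFun]
    push_cast
    linear_combination ((deriv (onReal (cosSeries (radiusCoeff s Y u))) θ : ℝ) : ℂ) *
      Complex.I_sq
  have h₂ : eval₂ (Circle.exp θ) 1 (1 + s • quot s Y u) *
      eval₂ (Circle.exp θ) 1 (quotInv s Y u) = 1 := by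
    rw [← eval₂_mul, quotInv, Ring.mul_inverse_cancel _ hu, eval₂_one]
  rw [density, eval₂_mul, h₀, h₁, strengthFun]
  linear_combination Complex.I * ((2 + s + onReal (cosSeries (s ^ 2 • g)) θ : ℝ) : ℂ) * h₂

/-- The factor R - tS equals (1 - t)Q, so the quotient computed in `div_re_im_formula` is the series
kernel. At t = 1 all quotients are 0 by convention, and no restriction on τ is needed. -/
theorem kernel_eq (hu : IsUnit (1 + s • quot s Y u)) (θ τ : ℝ) :
    tangent s Y u θ * eval₂ (Circle.exp θ) (Circle.exp τ) (density s Y g u) /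
        (1 - Circle.exp τ) =
      ((-kernel₁ (2 + s) (strengthFun s g) (radiusFun s Y u) θ (θ + τ) : ℝ) : ℂ) +
        ((kernel₂ (2 + s) (strengthFun s g) (radiusFun s Y u) θ (θ + τ) : ℝ) : ℂ) *
          Complex.I := by
  have h := div_re_im_formula (deriv (radiusFun s Y u) θ) (1 + radiusFun s Y u θ)
    (1 + radiusFun s Y u (θ + τ)) (2 + s + strengthFun s g (θ + τ)) τ
  have hN : ((1 + radiusFun s Y u θ : ℝ) - Circle.exp τ * (1 + radiusFun s Y u (θ + τ) : ℝ) : ℂ) =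
      (1 - Circle.exp τ) * eval₂ (Circle.exp θ) (Circle.exp τ) (1 + s • quot s Y u) := by
    rw [one_sub_mul_eval₂_quot, radiusFun]
    push_cast
    rfl
  rw [hN] at h
  have hk : θ - (θ + τ) = -τ := by ring
  rw [density, eval₂_mul, eval₂_quotInv hu, eval₂_strength₂, kernel₁, kernel₂, distSq, hk,
    Real.cos_neg, Real.sin_neg]
  rw [tangent, ← strengthFun]
  refine Eq.trans ?_ (h.trans ?_)
  · rw [div_eq_mul_inv, div_eq_mul_inv, mul_inv]
    ring
  · congr 2
    · rw [← mul_neg, ← neg_div]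
      congr 3
      ring
    · congr 3
      ring

theorem kernel₁_eq (hu : IsUnit (1 + s • quot s Y u)) (θ η : ℝ) :
    kernel₁ (2 + s) (strengthFun s g) (radiusFun s Y u) θ η =
      -(tangent s Y u θ * eval₂ (Circle.exp θ) (Circle.exp (η - θ)) (density s Y g u) /
        (1 - Circle.exp (η - θ))).re := by
  rw [kernel_eq hu, add_sub_cancel, Complex.add_re, Complex.re_ofReal_mul, Complex.ofReal_re,
    Complex.I_re, mul_zero, add_zero, neg_neg]

theorem kernel₂_eq (hu : IsUnit (1 + s • quot s Y u)) (θ η : ℝ) :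
    kernel₂ (2 + s) (strengthFun s g) (radiusFun s Y u) θ η =
      (tangent s Y u θ * eval₂ (Circle.exp θ) (Circle.exp (η - θ)) (density s Y g u) /
        (1 - Circle.exp (η - θ))).im := by
  rw [kernel_eq hu, add_sub_cancel, Complex.add_im, Complex.im_ofReal_mul, Complex.ofReal_im,
    Complex.I_im, mul_one, zero_add]

theorem integrableOn_puncturedPeriod {f : ℝ → ℝ} {θ ε : ℝ} (hf : IntegrableOn f (punctured ε)) :
    IntegrableOn (fun η => f (η - θ)) (puncturedPeriod θ ε) :=
  ((measurePreserving_sub_right volume θ).integrableOn_comp_preimage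
    (MeasurableEquiv.subRight θ).measurableEmbedding).2 hf

theorem setIntegral_puncturedPeriod (f : ℝ → ℝ) (θ ε : ℝ) :
    ∫ η in puncturedPeriod θ ε, f (η - θ) = ∫ τ in punctured ε, f τ :=
  (measurePreserving_sub_right volume θ).setIntegral_preimage_emb
    (MeasurableEquiv.subRight θ).measurableEmbedding f (punctured ε)

theorem pvExists_kernel₁ (hu : IsUnit (1 + s • quot s Y u)) (θ : ℝ) :
    PVExists (kernel₁ (2 + s) (strengthFun s g) (radiusFun s Y u) θ) θ ∧
      pvMean (kernel₁ (2 + s) (strengthFun s g) (radiusFun s Y u) θ) θ =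
        -(tangent s Y u θ * eval (Circle.exp θ) (pvOp (density s Y g u))).re := by
  obtain ⟨C, hC, hLip⟩ := exists_lipschitz s Y g u hu θ
  have hκ := tangent_mul_eval₂_density (g := g) hu θ
  have hk : kernel₁ (2 + s) (strengthFun s g) (radiusFun s Y u) θ = fun η =>
      -(tangent s Y u θ * eval₂ (Circle.exp θ) (Circle.exp (η - θ)) (density s Y g u) /
        (1 - Circle.exp (η - θ))).re := funext (kernel₁_eq hu θ)
  have hlim : Tendsto (truncMean (kernel₁ (2 + s) (strengthFun s g) (radiusFun s Y u) θ) θ) (𝓝[>] 0)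
      (𝓝 (-(tangent s Y u θ * eval (Circle.exp θ) (pvOp (density s Y g u))).re)) := by
    refine (tendsto_kernel_re hC hκ hLip).neg.congr fun ε => ?_
    rw [truncMean, hk, integral_neg, setIntegral_puncturedPeriod (fun τ => (tangent s Y u θ *
      eval₂ (Circle.exp θ) (Circle.exp τ) (density s Y g u) / (1 - Circle.exp τ)).re), mul_neg]
  refine ⟨⟨fun ε hε => ?_, _, hlim⟩, hlim.limUnder_eq⟩
  rw [hk]
  exact (integrableOn_puncturedPeriod (integrableOn_kernel_re hC hκ hLip hε)).neg

theorem integrable_kernel₂ (hu : IsUnit (1 + s • quot s Y u)) (θ : ℝ) :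
    IntervalIntegrable (kernel₂ (2 + s) (strengthFun s g) (radiusFun s Y u) θ) volume
        (-Real.pi) Real.pi ∧
      mean (kernel₂ (2 + s) (strengthFun s g) (radiusFun s Y u) θ) =
        (tangent s Y u θ * eval (Circle.exp θ) (pvOp (density s Y g u))).im := by
  obtain ⟨C, hC, hLip⟩ := exists_lipschitz s Y g u hu θ
  have hκ := tangent_mul_eval₂_density (g := g) hu θ
  set K : ℝ → ℝ := fun τ => (tangent s Y u θ * eval₂ (Circle.exp θ) (Circle.exp τ)
    (density s Y g u) / (1 - Circle.exp τ)).im with hK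
  have hk : kernel₂ (2 + s) (strengthFun s g) (radiusFun s Y u) θ = fun η => K (η - θ) :=
    funext (kernel₂_eq hu θ)
  have hper : Function.Periodic K (2 * Real.pi) := fun τ => by
    simp only [hK, Circle.exp_add, Circle.exp_two_pi, mul_one]
  have hInt : IntervalIntegrable K volume (-Real.pi) (-Real.pi + 2 * Real.pi) := by
    have := intervalIntegrable_kernel_im hC hκ hLip
    rwa [show -Real.pi + 2 * Real.pi = Real.pi by ring]
  constructor
  · rw [hk]
    have := (hper.intervalIntegrable (by positivity) hInt (-Real.pi - θ)
      (Real.pi - θ)).comp_sub_right θ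
    simpa using this
  · rw [← integral_kernel_im hC hκ hLip, mean, hk, intervalIntegral.integral_comp_sub_right,
      show Real.pi - θ = -Real.pi - θ + 2 * Real.pi by ring,
      hper.intervalIntegral_add_eq (-Real.pi - θ) (-Real.pi),
      show -Real.pi + 2 * Real.pi = Real.pi by ring]

theorem eval_equation (hu : IsUnit (1 + s • quot s Y u))
    (heq : leading ν Y g u + s • remainder s ν Y g u = 0) (θ : ℝ) :
    ((2 + s + strengthFun s g θ : ℝ) : ℂ) * (eval (Circle.exp θ) (pvOp (density s Y g u)) -
        (1 + radiusFun s Y u θ : ℝ)) =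
      ((s * (1 + s * ν) : ℝ) : ℂ) * ((1 + radiusFun s Y u θ : ℝ) +
        Complex.I * (deriv (radiusFun s Y u) θ : ℝ)) := by
  have h := congrArg (eval (Circle.exp θ)) (equation_expansion (ν := ν) (g := g) hu)
  have hg : eval (Circle.exp θ) ((2 + s) • (1 : Alg) + s ^ 2 • evenSeries g) =
      ((2 + s + strengthFun s g θ : ℝ) : ℂ) := by
    rw [map_add, ← map_smul evenSeries, eval_evenSeries, map_smul, eval_one, Complex.real_smul,
      strengthFun]
    push_cast
    ring
  rw [heq, smul_zero, map_zero, map_sub, eval_mul, hg, map_sub, map_smul,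
    map_sub (eval (Circle.exp θ)) (1 + s • radius s Y u), map_add, eval_one, eval_radius,
    eval_radiusDeriv, Complex.real_smul] at h
  rw [density, strength₂, radiusFun]
  push_cast at h ⊢
  linear_combination h

/-- Multiplication of the complex equation by r' + i(1 + r) makes its right side i·λ(r'² + (1 +
r)²), with λ = s(1 + sν), because (1 + r + ir')(r' + i(1 + r)) is purely imaginary. The real part is
then the first equation, and the imaginary part says that 𝓕̃₂ equals the constant λ, which I - P₀
removes. -/
theorem isSolution (hu : IsUnit (1 + s • quot s Y u))
    (heq : leading ν Y g u + s • remainder s ν Y g u = 0)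
    (hr : ∀ θ, 0 < 1 + radiusFun s Y u θ) (hg : ∀ θ, 0 < 2 + s + strengthFun s g θ) :
    IsSolution 1 (2 + s) (strengthFun s g) (radiusFun s Y u) := by
  have key (θ : ℝ) : ((2 + s + strengthFun s g θ : ℝ) : ℂ) * (tangent s Y u θ *
      eval (Circle.exp θ) (pvOp (density s Y g u))) =
      (((2 + s + strengthFun s g θ) *
        (deriv (radiusFun s Y u) θ * (1 + radiusFun s Y u θ)) : ℝ) : ℂ) +
      (((2 + s + strengthFun s g θ) * (1 + radiusFun s Y u θ) ^ 2 + s * (1 + s * ν) *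
        (deriv (radiusFun s Y u) θ ^ 2 + (1 + radiusFun s Y u θ) ^ 2) : ℝ) : ℂ) * Complex.I := by
    have h := eval_equation hu heq θ
    rw [tangent]
    push_cast at h ⊢
    linear_combination ((deriv (radiusFun s Y u) θ : ℝ) + Complex.I * (1 + radiusFun s Y u θ)) * h +
      s * (1 + s * ν) * ((deriv (radiusFun s Y u) θ : ℝ) * (1 + radiusFun s Y u θ)) * Complex.I_sq
  have hre (θ : ℝ) : (tangent s Y u θ * eval (Circle.exp θ) (pvOp (density s Y g u))).re =
      deriv (radiusFun s Y u) θ * (1 + radiusFun s Y u θ) := by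
    have h := congrArg Complex.re (key θ)
    rw [Complex.re_ofReal_mul, Complex.add_re, Complex.re_ofReal_mul, Complex.ofReal_re,
      Complex.I_re, mul_zero, add_zero] at h
    -- The first equation appears multiplied by the strength, which must be nonzero to be cancelled.
    exact mul_left_cancel₀ (hg θ).ne' h
  have him (θ : ℝ) : (2 + s + strengthFun s g θ) *
      (tangent s Y u θ * eval (Circle.exp θ) (pvOp (density s Y g u))).im =
      (2 + s + strengthFun s g θ) * (1 + radiusFun s Y u θ) ^ 2 + s * (1 + s * ν) *
        (deriv (radiusFun s Y u) θ ^ 2 + (1 + radiusFun s Y u θ) ^ 2) := by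
    have h := congrArg Complex.im (key θ)
    rwa [Complex.im_ofReal_mul, Complex.add_im, Complex.im_ofReal_mul, Complex.ofReal_im,
      Complex.I_im, mul_one, zero_add] at h
  have htilde : F₂tilde 1 (2 + s) (strengthFun s g) (radiusFun s Y u) =
      fun _ => s * (1 + s * ν) := by
    funext θ
    have hpos : 0 < deriv (radiusFun s Y u) θ ^ 2 + (1 + radiusFun s Y u θ) ^ 2 := by
      have := hr θ
      positivity
    rw [F₂tilde, (integrable_kernel₂ hu θ).2, one_mul, ← sub_mul, mul_div_assoc',
      div_eq_iff hpos.ne']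
    linear_combination him θ
  refine ⟨hr, fun θ => (pvExists_kernel₁ hu θ).1, fun θ => (integrable_kernel₂ hu θ).1, ?_,
    fun θ => ?_, fun θ => ?_⟩
  · rw [htilde]
    exact intervalIntegrable_const
  · rw [F₁, (pvExists_kernel₁ hu θ).2, hre]
    ring
  · rw [F₂, htilde, mean, intervalIntegral.integral_const, smul_eq_mul]
    have := Real.pi_ne_zero
    field_simp
    ring

end

/-! ### The branches of solutions -/

theorem radiusFun_pos {s Y : ℝ} {u : L1 ℕ} (h : 2 * ‖radiusCoeff s Y u‖ < 1) (θ : ℝ) :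
    0 < 1 + radiusFun s Y u θ := by
  have := abs_onReal_cosSeries_le (radiusCoeff s Y u) θ
  have := neg_abs_le (onReal (cosSeries (radiusCoeff s Y u)) θ)
  rw [radiusFun]
  linarith

theorem strengthFun_pos {s : ℝ} {g : L1 ℕ} (hs : -1 < s) (h : 2 * ‖s ^ 2 • g‖ < 1) (θ : ℝ) :
    0 < 2 + s + strengthFun s g θ := by
  have := abs_onReal_cosSeries_le (s ^ 2 • g) θ
  have := neg_abs_le (onReal (cosSeries (s ^ 2 • g)) θ)
  rw [strengthFun]
  linarith

theorem radiusCoeff_zero (s Y : ℝ) (u : L1 ℕ) : radiusCoeff s Y u 0 = s * (2 * Y) := by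
  rw [radiusCoeff, L1.smul_coord, L1.add_coord, L1.smul_coord, L1.smul_coord, shiftDiv_coord_zero,
    unit_coord]
  simp

theorem continuousAt_radiusCoeff {Y : ℝ → ℝ} {u : ℝ → L1 ℕ} {x : ℝ} (hY : ContinuousAt Y x)
    (hu : ContinuousAt u x) : ContinuousAt (fun s => radiusCoeff s (Y s) (u s)) x := by
  have := shiftDiv.continuous.continuousAt.comp' hu
  unfold radiusCoeff
  fun_prop

theorem eventually_isUnit {Y : ℝ → ℝ} {u : ℝ → L1 ℕ} (hY : ContinuousAt Y 0)
    (hu : ContinuousAt u 0) : ∀ᶠ s in 𝓝 (0 : ℝ), IsUnit (1 + s • quot s (Y s) (u s)) := by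
  have := quotTail.continuous.continuousAt.comp' hu
  have hc : ContinuousAt (fun s => 1 + s • quot s (Y s) (u s)) 0 := by
    unfold quot
    fun_prop
  refine hc.eventually (Units.isOpen.mem_nhds ?_)
  simp

end VortexSheet

end

/-! ### Assembly of the bifurcating curves -/

open VortexSheet

theorem theorem2p2 :
    ∃ c₀ : ℝ, 0 < c₀ ∧ ∀ k : ℕ, 3 ≤ k → ∀ c : ℝ, 0 < c → c < c₀ →
      ∀ m : ℝ, 1 - 4 * m ^ 2 = 0 →
        ∃ (δ : ℝ) (g r : ℝ → ℂ → ℂ), 0 < δ ∧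
          g 0 = 0 ∧ r 0 = 0 ∧
          (∀ x ∈ Set.Ioo (-δ) δ,
            g x ∈ VortexSheet.X k c ∧ r x ∈ VortexSheet.X (k + 1) c ∧
            VortexSheet.IsSolution 1 (2 + x)
              (VortexSheet.onReal (g x)) (VortexSheet.onReal (r x))) ∧
          (∀ x ∈ Set.Ioo (-δ) δ,
            Filter.Tendsto (fun y => VortexSheet.stripNormSq k c (g y - g x))
              (nhds x) (nhds 0) ∧
            Filter.Tendsto (fun y => VortexSheet.stripNormSq (k + 1) c (r y - r x))
              (nhds x) (nhds 0)) ∧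
          (∀ x ∈ Set.Ioo (-δ) δ, x ≠ 0 →
            VortexSheet.onReal (g x) ≠ 0 ∨ VortexSheet.onReal (r x) ≠ 0) ∧
          Filter.Tendsto (fun x => VortexSheet.modeTwo (VortexSheet.onReal (r x)) / x)
            (nhdsWithin 0 {0}ᶜ) (nhds m) := by
  refine ⟨Real.log 2 / 4, by positivity, fun k _ c hc₀ hc m hm => ?_⟩
  -- The mode e = 2 cos 2θ gives r the cos 2θ coefficient 2sY, so slope m corresponds to Y = m/2 and
  -- 4m² = 1 to 16Y² = 1.
  obtain ⟨ψ, hψ₀, hcont, heq⟩ := exists_branch (Y := m / 2) (by linarith)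
  set Y : ℝ → ℝ := fun x => (ψ x).2.1 with hY
  set ĝ : ℝ → L1 ℕ := fun x => (ψ x).2.2.1 with hĝ
  set u : ℝ → L1 ℕ := fun x => (ψ x).2.2.2 with hu
  have hYc {x : ℝ} (h : ContinuousAt ψ x) : ContinuousAt Y x := h.snd.fst
  have hgc {x : ℝ} (h : ContinuousAt ψ x) : ContinuousAt (fun s => s ^ 2 • ĝ s) x :=
    ((continuous_pow 2).continuousAt).smul h.snd.snd.fst
  have huc {x : ℝ} (h : ContinuousAt ψ x) : ContinuousAt u x := h.snd.snd.snd
  have hrc {x : ℝ} (h : ContinuousAt ψ x) : ContinuousAt (fun s => radiusCoeff s (Y s) (u s)) x :=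
    continuousAt_radiusCoeff (hYc h) (huc h)
  have h₀ : ContinuousAt ψ 0 := hcont.self_of_nhds
  have hY₀ : Y 0 = m / 2 := by
    simp only [hY, hψ₀, basePoint]
  have hm₀ : m ≠ 0 := by
    rintro rfl
    norm_num at hm
  have hmode (x : ℝ) : modeTwo (onReal (cosSeries (radiusCoeff x (Y x) (u x)))) =
      x * (2 * Y x) := by
    rw [modeTwo_cosSeries, radiusCoeff_zero]
  have hg_small : ∀ᶠ x in 𝓝 (0 : ℝ), 2 * ‖x ^ 2 • ĝ x‖ < 1 := by
    refine ((hgc h₀).norm.const_mul 2).eventually_lt continuousAt_const ?_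
    simp
  have hr_small : ∀ᶠ x in 𝓝 (0 : ℝ), 2 * ‖radiusCoeff x (Y x) (u x)‖ < 1 := by
    refine ((hrc h₀).norm.const_mul 2).eventually_lt continuousAt_const ?_
    simp [radiusCoeff]
  have hY_ne : ∀ᶠ x in 𝓝 (0 : ℝ), Y x ≠ 0 :=
    (hYc h₀).eventually_ne (by rw [hY₀]; exact div_ne_zero hm₀ two_ne_zero)
  obtain ⟨δ, hδ, hball⟩ := Metric.eventually_nhds_iff_ball.1 (hcont.and (heq.and
    ((eventually_isUnit (hYc h₀) (huc h₀)).and (hg_small.and (hr_small.and (hY_ne.and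
      (eventually_gt_nhds (show (-1 : ℝ) < 0 by norm_num))))))))
  have hall : ∀ x ∈ Set.Ioo (-δ) δ, _ := fun x hx => hball x (by
    rwa [Real.ball_eq_Ioo, zero_sub, zero_add])
  refine ⟨δ, fun x => cosSeries (x ^ 2 • ĝ x), fun x => cosSeries (radiusCoeff x (Y x) (u x)), hδ,
    ?_, ?_, fun x hx => ?_, fun x hx => ?_, fun x hx hx₀ => Or.inr fun h => ?_, ?_⟩
  · simp [cosSeries_zero]
  · simp [radiusCoeff, cosSeries_zero]
  · obtain ⟨-, hx₁, hx₂, hx₃, hx₄, -, hx₅⟩ := hall x hx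
    exact ⟨cosSeries_mem_X _ k hc₀ hc, cosSeries_mem_X _ (k + 1) hc₀ hc,
      isSolution hx₂ hx₁ (radiusFun_pos hx₄) (strengthFun_pos hx₅ hx₃)⟩
  · have hx₁ := (hall x hx).1
    exact ⟨tendsto_stripNormSq_cosSeries (hgc hx₁) k hc₀ hc,
      tendsto_stripNormSq_cosSeries (hrc hx₁) (k + 1) hc₀ hc⟩
  -- Nontriviality is read off from the cos 2θ coefficient 2xY(x) of r, nonzero because Y stays near
  -- m/2.
  · have hne := (hall x hx).2.2.2.2.2.1
    have h₁ := hmode x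
    simp only at h
    rw [h] at h₁
    simp [modeTwo, hx₀, hne] at h₁
  · have hlim : Tendsto (fun x => 2 * Y x) (𝓝[≠] 0) (𝓝 m) := by
      have := ((hYc h₀).tendsto.const_mul 2).mono_left (nhdsWithin_le_nhds (s := {0}ᶜ))
      rwa [hY₀, mul_div_cancel₀ _ two_ne_zero] at this
    refine hlim.congr' ?_
    filter_upwards [self_mem_nhdsWithin] with x hx
    rw [hmode, mul_div_cancel_left₀ _ hx]
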